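/- Let $d\ge 1$. For $V=\mathbb R^n$, a Schwartz window $g\in\mathcal S(V)$, $g\neq0$, and $f\in\mathcal S'(V)$ put $V_gf(x,\xi)=\langle f, M_\xi T_x g\rangle$, where $M_\xi T_xg(t)=e^{2\pi i\xi\cdot t}g(t-x)$ and $\langle\cdot,\cdot\rangle$ extends $\int f\bar g$. For $1\le p,q\le\infty$ and weights $m$ on $V\times V$, $w$ on $V$, let $$\|f\|_{M^{p,q}_m}=\Big(\int\Big(\int |V_gf(x,\xi)|^p m(x,\xi)^p\,dx\Big)^{q/p}d\xi\Big)^{1/q},\qquad \|f\|_{W(\mathcal FL^p,L^q_w)}=\Big(\int\Big(\int |V_gf(x,\xi)|^p\,d\xi\Big)^{q/p}w(x)^q\,dx\Big)^{1/q}$$ (with suprema for infinite exponents); $M^{p,q}_m$ and $W(\mathcal FL^p,L^q_w)$ consist of the $f\in\mathcal S'(V)$ with finite norm, $M^p_m=M^{p,p}_m$, and the weight is omitted when it is $1$. The norms may be computed with any fixed nonzero Schwartz windows. Let $v_s(z)=(1+|z|^2)^{s/2}$ for $z\in\mathbb R^{2d}$. For $f_1,f_2\in\mathcal S(\mathbb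 R^d)$ let $V_{f_1}f_2(x,\xi)=\int f_2(t)\overline{f_1(t-x)}e^{-2\pi i\xi\cdot t}dt\in\mathcal S(\mathbb R^{2d})$, and for $f_1,f_2\in\mathcal S'(\mathbb R^d)$ let $V_{f_1}f_2\in\mathcal S'(\mathbb R^{2d})$ be its extension by duality, that is, the unique tempered distribution with $\langle V_{f_1}f_2,V_\varphi\psi\rangle=\langle f_2,\psi\rangle\overline{\langle f_1,\varphi\rangle}$ for all $\varphi,\psi\in\mathcal S(\mathbb R^d)$. Let $p_1,p_2,p,q\in[1,\infty]$ and consider the condition $$p_1,p_2\le q,\qquad \frac1{p_1}+\frac1{p_2}\ge\frac1p+\frac1q.\tag{$*$}$$ (i) If $(*)$ holds, then for every $s\in\mathbb R$ there is a constant $C$ such that for all $f_1\in M^{p_1}_{v_{|s|}}(\mathbb R^d)$ and $f_2\in M^{p_2}_{v_s}(\mathbb R^d)$ the distribution $V_{f_1}f_2$ exists (and is unique), belongs to $W(\mathcal FL^p,L^q_{v_s})(\mathbb R^{2d})$, and $$\|V_{f_1}f_2\|_{W(\mathcal FL^p,L^q_{v_s})}\le C\,\|f_1\|_{M^{p_1}_{v_{|s|}}}\|f_2\|_{M^{p_2}_{v_s}}.$$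 (ii) Conversely, if there is a constant $C$ such that $$\|V_{f_1}f_2\|_{W(\mathcal FL^p,L^q)(\mathbb R^{2d})}\le C\,\|f_1\|_{M^{p_1}(\mathbb R^d)}\|f_2\|_{M^{p_2}(\mathbb R^d)}\qquad\text{for all } f_1,f_2\in\mathcal S(\mathbb R^d),$$ then $(*)$ holds. -/

import Mathlib

open MeasureTheory SchwartzMap
open scoped ENNReal NNReal ContDiff FourierTransform RealInnerProductSpace ComplexConjugate

namespace TimeFreq

section General

variable {V : Type*} [NormedAddCommGroup V] [InnerProductSpace ℝ V]

/-- The character `t ↦ e^{2πi ξ·t}`. -/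
noncomputable def character (ξ : V) : V → ℂ :=
  fun t => Complex.exp (2 * Real.pi * Complex.I * (⟪ξ, t⟫ : ℝ))

theorem hasTemperateGrowth_cexp :
    (fun x : ℝ => Complex.exp (2 * Real.pi * Complex.I * (x : ℂ))).HasTemperateGrowth := by
  have hd : ∀ n : ℕ, iteratedDeriv n (fun x : ℝ => Complex.exp (2 * Real.pi * Complex.I * (x : ℂ)))
      = fun x : ℝ => (2 * Real.pi * Complex.I) ^ n *
        Complex.exp (2 * Real.pi * Complex.I * (x : ℂ)) := by
    intro n
    induction n with
    | zero => simp
    | succ n ih =>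
      rw [iteratedDeriv_succ, ih]
      funext x
      have h1 : HasDerivAt (fun x : ℝ => 2 * Real.pi * Complex.I * (x : ℂ))
          (2 * Real.pi * Complex.I) x := by
        simpa using (Complex.ofRealCLM.hasDerivAt (x := x)).const_mul (2 * Real.pi * Complex.I)
      rw [((h1.cexp).const_mul ((2 * Real.pi * Complex.I) ^ n)).deriv]
      ring
  refine ⟨?_, fun n => ⟨0, (2 * Real.pi) ^ n, fun x => ?_⟩⟩
  · exact Complex.contDiff_exp.comp (contDiff_const.mul Complex.ofRealCLM.contDiff)
  · rw [norm_iteratedFDeriv_eq_norm_iteratedDeriv, hd n]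
    have : ‖Complex.exp (2 * Real.pi * Complex.I * (x : ℂ))‖ = 1 := by
      rw [show 2 * Real.pi * Complex.I * (x : ℂ) = ((2 * Real.pi * x : ℝ) : ℂ) * Complex.I by
        push_cast; ring]
      exact Complex.norm_exp_ofReal_mul_I _
    rw [norm_mul, this]
    simp [abs_of_pos Real.pi_pos]

theorem hasTemperateGrowth_character (ξ : V) : (character ξ).HasTemperateGrowth :=
  hasTemperateGrowth_cexp.comp (Function.hasTemperateGrowth_inner_right ξ)

/-- The complex conjugate of a Schwartz function. -/
noncomputable def conjS (φ : 𝓢(V, ℂ)) : 𝓢(V, ℂ) :=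
  SchwartzMap.postcompCLM (𝕜 := ℝ) (Complex.conjCLE : ℂ →L[ℝ] ℂ) φ

/-- The time-frequency shift `M_ξ T_x g`, that is, `t ↦ e^{2πi ξ·t} g(t - x)`. -/
noncomputable def tfShift (x ξ : V) (g : 𝓢(V, ℂ)) : 𝓢(V, ℂ) :=
  SchwartzMap.smulLeftCLM ℂ (character ξ) (SchwartzMap.compSubConstCLM ℂ x g)

theorem conjS_apply (φ : 𝓢(V, ℂ)) (t : V) : conjS φ t = conj (φ t) := rfl

theorem tfShift_apply (x ξ : V) (g : 𝓢(V, ℂ)) (t : V) :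
    tfShift x ξ g t = Complex.exp (2 * Real.pi * Complex.I * (⟪ξ, t⟫ : ℝ)) * g (t - x) := by
  simp [tfShift, SchwartzMap.smulLeftCLM_apply_apply (hasTemperateGrowth_character ξ), character]

/-- The sesquilinear bracket `⟨u, φ⟩` between a tempered distribution and a Schwartz function,
extending `∫ u(t) conj (φ(t)) dt`. -/
noncomputable def bracket (u : 𝓢'(V, ℂ)) (φ : 𝓢(V, ℂ)) : ℂ := u (conjS φ)

/-- The short-time Fourier transform `V_g f(x, ξ) = ⟨f, M_ξ T_x g⟩` of a tempered distribution `f`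
with respect to a Schwartz window `g`. -/
noncomputable def stft (g : 𝓢(V, ℂ)) (f : 𝓢'(V, ℂ)) (x ξ : V) : ℂ := bracket f (tfShift x ξ g)

/-- The polynomial weight `v_s(z) = (1 + |z|²)^{s/2}`. -/
noncomputable def weight (s : ℝ) (z : V) : ℝ := (1 + ‖z‖ ^ 2) ^ (s / 2)

variable [MeasurableSpace V] [BorelSpace V] [FiniteDimensional ℝ V]

/-- The norm of the modulation space `M^{p,q}_m(V)`, computed with the window `g`. -/
noncomputable def modulationNorm (g : 𝓢(V, ℂ)) (p q : ℝ≥0∞) (m : WithLp 2 (V × V) → ℝ)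
    (f : 𝓢'(V, ℂ)) : ℝ≥0∞ :=
  eLpNorm (fun ξ : V =>
    eLpNorm (fun x : V => ‖stft g f x ξ‖ₑ * ENNReal.ofReal (m (WithLp.toLp 2 (x, ξ)))) p volume)
    q volume

/-- Membership in the modulation space `M^{p,q}_m(V)`. -/
def MemModulation (g : 𝓢(V, ℂ)) (p q : ℝ≥0∞) (m : WithLp 2 (V × V) → ℝ) (f : 𝓢'(V, ℂ)) : Prop :=
  modulationNorm g p q m f < ⊤

/-- The norm of the Wiener amalgam space `W(𝓕L^p, L^q_w)(V)`, computed with the window `g`. -/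
noncomputable def wienerNorm (g : 𝓢(V, ℂ)) (p q : ℝ≥0∞) (w : V → ℝ) (f : 𝓢'(V, ℂ)) : ℝ≥0∞ :=
  eLpNorm (fun x : V =>
    eLpNorm (fun ξ : V => ‖stft g f x ξ‖ₑ) p volume * ENNReal.ofReal (w x)) q volume

/-- Membership in the Wiener amalgam space `W(𝓕L^p, L^q_w)(V)`. -/
def MemWiener (g : 𝓢(V, ℂ)) (p q : ℝ≥0∞) (w : V → ℝ) (f : 𝓢'(V, ℂ)) : Prop :=
  wienerNorm g p q w f < ⊤

end General

section Schwartz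

variable {V : Type*} [NormedAddCommGroup V] [InnerProductSpace ℝ V]

theorem norm_iteratedFDeriv_comp_clm_le {W : Type*} [NormedAddCommGroup W] [NormedSpace ℝ W]
    (L : W →L[ℝ] V) (hL : ‖L‖ ≤ 1) (a : 𝓢(V, ℂ)) (n : ℕ) (z : W) :
    ‖iteratedFDeriv ℝ n (fun z => a (L z)) z‖ ≤ ‖iteratedFDeriv ℝ n a (L z)‖ := by
  have := L.iteratedFDeriv_comp_right (a.smooth n) z (i := n) le_rfl
  rw [show (fun z => a (L z)) = a ∘ L from rfl, this]
  refine (ContinuousMultilinearMap.norm_compContinuousLinearMap_le _ _).trans ?_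
  refine mul_le_of_le_one_right (norm_nonneg _) ?_
  simpa using pow_le_one₀ (norm_nonneg _) hL

theorem tensor_decay (a b : 𝓢(V, ℂ)) (k n : ℕ) : ∃ C : ℝ, ∀ z : WithLp 2 (V × V),
    ‖z‖ ^ k * ‖iteratedFDeriv ℝ n (fun z : WithLp 2 (V × V) => a z.fst * b z.snd) z‖ ≤ C := by
  let L₁ : WithLp 2 (V × V) →L[ℝ] V := WithLp.fstL 2 ℝ V V
  let L₂ : WithLp 2 (V × V) →L[ℝ] V := WithLp.sndL 2 ℝ V V
  have h₁ : ‖L₁‖ ≤ 1 := ContinuousLinearMap.opNorm_le_bound _ zero_le_one fun z => by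
    simpa [L₁] using WithLp.norm_fst_le (p := 2) V z
  have h₂ : ‖L₂‖ ≤ 1 := ContinuousLinearMap.opNorm_le_bound _ zero_le_one fun z => by
    simpa [L₂] using WithLp.norm_snd_le (p := 2) V z
  have hz : ∀ z : WithLp 2 (V × V), ‖z‖ ≤ ‖z.fst‖ + ‖z.snd‖ := fun z => by
    rw [WithLp.prod_norm_eq_of_L2]
    refine Real.sqrt_le_iff.2 ⟨by positivity, ?_⟩
    nlinarith [norm_nonneg z.fst, norm_nonneg z.snd]
  choose A hA using a.decay
  choose B hB using b.decay
  refine ⟨2 ^ (k - 1) * ∑ i ∈ Finset.range (n + 1), (n.choose i : ℝ) *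
    (A k i * B 0 (n - i) + A 0 i * B k (n - i)), fun z => ?_⟩
  have hA0 : ∀ k i, 0 ≤ A k i := fun k i => (hA k i).1.le
  have hB0 : ∀ k i, 0 ≤ B k i := fun k i => (hB k i).1.le
  have hmul := norm_iteratedFDeriv_mul_le (𝕜 := ℝ) (n := n) (N := ((⊤ : ℕ∞) : WithTop ℕ∞))
    (f := fun z => a (L₁ z)) (g := fun z => b (L₂ z))
    ((a.smooth ⊤).comp L₁.contDiff) ((b.smooth ⊤).comp L₂.contDiff) z (mod_cast le_top)
  have hk : ‖z‖ ^ k ≤ 2 ^ (k - 1) * (‖z.fst‖ ^ k + ‖z.snd‖ ^ k) :=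
    (pow_le_pow_left₀ (norm_nonneg _) (hz z) k).trans
      (add_pow_le (norm_nonneg _) (norm_nonneg _) k)
  calc _ ≤ (2 ^ (k - 1) * (‖z.fst‖ ^ k + ‖z.snd‖ ^ k)) * ∑ i ∈ Finset.range (n + 1),
        (n.choose i : ℝ) * ‖iteratedFDeriv ℝ i a z.fst‖ * ‖iteratedFDeriv ℝ (n - i) b z.snd‖ := by
        refine mul_le_mul hk (hmul.trans (Finset.sum_le_sum fun i _ => ?_)) (norm_nonneg _)
          (by positivity)
        gcongr
        · exact norm_iteratedFDeriv_comp_clm_le L₁ h₁ a i z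
        · exact norm_iteratedFDeriv_comp_clm_le L₂ h₂ b (n - i) z
    _ ≤ _ := by
        rw [mul_assoc, Finset.mul_sum]
        refine mul_le_mul_of_nonneg_left (Finset.sum_le_sum fun i _ => ?_) (by positivity)
        have e1 := (hA k i).2 z.fst
        have e2 := (hA 0 i).2 z.fst
        have e3 := (hB k (n - i)).2 z.snd
        have e4 := (hB 0 (n - i)).2 z.snd
        simp only [pow_zero, one_mul] at e2 e4
        calc _ = (n.choose i : ℝ) * ((‖z.fst‖ ^ k * ‖iteratedFDeriv ℝ i a z.fst‖) *
              ‖iteratedFDeriv ℝ (n - i) b z.snd‖ + ‖iteratedFDeriv ℝ i a z.fst‖ *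
              (‖z.snd‖ ^ k * ‖iteratedFDeriv ℝ (n - i) b z.snd‖)) := by ring
          _ ≤ _ := by
            gcongr
            · exact hA0 _ _
            · exact hA0 _ _

/-- The function `(x, y) ↦ a(x) b(y)`. -/
noncomputable def tensor (a b : 𝓢(V, ℂ)) : 𝓢(WithLp 2 (V × V), ℂ) where
  toFun z := a z.fst * b z.snd
  smooth' := ((a.smooth ⊤).comp (WithLp.fstL 2 ℝ V V).contDiff).mul
    ((b.smooth ⊤).comp (WithLp.sndL 2 ℝ V V).contDiff)
  decay' := tensor_decay a b

/-- The chirp `(η, t) ↦ e^{2πi η·t}`. -/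
noncomputable def chirp : WithLp 2 (V × V) → ℂ :=
  fun z => Complex.exp (2 * Real.pi * Complex.I * ((⟪z.fst, z.snd⟫ : ℝ) : ℂ))

theorem hasTemperateGrowth_chirp : (chirp (V := V)).HasTemperateGrowth := by
  refine hasTemperateGrowth_cexp.comp (f := fun z : WithLp 2 (V × V) => (⟪z.fst, z.snd⟫ : ℝ)) ?_
  exact (innerSL ℝ).bilinear_hasTemperateGrowth (WithLp.fstL 2 ℝ V V).hasTemperateGrowth
    (WithLp.sndL 2 ℝ V V).hasTemperateGrowth

variable [MeasurableSpace V] [BorelSpace V] [FiniteDimensional ℝ V]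

/-- The short-time Fourier transform of Schwartz functions, `φ` being the window:
`V_φ ψ(x, ξ) = ∫ ψ(t) conj (φ(t - x)) e^{-2πi ξ·t} dt`. -/
noncomputable def stftFun (φ ψ : 𝓢(V, ℂ)) (z : WithLp 2 (V × V)) : ℂ :=
  ∫ t : V, ψ t * conj (φ (t - z.fst)) *
    Complex.exp (-(2 * Real.pi * Complex.I * (⟪z.snd, t⟫ : ℝ)))

/-- An auxiliary Schwartz function whose Fourier transform is the short-time Fourier transform. -/
noncomputable def stftKernel (φ ψ : 𝓢(V, ℂ)) : 𝓢(WithLp 2 (V × V), ℂ) :=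
  SchwartzMap.smulLeftCLM ℂ chirp (tensor (𝓕 (conjS φ)) ψ)

theorem stftKernel_apply (φ ψ : 𝓢(V, ℂ)) (z : WithLp 2 (V × V)) :
    stftKernel φ ψ z = chirp z * (𝓕 (conjS φ) z.fst * ψ z.snd) := by
  rw [stftKernel, SchwartzMap.smulLeftCLM_apply_apply hasTemperateGrowth_chirp]
  rfl

theorem fourier_stftKernel (φ ψ : 𝓢(V, ℂ)) :
    ((𝓕 (stftKernel φ ψ) : 𝓢(WithLp 2 (V × V), ℂ)) : WithLp 2 (V × V) → ℂ) = stftFun φ ψ := by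
  funext z
  have hint : Integrable (fun v : WithLp 2 (V × V) =>
      Complex.exp ((↑(-2 * Real.pi * ⟪v, z⟫) : ℂ) * Complex.I) • stftKernel φ ψ v) := by
    refine (stftKernel φ ψ).integrable.norm.mono' ?_ (Filter.Eventually.of_forall fun v => ?_)
    · refine Continuous.aestronglyMeasurable ?_
      have := (stftKernel φ ψ).continuous
      fun_prop
    · rw [norm_smul, Complex.norm_exp_ofReal_mul_I, one_mul]
  have hmp := WithLp.volume_preserving_toLp V V
  have hint' := hmp.integrable_comp_of_integrable hint
  rw [SchwartzMap.fourier_coe, Real.fourier_eq',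
    ← hmp.integral_comp (MeasurableEquiv.toLp 2 (V × V)).measurableEmbedding,
    Measure.volume_eq_prod]
  refine (integral_prod_symm _ hint').trans ?_
  rw [stftFun]
  refine integral_congr_ae (Filter.Eventually.of_forall fun t => ?_)
  have hinv : (𝓕 (𝓕 (conjS φ)) : 𝓢(V, ℂ)) (z.fst - t) = conj (φ (t - z.fst)) := by
    have h1 : (𝓕⁻ (𝓕 (conjS φ)) : 𝓢(V, ℂ)) (t - z.fst) = conjS φ (t - z.fst) := by simp
    rw [SchwartzMap.fourierInv_coe, Real.fourierInv_eq_fourier_neg, neg_sub] at h1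
    rw [SchwartzMap.fourier_coe, h1, conjS_apply]
  beta_reduce
  rw [← hinv, SchwartzMap.fourier_coe (𝓕 (conjS φ)), Real.fourier_eq',
    mul_right_comm, ← integral_const_mul]
  refine integral_congr_ae (Filter.Eventually.of_forall fun η => ?_)
  simp only [Function.comp_apply, stftKernel_apply, chirp, WithLp.prod_inner_apply, smul_eq_mul,
    WithLp.toLp_fst, WithLp.toLp_snd, WithLp.ofLp_fst, WithLp.ofLp_snd]
  have : Complex.exp ((↑(-2 * Real.pi * (⟪η, z.fst⟫ + ⟪t, z.snd⟫)) : ℂ) * Complex.I) *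
      Complex.exp (2 * Real.pi * Complex.I * ((⟪η, t⟫ : ℝ) : ℂ)) =
      Complex.exp ((↑(-2 * Real.pi * ⟪η, z.fst - t⟫) : ℂ) * Complex.I) *
      Complex.exp (-(2 * Real.pi * Complex.I * (⟪z.snd, t⟫ : ℝ))) := by
    rw [← Complex.exp_add, ← Complex.exp_add, inner_sub_right, real_inner_comm t z.snd]
    congr 1
    push_cast
    ring
  linear_combination (𝓕 (conjS φ) η * ψ t) * this

/-- The short-time Fourier transform `V_φ ψ` of Schwartz functions, as a Schwartz function. -/
noncomputable def stftS (φ ψ : 𝓢(V, ℂ)) : 𝓢(WithLp 2 (V × V), ℂ) where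
  toFun := stftFun φ ψ
  smooth' := fourier_stftKernel φ ψ ▸ (𝓕 (stftKernel φ ψ)).smooth'
  decay' := fourier_stftKernel φ ψ ▸ (𝓕 (stftKernel φ ψ)).decay'

/-- `F` is the short-time Fourier transform `V_{f₁} f₂` of the tempered distribution `f₂` with
respect to the tempered distribution `f₁`. This is the extension of `stftS` by duality: the
orthogonality relations `⟨V_{f₁} f₂, V_φ ψ⟩ = ⟨f₂, ψ⟩ conj ⟨f₁, φ⟩` of Schwartz functions are
required against all Schwartz functions `φ`, `ψ`. -/
def IsSTFT (f₁ f₂ : 𝓢'(V, ℂ)) (F : 𝓢'(WithLp 2 (V × V), ℂ)) : Prop :=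
  ∀ φ ψ : 𝓢(V, ℂ), bracket F (stftS φ ψ) = bracket f₂ ψ * conj (bracket f₁ φ)

/-- The notion `IsSTFT` extends the short-time Fourier transform of Schwartz functions. -/
theorem isSTFT_stftS (f₁ f₂ : 𝓢(V, ℂ)) :
    IsSTFT (f₁ : 𝓢'(V, ℂ)) (f₂ : 𝓢'(V, ℂ)) (stftS f₁ f₂ : 𝓢'(WithLp 2 (V × V), ℂ)) := by
  intro φ ψ
  have hb : ∀ {W : Type _} [NormedAddCommGroup W] [InnerProductSpace ℝ W] [MeasurableSpace W]
      [BorelSpace W] [FiniteDimensional ℝ W] (u v : 𝓢(W, ℂ)),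
      bracket (u : 𝓢'(W, ℂ)) v = ∫ t, conj (v t) * u t := by
    intro W _ _ _ _ _ u v
    simp [bracket, conjS_apply]
  have hS : ∀ u v : 𝓢(V, ℂ), stftS u v = 𝓕 (stftKernel u v) := fun u v => by
    ext z
    exact (congrFun (fourier_stftKernel u v) z).symm
  have hP : ∀ {W : Type _} [NormedAddCommGroup W] [InnerProductSpace ℝ W] [MeasurableSpace W]
      [BorelSpace W] [FiniteDimensional ℝ W] (u v : 𝓢(W, ℂ)),
      ∫ t, conj ((𝓕 v : 𝓢(W, ℂ)) t) * (𝓕 u : 𝓢(W, ℂ)) t = ∫ t, conj (v t) * u t := by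
    intro W _ _ _ _ _ u v
    simpa [mul_comm] using SchwartzMap.integral_sesq_fourier_fourier v u (innerSL ℂ)
  rw [hb, hb, hb, hS, hS, hP]
  have hmp := WithLp.volume_preserving_toLp V V
  rw [← hmp.integral_comp (MeasurableEquiv.toLp 2 (V × V)).measurableEmbedding,
    Measure.volume_eq_prod]
  have key : ∀ w : V × V, conj (stftKernel φ ψ (WithLp.toLp 2 w)) *
      stftKernel f₁ f₂ (WithLp.toLp 2 w) =
      (conj (𝓕 (conjS φ) w.1) * 𝓕 (conjS f₁) w.1) * (conj (ψ w.2) * f₂ w.2) := by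
    intro w
    have h1 : conj (chirp (WithLp.toLp 2 w)) * chirp (WithLp.toLp 2 w) = 1 := by
      rw [← Complex.normSq_eq_conj_mul_self, Complex.normSq_eq_norm_sq, chirp,
        WithLp.toLp_fst, WithLp.toLp_snd,
        show (2 * Real.pi * Complex.I * ((⟪w.1, w.2⟫ : ℝ) : ℂ)) =
          ((2 * Real.pi * ⟪w.1, w.2⟫ : ℝ) : ℂ) * Complex.I by push_cast; ring,
        Complex.norm_exp_ofReal_mul_I]
      simp
    simp only [stftKernel_apply, map_mul, WithLp.toLp_fst, WithLp.toLp_snd]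
    linear_combination (conj (𝓕 (conjS φ) w.1) * 𝓕 (conjS f₁) w.1) * (conj (ψ w.2) * f₂ w.2) * h1
  simp only [key]
  rw [integral_prod_mul (fun x : V => conj (𝓕 (conjS φ) x) * 𝓕 (conjS f₁) x)
    (fun y : V => conj (ψ y) * f₂ y), hP, mul_comm]
  congr 1
  rw [← integral_conj]
  simp [conjS_apply]

end Schwartz

end TimeFreq

open TimeFreq

/-! Everything rests on one identity, `IsSTFT.stft_eq`. A time-frequency shift of V_{φ₁}φ₂ is, up to
a unimodular factor, the short-time Fourier transform of shifts of φ₁ and φ₂ (`tfShift_stftS`).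
Testing the duality relation on such shifts shows that the transform of F = V_{f₁}f₂ with window
V_{g₁}g₂ at (z, ζ) has modulus U₁(a) U₂(a + z), where U_i = |V_{g_i} f_i| and a is the image of ζ
under a rotation of phase space followed by a translation. The Wiener norm of F is therefore the L^q
norm in z of the L^p norm in a of this product. The weight is distributed over the two factors by
Peetre's inequality (`IsSTFT.wienerNorm_le`).

For sufficiency, the case of equality in (∗) with p ≤ q is Young's inequality for U₁^p and U₂^p in
L^{q/p}. Inequality in (∗) is enough because each weighted U_i is bounded pointwise by a multiple of
its own modulation norm: it is dominated by its convolution with a rapidly decaying kernel.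
`eLpNorm_correlation_le` is Young's inequality for such functions. For p > q the inner exponent is
first lowered to q, which p₁, p₂ ≤ q permits, and then raised again by `exists_wienerNorm_le`.

Uniqueness and existence also come from the identity. It prescribes the transform of F with a
nonzero window, and the reproducing formula recovers F from that (`IsSTFT.unique`). Conversely, the
prescribed function is continuous of polynomial growth, so it can be integrated against transforms
of test functions. The functional so defined satisfies the duality relation because the double
integral is the integral of a convolution (`exists_isSTFT`). The formulas for tempered distributions
require moving a distribution inside an integral, which is `integral_apply_slice`.

For necessity, f₁ and f₂ are Gaussians of widths R₁, R₂ ≥ 1. Their transforms are of size one on |x|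
≲ R_i, |ξ| ≲ 1, and their modulation norms are at most a constant times R_i^{d/p_i}. The Wiener norm
is at least a constant times min(R₁,R₂)^{d/p} max(R₁,R₂)^{d/q}. The pairs (R,1), (1,R), (R,R) with R
→ ∞ give the three inequalities. -/

namespace TimeFreq

/-! ### Tempered distributions and integrals depending on a parameter -/

section Slice

variable {E F : Type*} [NormedAddCommGroup E] [NormedSpace ℝ E] [NormedAddCommGroup F]
  [NormedSpace ℝ F]

theorem hasTemperateGrowth_prodMk_left (z : E) :
    (fun x : F => (z, x)).HasTemperateGrowth := by
  have h := (Function.HasTemperateGrowth.const (E := F) ((z, 0) : E × F)).add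
      (ContinuousLinearMap.inr ℝ E F).hasTemperateGrowth
  convert h using 1
  ext x <;> simp

/-- The restriction `x ↦ Θ(z, x)` of a Schwartz function on a product. -/
noncomputable def slice (Θ : 𝓢(E × F, ℂ)) (z : E) : 𝓢(F, ℂ) :=
  SchwartzMap.compCLMOfAntilipschitz ℂ (K := 1) (hasTemperateGrowth_prodMk_left z)
    (AntilipschitzWith.of_le_mul_dist fun x y => by simp [Prod.dist_eq]) Θ

theorem slice_apply (Θ : 𝓢(E × F, ℂ)) (z : E) (x : F) : slice Θ z x = Θ (z, x) := rfl

theorem iteratedFDeriv_slice (Θ : 𝓢(E × F, ℂ)) (z : E) (n : ℕ) (x : F) :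
    iteratedFDeriv ℝ n (slice Θ z) x = (iteratedFDeriv ℝ n Θ (z, x)).compContinuousLinearMap
      (fun _ => ContinuousLinearMap.inr ℝ E F) := by
  have h1 : (slice Θ z : F → ℂ) = (fun y => Θ ((z, 0) + y)) ∘ ContinuousLinearMap.inr ℝ E F := by
    funext x
    simp [slice_apply]
  have h2 : ContDiff ℝ n (fun y => Θ ((z, 0) + y)) :=
    (Θ.smooth n).comp (contDiff_const.add contDiff_id)
  rw [h1, (ContinuousLinearMap.inr ℝ E F).iteratedFDeriv_comp_right h2 x le_rfl,
    iteratedFDeriv_comp_add_left]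
  simp

theorem norm_compContinuousLinearMap_inr_le {n : ℕ} (A : (E × F) [×n]→L[ℝ] ℂ) :
    ‖A.compContinuousLinearMap (fun _ => ContinuousLinearMap.inr ℝ E F)‖ ≤ ‖A‖ := by
  refine (ContinuousMultilinearMap.norm_compContinuousLinearMap_le _ _).trans ?_
  refine mul_le_of_le_one_right (norm_nonneg _) ?_
  refine Finset.prod_le_one (fun _ _ => norm_nonneg _) fun _ _ => ?_
  exact ContinuousLinearMap.opNorm_le_bound _ zero_le_one fun x => by simp

theorem norm_iteratedFDeriv_slice_le (Θ : 𝓢(E × F, ℂ)) (z : E) (n : ℕ) (x : F) :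
    ‖iteratedFDeriv ℝ n (slice Θ z) x‖ ≤ ‖iteratedFDeriv ℝ n Θ (z, x)‖ := by
  rw [iteratedFDeriv_slice]
  exact norm_compContinuousLinearMap_inr_le _

theorem exists_one_add_pow_mul_le (f : 𝓢(E, ℂ)) (k n : ℕ) : ∃ C, 0 < C ∧ ∀ x,
    (1 + ‖x‖) ^ k * ‖iteratedFDeriv ℝ n f x‖ ≤ C := by
  refine ⟨2 ^ k * ((Finset.Iic (k, n)).sup (schwartzSeminormFamily ℝ E ℂ)) f + 1, ?_, fun x => ?_⟩
  · positivity
  · exact (one_add_le_sup_seminorm_apply (𝕜 := ℝ) (m := (k, n)) le_rfl le_rfl f x).trans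
      (le_add_of_nonneg_right zero_le_one)

/-- Rapid decay of the slices in the parameter. -/
theorem exists_slice_decay (Θ : 𝓢(E × F, ℂ)) (k n N : ℕ) : ∃ C, 0 < C ∧ ∀ z x,
    ‖x‖ ^ k * ‖iteratedFDeriv ℝ n (slice Θ z) x‖ ≤ C * (1 + ‖z‖) ^ (-(N : ℝ)) := by
  obtain ⟨C, hC, h⟩ := exists_one_add_pow_mul_le Θ (k + N) n
  refine ⟨C, hC, fun z x => ?_⟩
  rw [Real.rpow_neg (by positivity), Real.rpow_natCast, ← div_eq_mul_inv,
    le_div_iff₀ (by positivity)]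
  refine le_trans ?_ (h (z, x))
  rw [pow_add]
  have h1 : ‖x‖ ≤ 1 + ‖(z, x)‖ := (norm_snd_le (z, x)).trans (by simp)
  have h2 : 1 + ‖z‖ ≤ 1 + ‖(z, x)‖ := by gcongr; exact norm_fst_le (z, x)
  have h3 := norm_iteratedFDeriv_slice_le Θ z n x
  calc _ = ‖x‖ ^ k * (1 + ‖z‖) ^ N * ‖iteratedFDeriv ℝ n (slice Θ z) x‖ := by ring
    _ ≤ _ := by gcongr

theorem continuous_iteratedFDeriv_slice (Θ : 𝓢(E × F, ℂ)) (n : ℕ) :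
    Continuous fun w : E × F => iteratedFDeriv ℝ n (slice Θ w.1) w.2 := by
  simp only [iteratedFDeriv_slice]
  exact (ContinuousMultilinearMap.compContinuousLinearMapL
    (fun _ => ContinuousLinearMap.inr ℝ E F)).continuous.comp
    ((Θ.smooth n).continuous_iteratedFDeriv le_rfl)

variable [MeasurableSpace E] [BorelSpace E] [FiniteDimensional ℝ E]
  (μ : Measure E) [μ.IsAddHaarMeasure]

theorem integrable_iteratedFDeriv_slice (Θ : 𝓢(E × F, ℂ)) (n : ℕ) (x : F) :
    Integrable (fun z => iteratedFDeriv ℝ n (slice Θ z) x) μ := by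
  obtain ⟨C, -, hC⟩ := exists_slice_decay Θ 0 n μ.integrablePower
  refine (Measure.integrable_pow_neg_integrablePower μ |>.const_mul C).mono' ?_ ?_
  · exact ((continuous_iteratedFDeriv_slice Θ n).comp
      (continuous_id.prodMk continuous_const)).aestronglyMeasurable
  · filter_upwards with z
    simpa using hC z x

/-- Differentiation under the integral sign, one order at a time. The decay of the slices in the
parameter supplies a dominating function independent of `x`. -/
theorem iteratedFDeriv_eq_integral_slice (Θ : 𝓢(E × F, ℂ)) (f : 𝓢(F, ℂ))
    (hf : ∀ x, f x = ∫ z, Θ (z, x) ∂μ) (n : ℕ) (x : F) :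
    iteratedFDeriv ℝ n f x = ∫ z, iteratedFDeriv ℝ n (slice Θ z) x ∂μ := by
  induction n generalizing x with
  | zero =>
    simp only [iteratedFDeriv_zero_eq_comp, Function.comp_apply]
    have := (continuousMultilinearCurryFin0 ℝ F ℂ).symm.toContinuousLinearEquiv.integral_comp_comm
      (fun z => slice Θ z x) (μ := μ)
    refine Eq.trans ?_ this.symm
    rw [hf]
    rfl
  | succ n ih =>
    obtain ⟨C, -, hC⟩ := exists_slice_decay Θ 0 (n + 1) μ.integrablePower
    have hd : ∀ z (x : F), HasFDerivAt (iteratedFDeriv ℝ n (slice Θ z))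
        (continuousMultilinearCurryLeftEquiv ℝ (fun _ : Fin (n + 1) => F) ℂ
          (iteratedFDeriv ℝ (n + 1) (slice Θ z) x)) x := fun z x => by
      have h := ((slice Θ z).smooth (n + 1 : ℕ)).differentiable_iteratedFDeriv (m := n)
        (by exact_mod_cast Nat.lt_succ_self n) x |>.hasFDerivAt
      rwa [fderiv_iteratedFDeriv] at h
    have hI := hasFDerivAt_integral_of_dominated_of_fderiv_le (μ := μ) (𝕜 := ℝ) (x₀ := x)
      (F := fun x z => iteratedFDeriv ℝ n (slice Θ z) x) (s := Set.univ)
      (F' := fun x z => continuousMultilinearCurryLeftEquiv ℝ (fun _ : Fin (n + 1) => F) ℂ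
          (iteratedFDeriv ℝ (n + 1) (slice Θ z) x))
      (bound := fun z => C * (1 + ‖z‖) ^ (-(μ.integrablePower : ℝ))) Filter.univ_mem
      (Filter.Eventually.of_forall fun y =>
        (integrable_iteratedFDeriv_slice μ Θ n y).aestronglyMeasurable)
      (integrable_iteratedFDeriv_slice μ Θ n x)
      ((continuousMultilinearCurryLeftEquiv ℝ (fun _ : Fin (n + 1) => F)
        ℂ).toContinuousLinearEquiv.continuous.comp_aestronglyMeasurable
        (integrable_iteratedFDeriv_slice μ Θ (n + 1) x).aestronglyMeasurable)
      (Filter.Eventually.of_forall fun z y _ => by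
        rw [LinearIsometryEquiv.norm_map]; simpa using hC z y)
      (Measure.integrable_pow_neg_integrablePower μ |>.const_mul C)
      (Filter.Eventually.of_forall fun z y _ => hd z y)
    rw [← funext ih] at hI
    rw [iteratedFDeriv_succ_eq_comp_left, Function.comp_apply, hI.fderiv]
    have h5 := ContinuousLinearEquiv.integral_comp_comm (𝕜 := ℝ) (E := F [×n + 1]→L[ℝ] ℂ)
      (F := F →L[ℝ] F [×n]→L[ℝ] ℂ) (continuousMultilinearCurryLeftEquiv ℝ
        (fun _ : Fin (n + 1) => F) ℂ).toContinuousLinearEquiv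
          (fun z => iteratedFDeriv ℝ (n + 1) (slice Θ z) x) (μ := μ)
    exact (LinearIsometryEquiv.symm_apply_eq (continuousMultilinearCurryLeftEquiv ℝ
      (fun _ : Fin (n + 1) => F) ℂ)).2 h5

/-- Bounded continuous functions with values in the multilinear forms of degree `n`. -/
abbrev BoundedForms (F : Type*) [NormedAddCommGroup F] [NormedSpace ℝ F] (n : ℕ) : Type _ :=
  @BoundedContinuousFunction F (F [×n]→L[ℝ] ℂ) _
    (NormedAddCommGroup.toSeminormedAddCommGroup (E := (F [×n]→L[ℝ] ℂ))).toPseudoMetricSpace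

/-- The bounded continuous function `x ↦ ‖x‖ ^ k • D^n h(x)`. -/
noncomputable def weightedDeriv (k n : ℕ) : 𝓢(F, ℂ) →ₗ[ℂ] BoundedForms F n where
  toFun h := BoundedContinuousFunction.ofNormedAddCommGroup
    (fun x => ‖x‖ ^ k • iteratedFDeriv ℝ n h x)
    ((continuous_norm.pow k).smul ((h.smooth n).continuous_iteratedFDeriv le_rfl))
    (SchwartzMap.seminorm ℂ k n h) fun x => by
      rw [norm_smul, norm_pow, norm_norm]
      exact SchwartzMap.le_seminorm ℂ k n h x
  map_add' f g := by
    ext1 x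
    have := iteratedFDeriv_add_apply (𝕜 := ℝ) (x := x) (i := n) (f.smooth n).contDiffAt (g.smooth n).contDiffAt
    simp [← smul_add, ← this]
  map_smul' c f := by
    ext1 x
    have := iteratedFDeriv_const_smul_apply (𝕜 := ℝ) (a := c) (x := x) (i := n) (f.smooth n).contDiffAt
    simp [smul_comm c, ← this]

theorem weightedDeriv_apply (k n : ℕ) (h : 𝓢(F, ℂ)) (x : F) :
    weightedDeriv k n h x = ‖x‖ ^ k • iteratedFDeriv ℝ n h x := rfl

theorem seminorm_le_norm_weightedDeriv (k n : ℕ) (h : 𝓢(F, ℂ)) :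
    SchwartzMap.seminorm ℂ k n h ≤ ‖weightedDeriv k n h‖ :=
  SchwartzMap.seminorm_le_bound ℂ k n h (norm_nonneg _) fun x => by
    have := (weightedDeriv k n h).norm_coe_le_norm x
    rwa [weightedDeriv_apply, norm_smul, norm_pow, norm_norm] at this

/-- A tempered distribution factors through finitely many of the maps `weightedDeriv`. -/
theorem exists_factor_weightedDeriv (T : 𝓢(F, ℂ) →L[ℂ] ℂ) : ∃ (s : Finset (ℕ × ℕ))
    (Λ : ((i : s) → BoundedForms F i.1.2) →L[ℂ] ℂ), ∀ h,
      T h = Λ fun i => weightedDeriv i.1.1 i.1.2 h := by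
  have hq : Continuous ((normSeminorm ℂ ℂ).comp (T : 𝓢(F, ℂ) →ₗ[ℂ] ℂ)) :=
    continuous_norm.comp T.continuous
  obtain ⟨s, C, -, hC⟩ := Seminorm.bound_of_continuous (schwartz_withSeminorms ℂ F ℂ) _ hq
  let J : 𝓢(F, ℂ) →ₗ[ℂ] ((i : s) → BoundedForms F i.1.2) :=
    LinearMap.pi fun i => weightedDeriv i.1.1 i.1.2
  have hJ : ∀ h, ‖T h‖ ≤ C * ‖J h‖ := fun h => by
    refine (hC h).trans ?_
    rw [smul_apply, NNReal.smul_def, smul_eq_mul]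
    refine mul_le_mul_of_nonneg_left (Seminorm.finset_sup_apply_le (norm_nonneg _) fun i hi => ?_)
      C.2
    exact (seminorm_le_norm_weightedDeriv i.1 i.2 h).trans (norm_le_pi_norm (J h) ⟨i, hi⟩)
  -- The seminorm bound makes `T` descend to a bounded functional on the range of `J`, which
  -- Hahn–Banach extends to the whole product.
  have hker : LinearMap.ker J ≤ LinearMap.ker (T : 𝓢(F, ℂ) →ₗ[ℂ] ℂ) := fun h hh => by
    have := hJ h
    rw [LinearMap.mem_ker.1 hh, norm_zero, mul_zero] at this
    exact norm_le_zero_iff.1 this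
  let T' : LinearMap.range J →ₗ[ℂ] ℂ :=
    ((LinearMap.ker J).liftQ (T : 𝓢(F, ℂ) →ₗ[ℂ] ℂ) hker).comp
      J.quotKerEquivRange.symm.toLinearMap
  have hT' : ∀ h, T' ⟨J h, LinearMap.mem_range_self J h⟩ = T h := fun h => by
    have : J.quotKerEquivRange.symm ⟨J h, LinearMap.mem_range_self J h⟩ =
        (LinearMap.ker J).mkQ h := by
      rw [LinearEquiv.symm_apply_eq]
      rfl
    simp only [T', LinearMap.comp_apply, LinearEquiv.coe_coe, this]
    rfl
  obtain ⟨Λ, hΛ, -⟩ := exists_extension_norm_eq (LinearMap.range J)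
    (T'.mkContinuous C (by
      rintro ⟨_, h, rfl⟩
      rw [hT']
      exact hJ h))
  refine ⟨s, Λ, fun h => ?_⟩
  have := hΛ ⟨J h, LinearMap.mem_range_self J h⟩
  rw [LinearMap.mkContinuous_apply, hT'] at this
  exact this.symm

/-- The mean value inequality in the parameter, uniform in `x`. It gives norm continuity, hence
strong measurability, of the slices as elements of a space of bounded functions that need not be
separable. -/
theorem norm_weightedDeriv_slice_sub_le (Θ : 𝓢(E × F, ℂ)) (k n : ℕ) : ∃ C : ℝ, ∀ z z',
    ‖weightedDeriv k n (slice Θ z) - weightedDeriv k n (slice Θ z')‖ ≤ C * ‖z - z'‖ := by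
  obtain ⟨C, hC0, hC⟩ := Θ.decay k (n + 1)
  refine ⟨C, fun z z' => (BoundedContinuousFunction.norm_le (by positivity)).2 fun x => ?_⟩
  have hsub : (iteratedFDeriv ℝ n (slice Θ z) x - iteratedFDeriv ℝ n (slice Θ z') x) =
      (iteratedFDeriv ℝ n Θ (z, x) - iteratedFDeriv ℝ n Θ (z', x)).compContinuousLinearMap
        (fun _ => ContinuousLinearMap.inr ℝ E F) := by
    rw [iteratedFDeriv_slice, iteratedFDeriv_slice]
    rfl
  have hle : ‖(weightedDeriv k n (slice Θ z) - weightedDeriv k n (slice Θ z')) x‖ ≤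
      ‖x‖ ^ k * ‖iteratedFDeriv ℝ n Θ (z, x) - iteratedFDeriv ℝ n Θ (z', x)‖ := by
    have h0 : (weightedDeriv k n (slice Θ z) - weightedDeriv k n (slice Θ z')) x =
        ‖x‖ ^ k • (iteratedFDeriv ℝ n (slice Θ z) x - iteratedFDeriv ℝ n (slice Θ z') x) :=
      (smul_sub (‖x‖ ^ k) (iteratedFDeriv ℝ n (slice Θ z) x)
        (iteratedFDeriv ℝ n (slice Θ z') x)).symm
    rw [h0, norm_smul, norm_pow, norm_norm, hsub]
    exact mul_le_mul_of_nonneg_left (norm_compContinuousLinearMap_inr_le _) (by positivity)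
  refine hle.trans ?_
  -- The derivative bound below divides by `‖x‖ ^ k`; since `x` stays fixed along the segment from
  -- `z'` to `z`, this factor is constant there.
  rcases (pow_nonneg (norm_nonneg x) k).eq_or_lt with h0 | h0
  · rw [← h0, zero_mul]
    positivity
  have hd : ∀ y ∈ (Set.univ : Set E), HasFDerivWithinAt (fun y => iteratedFDeriv ℝ n Θ (y, x))
      ((fderiv ℝ (iteratedFDeriv ℝ n Θ) (y, x)).comp (ContinuousLinearMap.inl ℝ E F))
      Set.univ y := fun y _ => by
    have h1 := ((Θ.smooth (n + 1 : ℕ)).differentiable_iteratedFDeriv (m := n)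
        (by exact_mod_cast Nat.lt_succ_self n) (y, x)).hasFDerivAt
    exact (h1.comp y (hasFDerivAt_prodMk_left y x)).hasFDerivWithinAt
  have hb : ∀ y ∈ (Set.univ : Set E), ‖(fderiv ℝ (iteratedFDeriv ℝ n Θ) (y, x)).comp
      (ContinuousLinearMap.inl ℝ E F)‖ ≤ C / ‖x‖ ^ k := fun y _ => by
    rw [le_div_iff₀' h0]
    refine le_trans ?_ (hC (y, x))
    rw [← norm_fderiv_iteratedFDeriv]
    refine mul_le_mul (pow_le_pow_left₀ (norm_nonneg _) (norm_snd_le (y, x)) k) ?_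
      (ContinuousLinearMap.opNorm_nonneg _) (by positivity)
    refine ContinuousLinearMap.opNorm_le_bound _ (ContinuousLinearMap.opNorm_nonneg _) fun v => ?_
    have hv : ‖ContinuousLinearMap.inl ℝ E F v‖ = ‖v‖ := by simp
    rw [ContinuousLinearMap.comp_apply, ← hv]
    exact ContinuousLinearMap.le_opNorm _ _
  have := convex_univ.norm_image_sub_le_of_norm_hasFDerivWithin_le (𝕜 := ℝ)
    hd hb (Set.mem_univ z') (Set.mem_univ z)
  calc _ ≤ ‖x‖ ^ k * (C / ‖x‖ ^ k * ‖z - z'‖) := by gcongr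
    _ = C * ‖z - z'‖ := by field_simp

/-- A tempered distribution commutes with integration of a Schwartz function of two variables in
one of them. -/
theorem integral_apply_slice (T : 𝓢(F, ℂ) →L[ℂ] ℂ) (Θ : 𝓢(E × F, ℂ)) (f : 𝓢(F, ℂ))
    (hf : ∀ x, f x = ∫ z, Θ (z, x) ∂μ) :
    (Continuous fun z => T (slice Θ z)) ∧ Integrable (fun z => T (slice Θ z)) μ ∧
      T f = ∫ z, T (slice Θ z) ∂μ := by
  obtain ⟨s, Λ, hΛ⟩ := exists_factor_weightedDeriv T
  let J : 𝓢(F, ℂ) → ((i : s) → BoundedForms F i.1.2) :=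
    fun h i => weightedDeriv i.1.1 i.1.2 h
  have hci : ∀ k n, Continuous fun z => weightedDeriv k n (slice Θ z) := fun k n => by
    obtain ⟨C, hC⟩ := norm_weightedDeriv_slice_sub_le Θ k n
    exact (LipschitzWith.of_dist_le' (K := C) fun z z' => by
      rw [dist_eq_norm, dist_eq_norm]; exact hC z z').continuous
  have hii : ∀ k n, Integrable (fun z => weightedDeriv k n (slice Θ z)) μ := fun k n => by
    obtain ⟨C, hC0, hC⟩ := exists_slice_decay Θ k n μ.integrablePower
    refine (Measure.integrable_pow_neg_integrablePower μ |>.const_mul C).mono'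
      (hci k n).aestronglyMeasurable (Filter.Eventually.of_forall fun z => ?_)
    refine (BoundedContinuousFunction.norm_le (by positivity)).2 fun x => ?_
    rw [weightedDeriv_apply, norm_smul, norm_pow, norm_norm]
    exact hC z x
  have hc : Continuous fun z => J (slice Θ z) := continuous_pi fun i => hci _ _
  have hi : Integrable (fun z => J (slice Θ z)) μ := Integrable.of_eval fun i => hii _ _
  have hT : ∀ z, T (slice Θ z) = Λ (J (slice Θ z)) := fun z => hΛ _
  refine ⟨?_, ?_, ?_⟩
  · simp only [hT]
    exact Λ.continuous.comp hc
  · simp only [hT]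
    exact Λ.integrable_comp hi
  · simp only [hT]
    -- `Λ` passes through the Bochner integral. What remains is an identity in a product of function
    -- spaces, checked in each coordinate at each point, where it is differentiation under the
    -- integral.
    rw [ContinuousLinearMap.integral_comp_comm _ hi, hΛ]
    congr 1
    funext i
    rw [eval_integral fun i => hii _ _]
    ext1 x
    have h1 := (BoundedContinuousFunction.evalCLM ℝ x).integral_comp_comm (hii i.1.1 i.1.2)
    refine Eq.trans ?_ h1
    simp only [weightedDeriv_apply, BoundedContinuousFunction.evalCLM_apply]
    rw [integral_smul, iteratedFDeriv_eq_integral_slice μ Θ f hf]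

end Slice

/-! ### Tensor products of Schwartz functions -/

section TensorProd

variable {E F : Type*} [NormedAddCommGroup E] [InnerProductSpace ℝ E] [NormedAddCommGroup F]
  [InnerProductSpace ℝ F]

/-- The function `(x, y) ↦ a(x) b(y)` on a product of two spaces, as a continuous linear function
of `b`. -/
noncomputable def tensorProd (a : 𝓢(E, ℂ)) : 𝓢(F, ℂ) →L[ℂ] 𝓢(E × F, ℂ) :=
  SchwartzMap.mkCLM (fun b w => a w.1 * b w.2) (fun f g x => by simp [mul_add])
    (fun c f x => by simp [mul_left_comm])
    (fun b => ((a.smooth ⊤).comp contDiff_fst).mul ((b.smooth ⊤).comp contDiff_snd)) <| by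
  rintro ⟨k, n⟩
  refine ⟨Finset.Iic (k, n), ∑ i ∈ Finset.range (n + 1), (n.choose i : ℝ) *
    (SchwartzMap.seminorm ℂ k i a + SchwartzMap.seminorm ℂ 0 i a), by positivity, fun b w => ?_⟩
  set S := ((Finset.Iic (k, n)).sup (schwartzSeminormFamily ℂ F ℂ)) b
  have hS : ∀ j ≤ n, ∀ l ≤ k, ‖w.2‖ ^ l * ‖iteratedFDeriv ℝ j b w.2‖ ≤ S := fun j hj l hl =>
    (SchwartzMap.le_seminorm ℂ l j b w.2).trans (Seminorm.le_finset_sup_apply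
      (p := schwartzSeminormFamily ℂ F ℂ) (i := (l, j)) (Finset.mem_Iic.2 ⟨hl, hj⟩))
  have h₁ : ‖ContinuousLinearMap.fst ℝ E F‖ ≤ 1 := ContinuousLinearMap.norm_fst_le ℝ E F
  have h₂ : ‖ContinuousLinearMap.snd ℝ E F‖ ≤ 1 := ContinuousLinearMap.norm_snd_le ℝ E F
  have hmul := norm_iteratedFDeriv_mul_le (𝕜 := ℝ) (n := n) (N := ((⊤ : ℕ∞) : WithTop ℕ∞))
    (f := fun w : E × F => a (ContinuousLinearMap.fst ℝ E F w))
    (g := fun w : E × F => b (ContinuousLinearMap.snd ℝ E F w))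
    ((a.smooth ⊤).comp contDiff_fst) ((b.smooth ⊤).comp contDiff_snd) w (mod_cast le_top)
  have hk : ‖w‖ ^ k ≤ ‖w.1‖ ^ k + ‖w.2‖ ^ k := by
    rw [Prod.norm_def]
    rcases le_total ‖w.1‖ ‖w.2‖ with h | h
    · rw [max_eq_right h]; exact le_add_of_nonneg_left (by positivity)
    · rw [max_eq_left h]; exact le_add_of_nonneg_right (by positivity)
  calc _ ≤ (‖w.1‖ ^ k + ‖w.2‖ ^ k) * ∑ i ∈ Finset.range (n + 1),
        (n.choose i : ℝ) * ‖iteratedFDeriv ℝ i a w.1‖ * ‖iteratedFDeriv ℝ (n - i) b w.2‖ := by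
        refine mul_le_mul hk (hmul.trans (Finset.sum_le_sum fun i _ => ?_)) (norm_nonneg _)
          (by positivity)
        gcongr
        · exact norm_iteratedFDeriv_comp_clm_le _ h₁ a i w
        · exact norm_iteratedFDeriv_comp_clm_le _ h₂ b (n - i) w
    _ ≤ _ := by
        rw [Finset.mul_sum, Finset.sum_mul]
        refine Finset.sum_le_sum fun i _ => ?_
        have e1 := SchwartzMap.le_seminorm ℂ k i a w.1
        have e2 := SchwartzMap.le_seminorm ℂ 0 i a w.1
        have e3 := hS (n - i) (Nat.sub_le n i) k le_rfl
        have e4 := hS (n - i) (Nat.sub_le n i) 0 (Nat.zero_le k)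
        simp only [pow_zero, one_mul] at e2 e4
        calc _ = (n.choose i : ℝ) * ((‖w.1‖ ^ k * ‖iteratedFDeriv ℝ i a w.1‖) *
              ‖iteratedFDeriv ℝ (n - i) b w.2‖ + ‖iteratedFDeriv ℝ i a w.1‖ *
              (‖w.2‖ ^ k * ‖iteratedFDeriv ℝ (n - i) b w.2‖)) := by ring
          _ ≤ (n.choose i : ℝ) * (SchwartzMap.seminorm ℂ k i a * S +
              SchwartzMap.seminorm ℂ 0 i a * S) := by gcongr
          _ = _ := by ring

end TensorProd

/-! ### Inversion and reproducing formulas for the short-time Fourier transform -/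

section Family

variable {V : Type*} [NormedAddCommGroup V] [InnerProductSpace ℝ V]

/-- The shear `(z, t) ↦ (z, t - x)`, where `z = (x, ξ)`. -/
noncomputable def shearEquiv : (WithLp 2 (V × V) × V) ≃L[ℝ] (WithLp 2 (V × V) × V) :=
  ContinuousLinearEquiv.equivOfInverse
    ((ContinuousLinearMap.fst ℝ (WithLp 2 (V × V)) V).prod
      (ContinuousLinearMap.snd ℝ (WithLp 2 (V × V)) V -
        (WithLp.fstL 2 ℝ V V).comp (ContinuousLinearMap.fst ℝ (WithLp 2 (V × V)) V)))
    ((ContinuousLinearMap.fst ℝ (WithLp 2 (V × V)) V).prod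
      (ContinuousLinearMap.snd ℝ (WithLp 2 (V × V)) V +
        (WithLp.fstL 2 ℝ V V).comp (ContinuousLinearMap.fst ℝ (WithLp 2 (V × V)) V)))
    (fun w => by simp) (fun w => by simp)

theorem hasTemperateGrowth_modulation :
    (fun w : WithLp 2 (V × V) × V =>
      Complex.exp (2 * Real.pi * Complex.I * ((-⟪w.1.snd, w.2⟫ : ℝ) : ℂ))).HasTemperateGrowth := by
  refine hasTemperateGrowth_cexp.comp (f := fun w : WithLp 2 (V × V) × V =>
    (-⟪w.1.snd, w.2⟫ : ℝ)) (Function.HasTemperateGrowth.neg ?_)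
  exact (innerSL ℝ).bilinear_hasTemperateGrowth
    ((WithLp.sndL 2 ℝ V V).comp (ContinuousLinearMap.fst ℝ _ V)).hasTemperateGrowth
    (ContinuousLinearMap.snd ℝ (WithLp 2 (V × V)) V).hasTemperateGrowth

/-- The Schwartz function `(z, t) ↦ H(z) conj (M_ξ T_x g (t))`, where `z = (x, ξ)`. -/
noncomputable def shiftFamily (H : 𝓢(WithLp 2 (V × V), ℂ)) (g : 𝓢(V, ℂ)) :
    𝓢(WithLp 2 (V × V) × V, ℂ) :=
  SchwartzMap.smulLeftCLM ℂ (fun w : WithLp 2 (V × V) × V =>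
      Complex.exp (2 * Real.pi * Complex.I * ((-⟪w.1.snd, w.2⟫ : ℝ) : ℂ)))
    (SchwartzMap.compCLMOfContinuousLinearEquiv ℂ shearEquiv (tensorProd H (conjS g)))

theorem conj_cexp (x : ℝ) : conj (Complex.exp (2 * Real.pi * Complex.I * (x : ℂ))) =
    Complex.exp (2 * Real.pi * Complex.I * ((-x : ℝ) : ℂ)) := by
  rw [← Complex.exp_conj]
  congr 1
  simp [Complex.conj_ofNat]

theorem shiftFamily_apply (H : 𝓢(WithLp 2 (V × V), ℂ)) (g : 𝓢(V, ℂ)) (z : WithLp 2 (V × V))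
    (t : V) : shiftFamily H g (z, t) = H z * conj (tfShift z.fst z.snd g t) := by
  rw [shiftFamily, SchwartzMap.smulLeftCLM_apply_apply hasTemperateGrowth_modulation, tfShift_apply,
    map_mul, conj_cexp, smul_eq_mul, mul_left_comm]
  rfl

theorem slice_shiftFamily (H : 𝓢(WithLp 2 (V × V), ℂ)) (g : 𝓢(V, ℂ)) (z : WithLp 2 (V × V)) :
    slice (shiftFamily H g) z = H z • conjS (tfShift z.fst z.snd g) := by
  ext t
  rw [slice_apply, shiftFamily_apply]
  rfl

theorem apply_slice_shiftFamily (f : 𝓢'(V, ℂ)) (H : 𝓢(WithLp 2 (V × V), ℂ)) (g : 𝓢(V, ℂ))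
    (z : WithLp 2 (V × V)) :
    f (slice (shiftFamily H g) z) = H z * stft g f z.fst z.snd := by
  rw [slice_shiftFamily, map_smul]
  rfl

theorem bracket_smul (f : 𝓢'(V, ℂ)) (c : ℂ) (h : 𝓢(V, ℂ)) :
    bracket f (c • h) = conj c * bracket f h := by
  have : conjS (c • h) = conj c • conjS h := by
    ext t
    simp [conjS_apply]
  rw [bracket, this, map_smul]
  rfl

/-- The Schwartz function `t ↦ h(t) conj (g(t - x))`. -/
noncomputable def windowed (g h : 𝓢(V, ℂ)) (x : V) : 𝓢(V, ℂ) :=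
  SchwartzMap.pairing (ContinuousLinearMap.mul ℂ ℂ) h (conjS (SchwartzMap.compSubConstCLM ℂ x g))

theorem windowed_apply (g h : 𝓢(V, ℂ)) (x t : V) : windowed g h x t = h t * conj (g (t - x)) := rfl

variable [MeasurableSpace V] [BorelSpace V] [FiniteDimensional ℝ V]

/-- A superposition of time-frequency shifts with Schwartz coefficients may be paired with `f` under
the integral. The superposition is stated after conjugation because the bracket is conjugate linear
in its second argument. -/
theorem bracket_eq_integral (f : 𝓢'(V, ℂ)) (H : 𝓢(WithLp 2 (V × V), ℂ)) (g h : 𝓢(V, ℂ))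
    (hh : ∀ t, conj (h t) = ∫ z : WithLp 2 (V × V), H z * conj (tfShift z.fst z.snd g t)) :
    (Continuous fun z : WithLp 2 (V × V) => H z * stft g f z.fst z.snd) ∧
    Integrable (fun z : WithLp 2 (V × V) => H z * stft g f z.fst z.snd) ∧
    bracket f h = ∫ z : WithLp 2 (V × V), H z * stft g f z.fst z.snd := by
  have := integral_apply_slice volume
    ((UniformConvergenceCLM.ofFun (RingHom.id ℂ) ℂ _).symm f)
    (shiftFamily H g) (conjS h) (fun t => by simp only [shiftFamily_apply, conjS_apply, hh])
  have he : ∀ z, ((UniformConvergenceCLM.ofFun (RingHom.id ℂ) ℂ _).symm f)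
      (slice (shiftFamily H g) z) = H z * stft g f z.fst z.snd := apply_slice_shiftFamily f H g
  simp only [he] at this
  exact this

theorem stftS_apply (g h : 𝓢(V, ℂ)) (z : WithLp 2 (V × V)) : stftS g h z = stftFun g h z := rfl

theorem stftS_eq_fourier (g h : 𝓢(V, ℂ)) : stftS g h = 𝓕 (stftKernel g h) := by
  ext z
  exact (congrFun (fourier_stftKernel g h) z).symm

/-- For fixed `x` the transform is an ordinary Fourier transform, so Fourier inversion in `ξ` is
available. -/
theorem stftFun_eq_fourier (g h : 𝓢(V, ℂ)) (x ξ : V) :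
    stftFun g h (WithLp.toLp 2 (x, ξ)) = 𝓕 (windowed g h x) ξ := by
  rw [SchwartzMap.fourier_coe, Real.fourier_eq', stftFun]
  refine integral_congr_ae (Filter.Eventually.of_forall fun t => ?_)
  simp only [windowed_apply, smul_eq_mul, WithLp.toLp_fst, WithLp.toLp_snd]
  rw [mul_comm]
  congr 2
  rw [real_inner_comm]
  push_cast
  ring

/-- The inversion formula for the short-time Fourier transform of Schwartz functions. -/
theorem integral_stftFun_mul_tfShift (g h : 𝓢(V, ℂ)) (t : V) :
    ∫ z : WithLp 2 (V × V), stftFun g h z * tfShift z.fst z.snd g t =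
      (∫ x, (‖g x‖ ^ 2 : ℝ) : ℝ) * h t := by
  have hmp := WithLp.volume_preserving_toLp V V
  have hint : Integrable fun z : WithLp 2 (V × V) =>
      stftFun g h z * tfShift z.fst z.snd g t := by
    -- Up to conjugation the integrand is the section at `t` of a Schwartz function of (z, t), which
    -- gives absolute integrability.
    have h0 := integrable_iteratedFDeriv_slice volume (shiftFamily (conjS (stftS g h)) g) 0 t
    have h1 : Integrable fun z : WithLp 2 (V × V) =>
        ‖stftFun g h z * tfShift z.fst z.snd g t‖ := by
      refine h0.norm.congr (Filter.Eventually.of_forall fun z => ?_)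
      simp [slice_apply, shiftFamily_apply, conjS_apply, stftS_apply]
    refine (integrable_norm_iff ?_).1 h1
    refine Continuous.aestronglyMeasurable ?_
    have h3 := (stftS g h).continuous
    have h4 := g.continuous
    simp only [tfShift_apply, ← stftS_apply]
    have h5 : Continuous fun z : WithLp 2 (V × V) => z.fst := (WithLp.fstL 2 ℝ V V).continuous
    have h6 : Continuous fun z : WithLp 2 (V × V) => z.snd := (WithLp.sndL 2 ℝ V V).continuous
    fun_prop
  rw [← hmp.integral_comp (MeasurableEquiv.toLp 2 (V × V)).measurableEmbedding,
    Measure.volume_eq_prod]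
  refine (integral_prod _ (hmp.integrable_comp_of_integrable hint)).trans ?_
  rw [← integral_complex_ofReal, ← integral_mul_const,
    ← integral_sub_left_eq_self (fun x => ((‖g x‖ ^ 2 : ℝ) : ℂ) * h t) volume t]
  refine integral_congr_ae (Filter.Eventually.of_forall fun x => ?_)
  have h1 : (𝓕⁻ (𝓕 (windowed g h x)) : 𝓢(V, ℂ)) t = windowed g h x t := by simp
  rw [SchwartzMap.fourierInv_coe, Real.fourierInv_eq', windowed_apply] at h1
  change ∫ ξ, stftFun g h (WithLp.toLp 2 (x, ξ)) * tfShift x ξ g t = _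
  simp only [stftFun_eq_fourier, tfShift_apply]
  have h2 : ∀ ξ, 𝓕 (windowed g h x) ξ *
      (Complex.exp (2 * Real.pi * Complex.I * (⟪ξ, t⟫ : ℝ)) * g (t - x)) =
      (Complex.exp ((2 * Real.pi * ⟪ξ, t⟫ : ℝ) * Complex.I) • 𝓕 (windowed g h x) ξ) *
        g (t - x) := fun ξ => by
    rw [show (2 * Real.pi * Complex.I * (⟪ξ, t⟫ : ℝ) : ℂ) =
      (2 * Real.pi * ⟪ξ, t⟫ : ℝ) * Complex.I by push_cast; ring, smul_eq_mul]
    ring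
  simp only [h2]
  rw [integral_mul_const, h1, mul_assoc, ← Complex.normSq_eq_conj_mul_self,
    Complex.normSq_eq_norm_sq, mul_comm]

theorem stft_coe (g h : 𝓢(V, ℂ)) (z : WithLp 2 (V × V)) :
    stft g (h : 𝓢'(V, ℂ)) z.fst z.snd = stftFun g h z := by
  simp only [stft, bracket, SchwartzMap.coe_apply, conjS_apply, stftFun, tfShift_apply, map_mul,
    conj_cexp, smul_eq_mul]
  refine integral_congr_ae (Filter.Eventually.of_forall fun t => ?_)
  beta_reduce
  rw [show (2 * Real.pi * Complex.I * ((-⟪z.snd, t⟫ : ℝ) : ℂ)) =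
    -(2 * Real.pi * Complex.I * (⟪z.snd, t⟫ : ℝ)) by push_cast; ring]
  ring

theorem integral_norm_sq_pos {g : 𝓢(V, ℂ)} (hg : g ≠ 0) : 0 < ∫ x, ‖g x‖ ^ 2 := by
  have hc : Continuous fun x => ‖g x‖ ^ 2 := g.continuous.norm.pow 2
  obtain ⟨x, hx⟩ : ∃ x, g x ≠ 0 := by
    by_contra! h
    exact hg (by ext x; simpa using h x)
  refine integral_pos_of_integrable_nonneg_nonzero (x := x) hc ?_ (fun _ => by positivity)
    (by simpa using hx)
  exact (g.memLp 2 volume).integrable_norm_pow (by norm_num)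

/-- The reproducing formula for the short-time Fourier transform of a tempered distribution. -/
theorem bracket_eq_integral_stft (f : 𝓢'(V, ℂ)) (g h : 𝓢(V, ℂ)) :
    (Continuous fun z : WithLp 2 (V × V) => conj (stftFun g h z) * stft g f z.fst z.snd) ∧
    Integrable (fun z : WithLp 2 (V × V) => conj (stftFun g h z) * stft g f z.fst z.snd) ∧
    ((∫ x, ‖g x‖ ^ 2 : ℝ) : ℂ) * bracket f h =
      ∫ z : WithLp 2 (V × V), conj (stftFun g h z) * stft g f z.fst z.snd := by
  have := bracket_eq_integral f (conjS (stftS g h)) g (((∫ x, ‖g x‖ ^ 2 : ℝ) : ℂ) • h)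
    (fun t => by
      have h1 := integral_stftFun_mul_tfShift g h t
      rw [smul_apply, smul_eq_mul, ← h1, ← integral_conj]
      simp only [map_mul, conjS_apply, stftS_apply])
  rw [bracket_smul, Complex.conj_ofReal] at this
  exact this

/-- This value is nonzero when `g` is, which permits division by V_g(M_ξ T_x g) near z = (x, ξ). -/
theorem stftFun_tfShift_self (g : 𝓢(V, ℂ)) (z : WithLp 2 (V × V)) :
    stftFun g (tfShift z.fst z.snd g) z = ((∫ x, ‖g x‖ ^ 2 : ℝ) : ℂ) := by
  rw [← integral_complex_ofReal, ← integral_sub_right_eq_self _ z.fst, stftFun]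
  refine integral_congr_ae (Filter.Eventually.of_forall fun t => ?_)
  beta_reduce
  rw [tfShift_apply, Complex.exp_neg, Complex.ofReal_pow, ← Complex.mul_conj']
  field_simp [Complex.exp_ne_zero]

/-- The product of V_g f with the conjugate of any V_g h is continuous by
`bracket_eq_integral_stft`. Choosing for `h` the shift of `g` to the point in question makes the
second factor nonzero there, so it can be divided out. -/
theorem continuous_stft (g : 𝓢(V, ℂ)) (f : 𝓢'(V, ℂ)) :
    Continuous fun z : WithLp 2 (V × V) => stft g f z.fst z.snd := by
  rcases eq_or_ne g 0 with rfl | hg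
  · have : ∀ z : WithLp 2 (V × V), stft 0 f z.fst z.snd = 0 := fun z => by
      have : tfShift z.fst z.snd (0 : 𝓢(V, ℂ)) = (0 : ℂ) • 0 := by simp [tfShift]
      rw [stft, this, bracket_smul]
      simp
    simp only [this]
    exact continuous_const
  refine continuous_iff_continuousAt.2 fun z₀ => ?_
  have h1 := (bracket_eq_integral_stft f g (tfShift z₀.fst z₀.snd g)).1.continuousAt (x := z₀)
  have h2 : Continuous fun z : WithLp 2 (V × V) =>
      conj (stftFun g (tfShift z₀.fst z₀.snd g) z) :=
    Complex.continuous_conj.comp (stftS g (tfShift z₀.fst z₀.snd g)).continuous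
  have h3 : conj (stftFun g (tfShift z₀.fst z₀.snd g) z₀) ≠ 0 := by
    rw [stftFun_tfShift_self, Complex.conj_ofReal]
    exact_mod_cast (integral_norm_sq_pos hg).ne'
  refine (h1.div h2.continuousAt h3).congr ?_
  filter_upwards [h2.continuousAt.eventually_ne h3] with z hz
  rw [Pi.div_apply, mul_div_cancel_left₀ _ hz]

/-- The short-time Fourier transform with a fixed window, as a continuous linear map. -/
noncomputable def stftCLM (φ : 𝓢(V, ℂ)) : 𝓢(V, ℂ) →L[ℂ] 𝓢(WithLp 2 (V × V), ℂ) :=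
  (FourierTransform.fourierCLM ℂ 𝓢(WithLp 2 (V × V), ℂ)).comp
    ((SchwartzMap.smulLeftCLM ℂ chirp).comp
      ((SchwartzMap.compCLMOfContinuousLinearEquiv ℂ (WithLp.prodContinuousLinearEquiv 2 ℝ V V)).comp
        (tensorProd (𝓕 (conjS φ)))))

theorem stftCLM_apply (φ ψ : 𝓢(V, ℂ)) : stftCLM φ ψ = stftS φ ψ := by
  rw [stftS_eq_fourier]
  rfl

end Family

/-! ### Covariance, the product formula and change of window -/

section Covariance

variable {V : Type*} [NormedAddCommGroup V] [InnerProductSpace ℝ V] [MeasurableSpace V]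
  [BorelSpace V] [FiniteDimensional ℝ V]

theorem norm_cexp_two_pi_mul (x : ℝ) :
    ‖Complex.exp (2 * Real.pi * Complex.I * (x : ℂ))‖ = 1 := by
  rw [show 2 * Real.pi * Complex.I * (x : ℂ) = ((2 * Real.pi * x : ℝ) : ℂ) * Complex.I by
    push_cast; ring]
  exact Complex.norm_exp_ofReal_mul_I _

/-- Covariance of the short-time Fourier transform under time-frequency shifts. -/
theorem norm_stftFun_tfShift (g h : 𝓢(V, ℂ)) (x ξ : V) (z : WithLp 2 (V × V)) :
    ‖stftFun g (tfShift x ξ h) z‖ = ‖stftFun g h (z - WithLp.toLp 2 (x, ξ))‖ := by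
  have : stftFun g (tfShift x ξ h) z =
      Complex.exp (2 * Real.pi * Complex.I * ((⟪ξ - z.snd, x⟫ : ℝ) : ℂ)) *
        stftFun g h (z - WithLp.toLp 2 (x, ξ)) := by
    rw [stftFun, ← integral_add_right_eq_self _ x, stftFun, ← integral_const_mul]
    refine integral_congr_ae (Filter.Eventually.of_forall fun t => ?_)
    beta_reduce
    simp only [tfShift_apply, add_sub_cancel_right, WithLp.sub_fst, WithLp.sub_snd,
      WithLp.toLp_fst, WithLp.toLp_snd]
    rw [show t + x - z.fst = t - (z.fst - x) by abel]
    have h1 : Complex.exp (2 * Real.pi * Complex.I * ((⟪ξ, t + x⟫ : ℝ) : ℂ)) *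
        Complex.exp (-(2 * Real.pi * Complex.I * ((⟪z.snd, t + x⟫ : ℝ) : ℂ))) =
        Complex.exp (2 * Real.pi * Complex.I * ((⟪ξ - z.snd, x⟫ : ℝ) : ℂ)) *
        Complex.exp (-(2 * Real.pi * Complex.I * ((⟪z.snd - ξ, t⟫ : ℝ) : ℂ))) := by
      rw [← Complex.exp_add, ← Complex.exp_add]
      congr 1
      simp only [inner_add_right, inner_sub_left]
      push_cast
      ring
    linear_combination (h t * conj (g (t - (z.fst - x)))) * h1
  rw [this, norm_mul, norm_cexp_two_pi_mul, one_mul]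

/-- Time-frequency shifts of `V_{φ₁} φ₂` are short-time Fourier transforms of time-frequency shifts
of `φ₁` and `φ₂`. -/
theorem tfShift_stftS (φ₁ φ₂ : 𝓢(V, ℂ)) (z ζ : WithLp 2 (V × V)) :
    tfShift z ζ (stftS φ₁ φ₂) =
      Complex.exp (2 * Real.pi * Complex.I * ((⟪z.snd, ζ.snd⟫ : ℝ) : ℂ)) •
        stftS (tfShift (-ζ.snd - z.fst) ζ.fst φ₁) (tfShift (-ζ.snd) (ζ.fst + z.snd) φ₂) := by
  ext w
  rw [tfShift_apply, stftS_apply, smul_apply, stftS_apply, smul_eq_mul]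
  -- This translation of the integration variable aligns the arguments of `φ₁` and `φ₂` on both
  -- sides; only the phases remain to be compared.
  conv_rhs => rw [stftFun, ← integral_add_right_eq_self _ (-ζ.snd)]
  rw [stftFun, ← integral_const_mul, ← integral_const_mul]
  refine integral_congr_ae (Filter.Eventually.of_forall fun t => ?_)
  beta_reduce
  simp only [tfShift_apply, WithLp.sub_fst, WithLp.sub_snd, map_mul, conj_cexp,
    WithLp.prod_inner_apply, WithLp.ofLp_fst, WithLp.ofLp_snd]
  rw [show t + -ζ.snd - -ζ.snd = t by abel,
    show t + -ζ.snd - w.fst - (-ζ.snd - z.fst) = t - (w.fst - z.fst) by abel]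
  have h1 : Complex.exp (2 * Real.pi * Complex.I * ((⟪ζ.fst, w.fst⟫ + ⟪ζ.snd, w.snd⟫ : ℝ) : ℂ)) *
      Complex.exp (-(2 * Real.pi * Complex.I * ((⟪w.snd - z.snd, t⟫ : ℝ) : ℂ))) =
      Complex.exp (2 * Real.pi * Complex.I * ((⟪z.snd, ζ.snd⟫ : ℝ) : ℂ)) *
      (Complex.exp (2 * Real.pi * Complex.I * ((⟪ζ.fst + z.snd, t + -ζ.snd⟫ : ℝ) : ℂ)) *
      Complex.exp (2 * Real.pi * Complex.I * ((-⟪ζ.fst, t + -ζ.snd - w.fst⟫ : ℝ) : ℂ)) *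
      Complex.exp (-(2 * Real.pi * Complex.I * ((⟪w.snd, t + -ζ.snd⟫ : ℝ) : ℂ)))) := by
    simp only [← Complex.exp_add]
    congr 1
    simp only [inner_add_right, inner_sub_left, inner_sub_right, inner_add_left, inner_neg_right]
    rw [real_inner_comm w.snd ζ.snd]
    push_cast
    ring
  linear_combination (φ₂ t * conj (φ₁ (t - (w.fst - z.fst)))) * h1

/-- The short-time Fourier transform of `V_{f₁} f₂` with the window `V_{φ₁} φ₂`. -/
theorem IsSTFT.stft_eq {f₁ f₂ : 𝓢'(V, ℂ)} {F : 𝓢'(WithLp 2 (V × V), ℂ)} (hF : IsSTFT f₁ f₂ F)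
    (φ₁ φ₂ : 𝓢(V, ℂ)) (z ζ : WithLp 2 (V × V)) :
    stft (stftS φ₁ φ₂) F z ζ =
      conj (Complex.exp (2 * Real.pi * Complex.I * ((⟪z.snd, ζ.snd⟫ : ℝ) : ℂ))) *
        (stft φ₂ f₂ (-ζ.snd) (ζ.fst + z.snd) *
          conj (stft φ₁ f₁ (-ζ.snd - z.fst) ζ.fst)) := by
  rw [stft, tfShift_stftS, bracket_smul, hF]
  rfl

theorem IsSTFT.enorm_stft_eq {f₁ f₂ : 𝓢'(V, ℂ)} {F : 𝓢'(WithLp 2 (V × V), ℂ)}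
    (hF : IsSTFT f₁ f₂ F) (φ₁ φ₂ : 𝓢(V, ℂ)) (z ζ : WithLp 2 (V × V)) :
    ‖stft (stftS φ₁ φ₂) F z ζ‖ₑ = ‖stft φ₁ f₁ (-ζ.snd - z.fst) ζ.fst‖ₑ *
      ‖stft φ₂ f₂ (-ζ.snd) (ζ.fst + z.snd)‖ₑ := by
  rw [← ofReal_norm, ← ofReal_norm, ← ofReal_norm, ← ENNReal.ofReal_mul (norm_nonneg _),
    hF.stft_eq, norm_mul, norm_mul, RCLike.norm_conj, RCLike.norm_conj, norm_cexp_two_pi_mul,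
    one_mul, mul_comm]

/-- The decaying weight `(1 + |x|)^{-N}`. -/
noncomputable def decayKernel (N : ℕ) (x : V) : ℝ≥0∞ := ENNReal.ofReal ((1 + ‖x‖) ^ (-(N : ℝ)))

theorem exists_enorm_le_decayKernel (Ψ : 𝓢(WithLp 2 (V × V), ℂ)) (N : ℕ) : ∃ C : ℝ≥0, ∀ x ξ : V,
    ‖Ψ (WithLp.toLp 2 (x, ξ))‖ₑ ≤ C * (decayKernel N x * decayKernel N ξ) := by
  obtain ⟨C, hC, h⟩ := exists_one_add_pow_mul_le Ψ (N + N) 0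
  refine ⟨C.toNNReal, fun x ξ => ?_⟩
  rw [decayKernel, decayKernel, ← ENNReal.ofReal_mul (by positivity), ← ofReal_norm,
    show (C.toNNReal : ℝ≥0∞) = ENNReal.ofReal C from rfl, ← ENNReal.ofReal_mul hC.le]
  refine ENNReal.ofReal_le_ofReal ?_
  set z : WithLp 2 (V × V) := WithLp.toLp 2 (x, ξ)
  have hz := h z
  rw [norm_iteratedFDeriv_zero, pow_add] at hz
  have h1 : 1 + ‖x‖ ≤ 1 + ‖z‖ := by
    gcongr; exact WithLp.norm_fst_le (p := 2) V z
  have h2 : 1 + ‖ξ‖ ≤ 1 + ‖z‖ := by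
    gcongr; exact WithLp.norm_snd_le (p := 2) V z
  rw [Real.rpow_neg (by positivity), Real.rpow_natCast, Real.rpow_neg (by positivity),
    Real.rpow_natCast, ← mul_inv, ← div_eq_mul_inv, le_div_iff₀ (by positivity), mul_comm]
  refine le_trans ?_ hz
  gcongr

theorem lintegral_withLp_prod {f : WithLp 2 (V × V) → ℝ≥0∞} (hf : Measurable f) :
    ∫⁻ z, f z = ∫⁻ x, ∫⁻ y, f (WithLp.toLp 2 (x, y)) := by
  have hmp := WithLp.volume_preserving_toLp V V
  rw [← hmp.lintegral_comp hf, Measure.volume_eq_prod]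
  exact lintegral_prod _ (hf.comp hmp.measurable).aemeasurable

theorem lintegral_withLp_prod_symm {f : WithLp 2 (V × V) → ℝ≥0∞} (hf : Measurable f) :
    ∫⁻ z, f z = ∫⁻ y, ∫⁻ x, f (WithLp.toLp 2 (x, y)) := by
  have hmp := WithLp.volume_preserving_toLp V V
  rw [← hmp.lintegral_comp hf, Measure.volume_eq_prod]
  exact lintegral_prod_symm _ (hf.comp hmp.measurable).aemeasurable

theorem measurable_decayKernel (N : ℕ) : Measurable (decayKernel N : V → ℝ≥0∞) := by
  unfold decayKernel
  fun_prop

/-- Change of the window of a short-time Fourier transform. -/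
theorem exists_enorm_stft_le {g : 𝓢(V, ℂ)} (hg : g ≠ 0) (h : 𝓢(V, ℂ)) (N : ℕ) : ∃ C : ℝ≥0,
    ∀ (f : 𝓢'(V, ℂ)) (x ξ : V), ‖stft h f x ξ‖ₑ ≤
      C * ∫⁻ x', ∫⁻ ξ', ‖stft g f x' ξ'‖ₑ * (decayKernel N (x' - x) * decayKernel N (ξ' - ξ)) := by
  obtain ⟨C, hC⟩ := exists_enorm_le_decayKernel (stftS g h) N
  have hN := integral_norm_sq_pos hg
  set A := ∫ x, ‖g x‖ ^ 2
  refine ⟨A.toNNReal⁻¹ * C, fun f x ξ => ?_⟩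
  -- The factor `A⁻¹` normalises the reproducing formula; `C` comes from the decay of V_g h, which
  -- covariance recentres at (x, ξ).
  obtain ⟨h1, -, h3⟩ := bracket_eq_integral_stft f g (tfShift x ξ h)
  have h4 : ENNReal.ofReal A * ‖stft h f x ξ‖ₑ ≤ ∫⁻ z : WithLp 2 (V × V),
      ‖stft g f z.fst z.snd‖ₑ *
        (C * (decayKernel N (z.fst - x) * decayKernel N (z.snd - ξ))) := by
    have e1 : ENNReal.ofReal A * ‖stft h f x ξ‖ₑ = ‖(A : ℂ) * bracket f (tfShift x ξ h)‖ₑ := by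
      rw [enorm_mul, ← ofReal_norm (A : ℂ), Complex.norm_real, Real.norm_of_nonneg hN.le]
      rfl
    rw [e1, h3]
    refine (enorm_integral_le_lintegral_enorm _).trans (lintegral_mono fun z => ?_)
    rw [enorm_mul, mul_comm]
    gcongr
    refine le_trans (le_of_eq ?_) (hC (z.fst - x) (z.snd - ξ))
    rw [← ofReal_norm, ← ofReal_norm, RCLike.norm_conj, norm_stftFun_tfShift]
    rfl
  have hm : Measurable fun z : WithLp 2 (V × V) => ‖stft g f z.fst z.snd‖ₑ *
        (C * (decayKernel N (z.fst - x) * decayKernel N (z.snd - ξ))) := by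
    have m1 := (continuous_stft g f).measurable
    have m2 : Measurable fun z : WithLp 2 (V × V) => z.fst :=
      (WithLp.fstL 2 ℝ V V).continuous.measurable
    have m3 : Measurable fun z : WithLp 2 (V × V) => z.snd :=
      (WithLp.sndL 2 ℝ V V).continuous.measurable
    have m4 := measurable_decayKernel (V := V) N
    fun_prop
  rw [lintegral_withLp_prod hm] at h4
  simp only [WithLp.toLp_fst, WithLp.toLp_snd, mul_left_comm _ (C : ℝ≥0∞)] at h4
  simp only [lintegral_const_mul' _ _ ENNReal.coe_ne_top] at h4
  have hA : ENNReal.ofReal A ≠ 0 := by simpa using hN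
  rw [ENNReal.coe_mul, ENNReal.coe_inv (by simpa using hN), mul_assoc]
  change _ ≤ (ENNReal.ofReal A)⁻¹ * _
  rw [← ENNReal.div_eq_inv_mul, ENNReal.le_div_iff_mul_le (Or.inl hA)
    (Or.inl ENNReal.ofReal_ne_top), mul_comm]
  exact h4

end Covariance

/-! ### Norms of nonnegative functions: Jensen, Minkowski, interpolation -/

section Lp

variable {X Y : Type*} [MeasurableSpace X] [MeasurableSpace Y] {μ : Measure X} {ν : Measure Y}

theorem eLpNorm_ennreal {p : ℝ≥0∞} (h0 : p ≠ 0) (ht : p ≠ ⊤) (f : X → ℝ≥0∞) :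
    eLpNorm f p μ = (∫⁻ x, f x ^ p.toReal ∂μ) ^ (1 / p.toReal) := by
  rw [eLpNorm_eq_lintegral_rpow_enorm_toReal h0 ht]
  rfl

theorem eLpNorm_ennreal_top (f : X → ℝ≥0∞) : eLpNorm f ⊤ μ = essSup f μ := by
  rw [eLpNorm_exponent_top]
  rfl

theorem eLpNorm_ennreal_mono {p : ℝ≥0∞} {f g : X → ℝ≥0∞} (h : ∀ x, f x ≤ g x) :
    eLpNorm f p μ ≤ eLpNorm g p μ := eLpNorm_mono_enorm h

theorem eLpNorm_ennreal_const_mul {p c : ℝ≥0∞} (hp : 1 ≤ p) (hc : c ≠ ⊤) (f : X → ℝ≥0∞) :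
    eLpNorm (fun x => c * f x) p μ = c * eLpNorm f p μ := by
  have h0 : p ≠ 0 := (zero_lt_one.trans_le hp).ne'
  by_cases ht : p = ⊤
  · subst ht
    rw [eLpNorm_ennreal_top, eLpNorm_ennreal_top, ENNReal.essSup_const_mul]
  · have hp' : 0 < p.toReal := ENNReal.toReal_pos h0 ht
    rw [eLpNorm_ennreal h0 ht, eLpNorm_ennreal h0 ht]
    simp only [ENNReal.mul_rpow_of_nonneg _ _ hp'.le]
    rw [lintegral_const_mul' _ _ (ENNReal.rpow_ne_top_of_nonneg hp'.le hc),
      ENNReal.mul_rpow_of_nonneg _ _ (by positivity), ← ENNReal.rpow_mul,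
      mul_one_div_cancel hp'.ne', ENNReal.rpow_one]

/-- Jensen's inequality. -/
theorem lintegral_mul_rpow_le {r : ℝ} (hr : 1 ≤ r) {f k : X → ℝ≥0∞} (hf : Measurable f)
    (hk : Measurable k) :
    (∫⁻ x, k x * f x ∂μ) ^ r ≤ (∫⁻ x, k x ∂μ) ^ (r - 1) * ∫⁻ x, k x * f x ^ r ∂μ := by
  have h := eLpNorm'_le_eLpNorm'_mul_rpow_measure_univ (μ := μ.withDensity k) one_pos hr
    hf.aestronglyMeasurable
  have hr0 : 0 < r := zero_lt_one.trans_le hr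
  simp only [eLpNorm', enorm_eq_self, ENNReal.rpow_one, div_one] at h
  rw [lintegral_withDensity_eq_lintegral_mul _ hk hf,
    lintegral_withDensity_eq_lintegral_mul _ hk (hf.pow_const r),
    withDensity_apply _ MeasurableSet.univ, Measure.restrict_univ] at h
  refine (ENNReal.rpow_le_rpow h hr0.le).trans (le_of_eq ?_)
  rw [ENNReal.mul_rpow_of_nonneg _ _ hr0.le, ← ENNReal.rpow_mul, ← ENNReal.rpow_mul,
    one_div_mul_cancel hr0.ne', ENNReal.rpow_one, mul_comm]
  congr 2
  field_simp

/-- The essential supremum is at most `c` exactly when the section of {G > c} is null, and the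
measure of a section depends measurably on the parameter. -/
theorem measurable_essSup_right [SFinite ν] {G : X → Y → ℝ≥0∞}
    (hG : Measurable (Function.uncurry G)) : Measurable fun x => essSup (G x) ν := by
  refine measurable_of_Iic fun c => ?_
  have : (fun x => essSup (G x) ν) ⁻¹' Set.Iic c =
      {x | ν (Prod.mk x ⁻¹' {w : X × Y | c < Function.uncurry G w}) = 0} := by
    ext x
    have h1 : ν (Prod.mk x ⁻¹' {w : X × Y | c < Function.uncurry G w}) = 0 ↔
        ∀ᵐ y ∂ν, G x y ≤ c := by
      rw [ae_iff]
      simp only [not_le]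
      rfl
    rw [Set.mem_ofPred_eq, h1, Set.mem_preimage, Set.mem_Iic]
    exact ⟨fun h => (ENNReal.ae_le_essSup (G x)).mono fun y hy => hy.trans h,
      fun h => essSup_le_of_ae_le c h⟩
  rw [this]
  exact (measurable_measure_prodMk_left (measurableSet_lt measurable_const hG))
    (measurableSet_singleton 0)

theorem measurable_eLpNorm_right [SFinite ν] {p : ℝ≥0∞} (hp : 1 ≤ p) {G : X → Y → ℝ≥0∞}
    (hG : Measurable (Function.uncurry G)) : Measurable fun x => eLpNorm (G x) p ν := by
  by_cases ht : p = ⊤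
  · subst ht
    simp only [eLpNorm_ennreal_top]
    exact measurable_essSup_right hG
  · simp only [eLpNorm_ennreal (zero_lt_one.trans_le hp).ne' ht]
    exact (Measurable.lintegral_prod_right (hG.pow_const _)).pow_const _

theorem ae_le_of_eLpNorm_eq_zero {p : ℝ≥0∞} (hp : 1 ≤ p) {f : X → ℝ≥0∞} (hf : Measurable f)
    (h : eLpNorm f p μ = 0) : ∀ᵐ x ∂μ, f x = 0 := by
  by_cases ht : p = ⊤
  · subst ht
    rw [eLpNorm_ennreal_top, ENNReal.essSup_eq_zero_iff] at h
    exact h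
  · have h0 : p ≠ 0 := (zero_lt_one.trans_le hp).ne'
    have hp' : 0 < p.toReal := ENNReal.toReal_pos h0 ht
    rw [eLpNorm_ennreal h0 ht, ENNReal.rpow_eq_zero_iff_of_pos (by positivity),
      lintegral_eq_zero_iff (hf.pow_const _)] at h
    filter_upwards [h] with x hx
    exact (ENNReal.rpow_eq_zero_iff_of_pos hp').1 hx

/-- Minkowski's integral inequality. -/
theorem eLpNorm_lintegral_le [SFinite μ] [SFinite ν] {p : ℝ≥0∞} (hp : 1 ≤ p) {h : X → Y → ℝ≥0∞}
    (hh : Measurable (Function.uncurry h)) :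
    eLpNorm (fun y => ∫⁻ x, h x y ∂μ) p ν ≤ ∫⁻ x, eLpNorm (h x) p ν ∂μ := by
  have h0 : p ≠ 0 := (zero_lt_one.trans_le hp).ne'
  have hhx : ∀ x, Measurable (h x) := fun x => hh.comp measurable_prodMk_left
  have hN := measurable_eLpNorm_right (ν := ν) hp hh
  set N := fun x => eLpNorm (h x) p ν with hNdef
  by_cases ht : p = ⊤
  · have h1 : ∀ᵐ y ∂ν, ∀ᵐ x ∂μ, h x y ≤ N x := by
      rw [← Measure.ae_ae_comm (p := fun x y => h x y ≤ N x)
        (measurableSet_le hh (hN.comp measurable_fst))]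
      filter_upwards with x
      simp only [hNdef, ht, eLpNorm_ennreal_top]
      exact ENNReal.ae_le_essSup (h x)
    rw [ht, eLpNorm_ennreal_top]
    refine essSup_le_of_ae_le _ ?_
    filter_upwards [h1] with y hy
    exact lintegral_mono_ae hy
  by_cases hA : ∫⁻ x, N x ∂μ = ⊤
  · rw [hA]; exact le_top
  have hr : 1 ≤ p.toReal := by
    rw [← ENNReal.toReal_one]
    exact ENNReal.toReal_mono ht hp
  have hr0 : 0 < p.toReal := zero_lt_one.trans_le hr
  set r := p.toReal
  have hfin : ∀ᵐ x ∂μ, N x < ⊤ := ae_lt_top hN hA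
  -- The quotient h/N used below loses the values of `h` where N = 0; these vanish almost
  -- everywhere, and Fubini exchanges the order of the exceptional sets.
  have h1 : ∀ᵐ y ∂ν, ∀ᵐ x ∂μ, (N x = 0 → h x y = 0) := by
    have hms : MeasurableSet {w : X × Y | N w.1 = 0 → h w.1 w.2 = 0} := by
      have := ((measurableSet_eq_fun (hN.comp measurable_fst)
        (measurable_const (a := (0 : ℝ≥0∞)))).compl.union
        (measurableSet_eq_fun hh (measurable_const (a := (0 : ℝ≥0∞)))) :
          MeasurableSet (_ : Set (X × Y)))
      convert this using 1
      ext w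
      simp [Function.uncurry, imp_iff_not_or]
    rw [← Measure.ae_ae_comm hms]
    filter_upwards with x
    by_cases hx : N x = 0
    · filter_upwards [ae_le_of_eLpNorm_eq_zero hp (hhx x) hx] with y hy _ using hy
    · filter_upwards with y hy using absurd hy hx
  -- Jensen's inequality for h/N with density N. Each section of h/N has norm at most one, so
  -- integrating in `y` leaves only powers of ∫ N.
  have h2 : ∀ᵐ y ∂ν, (∫⁻ x, h x y ∂μ) ^ r ≤
      (∫⁻ x, N x ∂μ) ^ (r - 1) * ∫⁻ x, N x * (h x y / N x) ^ r ∂μ := by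
    filter_upwards [h1] with y hy
    refine le_trans (le_of_eq ?_) (lintegral_mul_rpow_le (f := fun x => h x y / N x) hr
      ((hh.comp measurable_prodMk_right).div hN) hN)
    congr 1
    refine lintegral_congr_ae ?_
    filter_upwards [hy, hfin] with x hx hx'
    by_cases hx0 : N x = 0
    · rw [hx hx0, hx0, zero_mul]
    · exact (ENNReal.mul_div_cancel hx0 hx'.ne).symm
  have h3 : ∀ x, ∫⁻ y, N x * (h x y / N x) ^ r ∂ν ≤ N x := fun x => by
    have hx : ∀ y, N x * (h x y / N x) ^ r = N x * ((N x ^ r)⁻¹ * h x y ^ r) := fun y => by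
      rw [ENNReal.div_rpow_of_nonneg _ _ hr0.le, ENNReal.div_eq_inv_mul]
    simp only [hx]
    rw [lintegral_const_mul _ ((hhx x).pow_const r |>.const_mul _),
      lintegral_const_mul _ ((hhx x).pow_const r)]
    have : ∫⁻ y, h x y ^ r ∂ν = N x ^ r := by
      rw [hNdef]
      simp only [eLpNorm_ennreal h0 ht]
      rw [← ENNReal.rpow_mul, one_div_mul_cancel hr0.ne', ENNReal.rpow_one]
    rw [this]
    exact mul_le_of_le_one_right' (ENNReal.inv_mul_le_one _)
  have h4 : ∫⁻ y, (∫⁻ x, h x y ∂μ) ^ r ∂ν ≤ (∫⁻ x, N x ∂μ) ^ r := by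
    calc _ ≤ ∫⁻ y, (∫⁻ x, N x ∂μ) ^ (r - 1) * ∫⁻ x, N x * (h x y / N x) ^ r ∂μ ∂ν :=
          lintegral_mono_ae h2
      _ = (∫⁻ x, N x ∂μ) ^ (r - 1) * ∫⁻ x, ∫⁻ y, N x * (h x y / N x) ^ r ∂ν ∂μ := by
          rw [lintegral_const_mul' _ _ (ENNReal.rpow_ne_top_of_nonneg (by linarith) hA),
            lintegral_lintegral_swap]
          have m1 : Measurable fun w : Y × X => h w.2 w.1 := hh.comp measurable_swap
          have m2 : Measurable fun w : Y × X => N w.2 := hN.comp measurable_snd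
          exact (m2.mul ((m1.div m2).pow_const r)).aemeasurable
      _ ≤ (∫⁻ x, N x ∂μ) ^ (r - 1) * ∫⁻ x, N x ∂μ := by gcongr with x; exact h3 x
      _ = _ := by
          nth_rewrite 2 [← ENNReal.rpow_one (∫⁻ x, N x ∂μ)]
          rw [← ENNReal.rpow_add_of_nonneg _ _ (by linarith) zero_le_one, sub_add_cancel]
  rw [eLpNorm_ennreal h0 ht]
  refine (ENNReal.rpow_le_rpow h4 (by positivity)).trans (le_of_eq ?_)
  rw [← ENNReal.rpow_mul, mul_one_div_cancel hr0.ne', ENNReal.rpow_one]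

/-- The `L^p` norm is bounded by the supremum and any `L^{p₀}` norm with `p₀ ≤ p`. -/
theorem eLpNorm_le_of_le {p₀ p A : ℝ≥0∞} (hp₀ : 1 ≤ p₀) (hpp : p₀ ≤ p) {f : X → ℝ≥0∞}
    (h1 : ∀ x, f x ≤ A) (h2 : eLpNorm f p₀ μ ≤ A) : eLpNorm f p μ ≤ A := by
  by_cases ht : p = ⊤
  · rw [ht, eLpNorm_ennreal_top]
    exact essSup_le_of_ae_le _ (Filter.Eventually.of_forall h1)
  by_cases hA : A = ⊤
  · rw [hA]; exact le_top
  have ht₀ : p₀ ≠ ⊤ := ne_top_of_le_ne_top ht hpp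
  have h0 : p₀ ≠ 0 := (zero_lt_one.trans_le hp₀).ne'
  have h0' : p ≠ 0 := (zero_lt_one.trans_le (hp₀.trans hpp)).ne'
  have hr0 : 0 < p₀.toReal := ENNReal.toReal_pos h0 ht₀
  have hr : 0 < p.toReal := ENNReal.toReal_pos h0' ht
  have hrr : p₀.toReal ≤ p.toReal := ENNReal.toReal_mono ht hpp
  rw [eLpNorm_ennreal h0 ht₀, one_div, ENNReal.rpow_inv_le_iff hr0] at h2
  rw [eLpNorm_ennreal h0' ht, one_div, ENNReal.rpow_inv_le_iff hr]
  calc ∫⁻ x, f x ^ p.toReal ∂μ = ∫⁻ x, f x ^ (p.toReal - p₀.toReal) * f x ^ p₀.toReal ∂μ := by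
        refine lintegral_congr fun x => ?_
        rw [← ENNReal.rpow_add_of_nonneg _ _ (by linarith) hr0.le, sub_add_cancel]
    _ ≤ ∫⁻ x, A ^ (p.toReal - p₀.toReal) * f x ^ p₀.toReal ∂μ := by
        gcongr with x
        exact h1 x
    _ = A ^ (p.toReal - p₀.toReal) * ∫⁻ x, f x ^ p₀.toReal ∂μ :=
        lintegral_const_mul' _ _ (ENNReal.rpow_ne_top_of_nonneg (by linarith) hA)
    _ ≤ A ^ (p.toReal - p₀.toReal) * A ^ p₀.toReal := by gcongr
    _ = _ := by rw [← ENNReal.rpow_add_of_nonneg _ _ (by linarith) hr0.le, sub_add_cancel]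

end Lp

/-! ### Convolution with bounded integrable kernels -/

section Convolution

variable {V : Type*} [NormedAddCommGroup V] [InnerProductSpace ℝ V] [MeasurableSpace V]
  [BorelSpace V] [FiniteDimensional ℝ V]

/-- A nonnegative kernel that is bounded by one, with integral at most `M`. -/
structure IsKernel (k : V → ℝ≥0∞) (M : ℝ≥0) : Prop where
  measurable : Measurable k
  le_one : ∀ x, k x ≤ 1
  one_le : 1 ≤ M
  lintegral_le : ∫⁻ x, k x ≤ M

theorem IsKernel.one_le' {k : V → ℝ≥0∞} {M : ℝ≥0} (hk : IsKernel k M) : (1 : ℝ≥0∞) ≤ M := by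
  exact_mod_cast hk.one_le

theorem IsKernel.lintegral_sub_right_le {k : V → ℝ≥0∞} {M : ℝ≥0} (hk : IsKernel k M) (y : V) :
    ∫⁻ y', k (y' - y) ≤ M := by
  rw [lintegral_sub_right_eq_self k y]
  exact hk.lintegral_le

theorem IsKernel.lintegral_sub_left_le {k : V → ℝ≥0∞} {M : ℝ≥0} (hk : IsKernel k M) (y : V) :
    ∫⁻ y', k (y - y') ≤ M := by
  rw [lintegral_sub_left_eq_self k y]
  exact hk.lintegral_le

theorem IsKernel.rpow_le {k : V → ℝ≥0∞} {M : ℝ≥0} (hk : IsKernel k M) {r : ℝ} (hr : 1 ≤ r)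
    {f : V → ℝ≥0∞} (hf : Measurable f) (y : V) :
    (∫⁻ y', f y' * k (y' - y)) ^ r ≤ (M : ℝ≥0∞) ^ (r - 1) * ∫⁻ y', k (y' - y) * f y' ^ r := by
  simp only [mul_comm (f _)]
  refine (lintegral_mul_rpow_le hr hf (hk.measurable.comp (measurable_id.sub_const y))).trans ?_
  exact mul_le_mul' (ENNReal.rpow_le_rpow (hk.lintegral_sub_right_le y) (by linarith)) le_rfl

theorem one_le_toReal {p : ℝ≥0∞} (hp : 1 ≤ p) (ht : p ≠ ⊤) : 1 ≤ p.toReal := by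
  rw [← ENNReal.toReal_one]
  exact ENNReal.toReal_mono ht hp

theorem rpow_sub_one_mul_self (a : ℝ≥0∞) {r : ℝ} (hr : 1 ≤ r) : a ^ (r - 1) * a = a ^ r := by
  nth_rewrite 2 [← ENNReal.rpow_one a]
  rw [← ENNReal.rpow_add_of_nonneg _ _ (by linarith) zero_le_one, sub_add_cancel]

/-- For finite `p`, Jensen's inequality and then `k ≤ 1`; the condition `1 ≤ M` absorbs M^(p-1) into
M^p. For p = ∞ only the mass of the kernel is used. -/
theorem IsKernel.lintegral_mul_le {k : V → ℝ≥0∞} {M : ℝ≥0} (hk : IsKernel k M) {p : ℝ≥0∞}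
    (hp : 1 ≤ p) {f : V → ℝ≥0∞} (hf : Measurable f) (y : V) :
    ∫⁻ y', f y' * k (y' - y) ≤ M * eLpNorm f p volume := by
  by_cases ht : p = ⊤
  · subst ht
    rw [eLpNorm_ennreal_top, mul_comm]
    calc _ ≤ ∫⁻ y', essSup f volume * k (y' - y) := by
          refine lintegral_mono_ae ?_
          filter_upwards [ENNReal.ae_le_essSup f] with y' hy'
          gcongr
      _ = essSup f volume * ∫⁻ y', k (y' - y) :=
          lintegral_const_mul _ (hk.measurable.comp (measurable_id.sub_const y))
      _ ≤ _ := by gcongr; exact hk.lintegral_sub_right_le y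
  · have h0 : p ≠ 0 := (zero_lt_one.trans_le hp).ne'
    have hr := one_le_toReal hp ht
    have hr0 : 0 < p.toReal := zero_lt_one.trans_le hr
    rw [eLpNorm_ennreal h0 ht, ← ENNReal.rpow_le_rpow_iff hr0,
      ENNReal.mul_rpow_of_nonneg _ _ hr0.le, ← ENNReal.rpow_mul, one_div_mul_cancel hr0.ne',
      ENNReal.rpow_one]
    refine (hk.rpow_le hr hf y).trans ?_
    gcongr
    · exact hk.one_le'
    · linarith
    · exact mul_le_of_le_one_left' (hk.le_one _)

/-- Young's inequality for a bounded and integrable kernel. -/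
theorem IsKernel.eLpNorm_lintegral_mul_le {k : V → ℝ≥0∞} {M : ℝ≥0} (hk : IsKernel k M)
    {p₀ p : ℝ≥0∞} (hp₀ : 1 ≤ p₀) (hpp : p₀ ≤ p) {f : V → ℝ≥0∞} (hf : Measurable f) :
    eLpNorm (fun y => ∫⁻ y', f y' * k (y' - y)) p volume ≤ M * eLpNorm f p₀ volume := by
  have h1 := hk.lintegral_mul_le hp₀ hf
  -- The pointwise bound carries the same constant, so interpolation reduces everything to the
  -- exponent `p₀`.
  refine eLpNorm_le_of_le hp₀ hpp h1 ?_
  by_cases ht : p₀ = ⊤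
  · subst ht
    rw [eLpNorm_ennreal_top]
    exact essSup_le_of_ae_le _ (Filter.Eventually.of_forall h1)
  have h0 : p₀ ≠ 0 := (zero_lt_one.trans_le hp₀).ne'
  have hr := one_le_toReal hp₀ ht
  have hr0 : 0 < p₀.toReal := zero_lt_one.trans_le hr
  have hm : Measurable fun w : V × V => k (w.2 - w.1) * f w.2 ^ p₀.toReal := by
    have := hk.measurable
    fun_prop
  rw [eLpNorm_ennreal h0 ht, eLpNorm_ennreal h0 ht, ← ENNReal.rpow_le_rpow_iff hr0,
    ENNReal.mul_rpow_of_nonneg _ _ hr0.le, ← ENNReal.rpow_mul, ← ENNReal.rpow_mul,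
    one_div_mul_cancel hr0.ne', ENNReal.rpow_one, ENNReal.rpow_one]
  calc _ ≤ ∫⁻ y, (M : ℝ≥0∞) ^ (p₀.toReal - 1) * ∫⁻ y', k (y' - y) * f y' ^ p₀.toReal :=
        lintegral_mono fun y => hk.rpow_le hr hf y
    _ = (M : ℝ≥0∞) ^ (p₀.toReal - 1) * ∫⁻ y', ∫⁻ y, k (y' - y) * f y' ^ p₀.toReal := by
        rw [lintegral_const_mul' _ _ (ENNReal.rpow_ne_top_of_nonneg (by linarith)
          ENNReal.coe_ne_top), lintegral_lintegral_swap hm.aemeasurable]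
    _ ≤ (M : ℝ≥0∞) ^ (p₀.toReal - 1) * ∫⁻ y', M * f y' ^ p₀.toReal := by
        gcongr with y'
        have mk : Measurable fun y => k (y' - y) := by
          have := hk.measurable
          fun_prop
        rw [lintegral_mul_const _ mk]
        gcongr
        exact hk.lintegral_sub_left_le y'
    _ = _ := by
        rw [lintegral_const_mul' _ _ ENNReal.coe_ne_top, ← mul_assoc, rpow_sub_one_mul_self _ hr]

/-- Young's inequality in mixed norms. -/
theorem IsKernel.mixed_eLpNorm_le {k₁ k₂ : V → ℝ≥0∞} {M₁ M₂ : ℝ≥0} (hk₁ : IsKernel k₁ M₁)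
    (hk₂ : IsKernel k₂ M₂) {p₀ p q₀ q : ℝ≥0∞} (hp₀ : 1 ≤ p₀) (hpp : p₀ ≤ p) (hq₀ : 1 ≤ q₀)
    (hqq : q₀ ≤ q) {G H : V → V → ℝ≥0∞} (hG : Measurable (Function.uncurry G))
    (h : ∀ x y, H x y ≤ ∫⁻ x', ∫⁻ y', G x' y' * (k₁ (x' - x) * k₂ (y' - y))) :
    eLpNorm (fun x => eLpNorm (H x) p volume) q volume ≤
      M₁ * M₂ * eLpNorm (fun x => eLpNorm (G x) p₀ volume) q₀ volume := by
  have hp := hp₀.trans hpp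
  have hq := hq₀.trans hqq
  have hN := measurable_eLpNorm_right (ν := (volume : Measure V)) hp₀ hG
  have mk₁ := hk₁.measurable
  have mk₂ := hk₂.measurable
  have hm : Measurable fun w : V × V => ∫⁻ y', G w.1 y' * k₂ (y' - w.2) := by
    refine Measurable.lintegral_prod_right' (f := fun (w : (V × V) × V) =>
      G w.1.1 w.2 * k₂ (w.2 - w.1.2)) ?_
    have : Measurable fun w : (V × V) × V => G w.1.1 w.2 :=
      hG.comp ((measurable_fst.comp measurable_fst).prodMk measurable_snd)
    fun_prop
  have hH : ∀ x, eLpNorm (H x) p volume ≤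
      M₂ * ∫⁻ x', eLpNorm (G x') p₀ volume * k₁ (x' - x) := fun x => by
    calc eLpNorm (H x) p volume ≤ eLpNorm (fun y => ∫⁻ x', k₁ (x' - x) *
          ∫⁻ y', G x' y' * k₂ (y' - y)) p volume := by
          refine eLpNorm_ennreal_mono fun y => (h x y).trans (lintegral_mono fun x' => ?_)
          rw [← lintegral_const_mul' _ _ (ne_top_of_le_ne_top ENNReal.one_ne_top (hk₁.le_one _))]
          refine lintegral_mono fun y' => le_of_eq ?_
          ring
      _ ≤ ∫⁻ x', eLpNorm (fun y => k₁ (x' - x) * ∫⁻ y', G x' y' * k₂ (y' - y)) p volume := by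
          refine eLpNorm_lintegral_le hp ?_
          exact (mk₁.comp (measurable_fst.sub_const x)).mul hm
      _ ≤ ∫⁻ x', M₂ * (eLpNorm (G x') p₀ volume * k₁ (x' - x)) := by
          refine lintegral_mono fun x' => ?_
          rw [eLpNorm_ennreal_const_mul hp (ne_top_of_le_ne_top ENNReal.one_ne_top (hk₁.le_one _)),
            ← mul_assoc, mul_comm]
          gcongr
          exact hk₂.eLpNorm_lintegral_mul_le hp₀ hpp (hG.comp measurable_prodMk_left)
      _ = _ := lintegral_const_mul' _ _ ENNReal.coe_ne_top
  refine (eLpNorm_ennreal_mono hH).trans ?_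
  rw [eLpNorm_ennreal_const_mul hq ENNReal.coe_ne_top, mul_comm (M₁ : ℝ≥0∞), mul_assoc]
  gcongr
  exact hk₁.eLpNorm_lintegral_mul_le hq₀ hqq hN

/-- The endpoint estimate into the supremum, applied in one variable at a time. It is the source of
the pointwise bounds on short-time Fourier transforms. -/
theorem IsKernel.le_mixed_eLpNorm {k₁ k₂ : V → ℝ≥0∞} {M₁ M₂ : ℝ≥0} (hk₁ : IsKernel k₁ M₁)
    (hk₂ : IsKernel k₂ M₂) {p q : ℝ≥0∞} (hp : 1 ≤ p) (hq : 1 ≤ q)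
    {G : V → V → ℝ≥0∞} (hG : Measurable (Function.uncurry G)) (x y : V) :
    ∫⁻ x', ∫⁻ y', G x' y' * (k₁ (x' - x) * k₂ (y' - y)) ≤
      M₁ * M₂ * eLpNorm (fun x => eLpNorm (G x) p volume) q volume := by
  have hN := measurable_eLpNorm_right (ν := (volume : Measure V)) hp hG
  calc _ ≤ ∫⁻ x', M₂ * (eLpNorm (G x') p volume * k₁ (x' - x)) := by
        refine lintegral_mono fun x' => ?_
        simp only [mul_left_comm _ (k₁ _)]
        rw [lintegral_const_mul' _ _ (ne_top_of_le_ne_top ENNReal.one_ne_top (hk₁.le_one _)),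
          ← mul_assoc, mul_comm]
        gcongr
        exact hk₂.lintegral_mul_le hp (hG.comp measurable_prodMk_left) y
    _ = M₂ * ∫⁻ x', eLpNorm (G x') p volume * k₁ (x' - x) :=
        lintegral_const_mul' _ _ ENNReal.coe_ne_top
    _ ≤ _ := by
        rw [mul_comm (M₁ : ℝ≥0∞), mul_assoc]
        gcongr
        exact hk₁.lintegral_mul_le hq hN x

end Convolution

/-! ### A Young inequality for correlations of bounded functions -/

section Correlation

/-- The power `u ^ p`, with the convention `u ^ ∞ = 0`. -/
noncomputable def truncPow (p u : ℝ≥0∞) : ℝ≥0∞ := if p = ⊤ then 0 else u ^ p.toReal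

/-- With m the larger of u^p₁ and v^p₂, the product is at most m raised to α/p₁ + β/p₂. This
exponent is at least 1 and m ≤ 1, so the power is at most m. Boundedness by one is what allows an
inequality between the exponents. -/
theorem rpow_mul_rpow_le_truncPow {p₁ p₂ : ℝ≥0∞} (hp₁ : 1 ≤ p₁) (hp₂ : 1 ≤ p₂) {α β : ℝ}
    (hα : 0 ≤ α) (hβ : 0 ≤ β) (h : 1 ≤ α * p₁⁻¹.toReal + β * p₂⁻¹.toReal) {u v : ℝ≥0∞}
    (hu : u ≤ 1) (hv : v ≤ 1) : u ^ α * v ^ β ≤ truncPow p₁ u + truncPow p₂ v := by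
  have key : ∀ {p : ℝ≥0∞}, 1 ≤ p → ∀ {γ : ℝ}, 0 ≤ γ → ∀ {w m : ℝ≥0∞}, w ≤ 1 → truncPow p w ≤ m →
      w ^ γ ≤ m ^ (γ * p⁻¹.toReal) := by
    intro p hp γ hγ w m hw hm
    by_cases ht : p = ⊤
    · subst ht
      simpa using ENNReal.rpow_le_one hw hγ
    · have hr := one_le_toReal hp ht
      have hr0 : 0 < p.toReal := zero_lt_one.trans_le hr
      rw [truncPow, if_neg ht] at hm
      rw [ENNReal.toReal_inv]
      calc w ^ γ = (w ^ p.toReal) ^ (γ * p.toReal⁻¹) := by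
            rw [← ENNReal.rpow_mul]
            congr 1
            field_simp
        _ ≤ _ := ENNReal.rpow_le_rpow hm (by positivity)
  have hle : ∀ {p : ℝ≥0∞}, 1 ≤ p → ∀ {w : ℝ≥0∞}, w ≤ 1 → truncPow p w ≤ 1 := by
    intro p hp w hw
    unfold truncPow
    split_ifs with ht
    · exact zero_le_one
    · exact ENNReal.rpow_le_one hw ENNReal.toReal_nonneg
  set m := max (truncPow p₁ u) (truncPow p₂ v)
  have hm1 : m ≤ 1 := max_le (hle hp₁ hu) (hle hp₂ hv)
  calc u ^ α * v ^ β ≤ m ^ (α * p₁⁻¹.toReal) * m ^ (β * p₂⁻¹.toReal) :=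
        mul_le_mul' (key hp₁ hα hu (le_max_left _ _)) (key hp₂ hβ hv (le_max_right _ _))
    _ = m ^ (α * p₁⁻¹.toReal + β * p₂⁻¹.toReal) :=
        (ENNReal.rpow_add_of_nonneg _ _ (by positivity) (by positivity)).symm
    _ ≤ m ^ (1 : ℝ) := ENNReal.rpow_le_rpow_of_exponent_ge hm1 h
    _ = m := ENNReal.rpow_one m
    _ ≤ _ := max_le (le_add_of_nonneg_right zero_le) (le_add_of_nonneg_left zero_le)

theorem toReal_inv_add_le {p₁ p₂ p q : ℝ≥0∞} (hp₁ : 1 ≤ p₁) (hp₂ : 1 ≤ p₂) (hp : 1 ≤ p)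
    (hq : 1 ≤ q) (h : p⁻¹ + q⁻¹ ≤ p₁⁻¹ + p₂⁻¹) :
    p⁻¹.toReal + q⁻¹.toReal ≤ p₁⁻¹.toReal + p₂⁻¹.toReal := by
  have hf : ∀ {r : ℝ≥0∞}, 1 ≤ r → r⁻¹ ≠ ⊤ := fun hr =>
    ENNReal.inv_ne_top.2 (zero_lt_one.trans_le hr).ne'
  rw [← ENNReal.toReal_add (hf hp) (hf hq), ← ENNReal.toReal_add (hf hp₁) (hf hp₂)]
  exact ENNReal.toReal_mono (ENNReal.add_ne_top.2 ⟨hf hp₁, hf hp₂⟩) h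

variable {A : Type*} [NormedAddCommGroup A] [InnerProductSpace ℝ A] [MeasurableSpace A]
  [BorelSpace A] [FiniteDimensional ℝ A]

theorem lintegral_rpow_mul_rpow_le_two {p₁ p₂ : ℝ≥0∞} (hp₁ : 1 ≤ p₁) (hp₂ : 1 ≤ p₂) {α β : ℝ}
    (hα : 0 ≤ α) (hβ : 0 ≤ β) (h : 1 ≤ α * p₁⁻¹.toReal + β * p₂⁻¹.toReal) {U₁ U₂ : A → ℝ≥0∞}
    (hm₁ : Measurable U₁) (h₁ : ∀ a, U₁ a ≤ 1)
    (h₂ : ∀ a, U₂ a ≤ 1) (i₁ : ∫⁻ a, truncPow p₁ (U₁ a) ≤ 1) (i₂ : ∫⁻ a, truncPow p₂ (U₂ a) ≤ 1)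
    (z : A) : ∫⁻ a, U₁ a ^ α * U₂ (a + z) ^ β ≤ 2 := by
  have hm : Measurable fun a => truncPow p₁ (U₁ a) := by
    unfold truncPow
    split_ifs
    · exact measurable_const
    · exact hm₁.pow_const _
  calc _ ≤ ∫⁻ a, (truncPow p₁ (U₁ a) + truncPow p₂ (U₂ (a + z))) :=
        lintegral_mono fun a => rpow_mul_rpow_le_truncPow hp₁ hp₂ hα hβ h (h₁ a) (h₂ _)
    _ = (∫⁻ a, truncPow p₁ (U₁ a)) + ∫⁻ a, truncPow p₂ (U₂ (a + z)) := lintegral_add_left hm _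
    _ ≤ 1 + 1 := by
        rw [lintegral_add_right_eq_self (fun a => truncPow p₂ (U₂ a)) z]
        exact add_le_add i₁ i₂
    _ = 2 := one_add_one_eq_two

theorem lintegral_correlation {U₁ U₂ : A → ℝ≥0∞} (hm₁ : Measurable U₁) (hm₂ : Measurable U₂) :
    ∫⁻ z, ∫⁻ a, U₁ a * U₂ (a + z) = (∫⁻ a, U₁ a) * ∫⁻ a, U₂ a := by
  rw [lintegral_lintegral_swap (by fun_prop)]
  have : ∀ a, ∫⁻ z, U₁ a * U₂ (a + z) = U₁ a * ∫⁻ b, U₂ b := fun a => by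
    rw [lintegral_const_mul _ (by fun_prop), lintegral_add_left_eq_self U₂ a]
  simp only [this]
  exact lintegral_mul_const _ hm₁

theorem two_rpow_le_two {r : ℝ} (hr : r ≤ 1) : (2 : ℝ≥0∞) ^ r ≤ 2 := by
  nth_rewrite 2 [← ENNReal.rpow_one 2]
  exact ENNReal.rpow_le_rpow_of_exponent_le (by norm_num) hr

/-- The proof of Young's inequality by Hölder. For finite q, the q-th power of the inner norm is
bounded by a constant times the correlation of U₁^p₁ and U₂^p₂ at z, whose total integral factors by
Tonelli. -/
theorem eLpNorm_correlation_le_two {p₁ p₂ p q : ℝ≥0∞} (hp₁ : 1 ≤ p₁) (hp₂ : 1 ≤ p₂) (hp : 1 ≤ p)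
    (hpq : p ≤ q) (h1q : p₁ ≤ q) (h2q : p₂ ≤ q) (h : p⁻¹ + q⁻¹ ≤ p₁⁻¹ + p₂⁻¹)
    {U₁ U₂ : A → ℝ≥0∞} (hm₁ : Measurable U₁) (hm₂ : Measurable U₂) (h₁ : ∀ a, U₁ a ≤ 1)
    (h₂ : ∀ a, U₂ a ≤ 1) (i₁ : ∫⁻ a, truncPow p₁ (U₁ a) ≤ 1) (i₂ : ∫⁻ a, truncPow p₂ (U₂ a) ≤ 1) :
    eLpNorm (fun z => eLpNorm (fun a => U₁ a * U₂ (a + z)) p volume) q volume ≤ 2 := by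
  have hq := hp.trans hpq
  have hR := toReal_inv_add_le hp₁ hp₂ hp hq h
  have h0 : p ≠ 0 := (zero_lt_one.trans_le hp).ne'
  have h0q : q ≠ 0 := (zero_lt_one.trans_le hq).ne'
  by_cases htq : q = ⊤
  · subst htq
    rw [eLpNorm_ennreal_top]
    refine essSup_le_of_ae_le _ (Filter.Eventually.of_forall fun z => ?_)
    beta_reduce
    by_cases htp : p = ⊤
    · subst htp
      rw [eLpNorm_ennreal_top]
      refine essSup_le_of_ae_le _ (Filter.Eventually.of_forall fun a => ?_)
      exact (mul_le_one' (h₁ a) (h₂ _)).trans one_le_two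
    · have hr := one_le_toReal hp htp
      have hr0 : 0 < p.toReal := zero_lt_one.trans_le hr
      rw [eLpNorm_ennreal h0 htp]
      simp only [ENNReal.mul_rpow_of_nonneg _ _ hr0.le]
      refine (ENNReal.rpow_le_rpow (lintegral_rpow_mul_rpow_le_two hp₁ hp₂ hr0.le hr0.le ?_ hm₁ h₁
        h₂ i₁ i₂ z) (by positivity)).trans (two_rpow_le_two ((div_le_one hr0).2 hr))
      rw [← mul_add]
      simp only [ENNReal.inv_top, ENNReal.toReal_zero, add_zero] at hR
      calc (1 : ℝ) = p.toReal * p⁻¹.toReal := by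
            rw [ENNReal.toReal_inv, mul_inv_cancel₀ hr0.ne']
        _ ≤ _ := by gcongr
  have htp : p ≠ ⊤ := ne_top_of_le_ne_top htq hpq
  have ht₁ : p₁ ≠ ⊤ := ne_top_of_le_ne_top htq h1q
  have ht₂ : p₂ ≠ ⊤ := ne_top_of_le_ne_top htq h2q
  have hP := one_le_toReal hp htp
  have hQ := one_le_toReal hq htq
  have hP₁ := one_le_toReal hp₁ ht₁
  have hP₂ := one_le_toReal hp₂ ht₂
  have hPQ : p.toReal ≤ q.toReal := ENNReal.toReal_mono htq hpq
  have hP₁Q : p₁.toReal ≤ q.toReal := ENNReal.toReal_mono htq h1q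
  have hP₂Q : p₂.toReal ≤ q.toReal := ENNReal.toReal_mono htq h2q
  simp only [ENNReal.toReal_inv] at hR
  simp only [truncPow, if_neg ht₁] at i₁
  simp only [truncPow, if_neg ht₂] at i₂
  have hcorr : ∫⁻ z, ∫⁻ a, U₁ a ^ p₁.toReal * U₂ (a + z) ^ p₂.toReal ≤ 1 := by
    rw [lintegral_correlation (U₁ := fun a => U₁ a ^ p₁.toReal) (U₂ := fun a => U₂ a ^ p₂.toReal)
      (hm₁.pow_const _) (hm₂.pow_const _)]
    exact mul_le_one' i₁ i₂
  have hin : ∀ z, eLpNorm (fun a => U₁ a * U₂ (a + z)) p volume ^ q.toReal ≤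
      2 ^ (q.toReal / p.toReal - 1) * ∫⁻ a, U₁ a ^ p₁.toReal * U₂ (a + z) ^ p₂.toReal := by
    intro z
    rw [eLpNorm_ennreal h0 htp, ← ENNReal.rpow_mul]
    simp only [ENNReal.mul_rpow_of_nonneg _ _ (zero_le_one.trans hP)]
    set P := p.toReal
    set Q := q.toReal
    set P₁ := p₁.toReal
    set P₂ := p₂.toReal
    have hP0 : 0 < P := zero_lt_one.trans_le hP
    have hQ0 : 0 < Q := zero_lt_one.trans_le hQ
    -- For p = q Hölder degenerates, but then p₁, p₂ ≤ q and U₁, U₂ ≤ 1 compare the integrands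
    -- directly.
    rcases hPQ.eq_or_lt with heq | hlt
    · rw [heq, one_div_mul_cancel hQ0.ne', ENNReal.rpow_one, div_self hQ0.ne', sub_self,
        ENNReal.rpow_zero, one_mul]
      refine lintegral_mono fun a => mul_le_mul' ?_ ?_
      · exact ENNReal.rpow_le_rpow_of_exponent_ge (h₁ a) hP₁Q
      · exact ENNReal.rpow_le_rpow_of_exponent_ge (h₂ _) hP₂Q
    have hQP : 0 < Q - P := sub_pos.2 hlt
    have hconj : (Q / P).HolderConjugate (Q / (Q - P)) := by
      rw [Real.holderConjugate_iff]
      refine ⟨(one_lt_div hP0).2 hlt, ?_⟩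
      field_simp
      ring
    -- The first factor is chosen so that its Q/P-th power is the correlation integrand; the second
    -- takes up the rest of (U₁U₂)^P.
    have hH := ENNReal.lintegral_mul_le_Lp_mul_Lq volume hconj
      (f := fun a => (U₁ a ^ P₁ * U₂ (a + z) ^ P₂) ^ (P / Q))
      (g := fun a => U₁ a ^ (P * (1 - P₁ / Q)) * U₂ (a + z) ^ (P * (1 - P₂ / Q)))
      (by fun_prop) (by fun_prop)
    have e1 : 0 ≤ 1 - P₁ / Q := sub_nonneg.2 ((div_le_one hQ0).2 hP₁Q)
    have e2 : 0 ≤ 1 - P₂ / Q := sub_nonneg.2 ((div_le_one hQ0).2 hP₂Q)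
    have hL : ∀ a, U₁ a ^ P * U₂ (a + z) ^ P = ((fun a => (U₁ a ^ P₁ * U₂ (a + z) ^ P₂) ^ (P / Q)) *
        fun a => U₁ a ^ (P * (1 - P₁ / Q)) * U₂ (a + z) ^ (P * (1 - P₂ / Q))) a := fun a => by
      rw [Pi.mul_apply, ENNReal.mul_rpow_of_nonneg _ _ (by positivity), ← ENNReal.rpow_mul,
        ← ENNReal.rpow_mul, mul_mul_mul_comm, ← ENNReal.rpow_add_of_nonneg _ _ (by positivity)
        (by positivity), ← ENNReal.rpow_add_of_nonneg _ _ (by positivity) (by positivity)]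
      congr 2 <;> field_simp <;> ring
    have hF : ∀ a, ((U₁ a ^ P₁ * U₂ (a + z) ^ P₂) ^ (P / Q)) ^ (Q / P) =
        U₁ a ^ P₁ * U₂ (a + z) ^ P₂ := fun a => by
      rw [← ENNReal.rpow_mul, div_mul_div_cancel₀ hQ0.ne', div_self hP0.ne', ENNReal.rpow_one]
    have hG : ∀ a, (U₁ a ^ (P * (1 - P₁ / Q)) * U₂ (a + z) ^ (P * (1 - P₂ / Q))) ^ (Q / (Q - P)) =
        U₁ a ^ ((Q - P₁) * P / (Q - P)) * U₂ (a + z) ^ ((Q - P₂) * P / (Q - P)) := fun a => by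
      rw [ENNReal.mul_rpow_of_nonneg _ _ (by positivity), ← ENNReal.rpow_mul, ← ENNReal.rpow_mul]
      congr 2 <;> field_simp
    have hG2 : ∫⁻ a, U₁ a ^ ((Q - P₁) * P / (Q - P)) * U₂ (a + z) ^ ((Q - P₂) * P / (Q - P)) ≤ 2 := by
      have f1 : 0 ≤ Q - P₁ := sub_nonneg.2 hP₁Q
      have f2 : 0 ≤ Q - P₂ := sub_nonneg.2 hP₂Q
      refine lintegral_rpow_mul_rpow_le_two hp₁ hp₂ (by positivity) (by positivity) ?_ hm₁ h₁ h₂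
        (by simpa only [truncPow, if_neg ht₁] using i₁)
        (by simpa only [truncPow, if_neg ht₂] using i₂) z
      rw [ENNReal.toReal_inv, ENNReal.toReal_inv]
      change 1 ≤ _ * P₁⁻¹ + _ * P₂⁻¹
      have hP₁0 : 0 < P₁ := zero_lt_one.trans_le hP₁
      have hP₂0 : 0 < P₂ := zero_lt_one.trans_le hP₂
      have e : (Q - P₁) * P / (Q - P) * P₁⁻¹ + (Q - P₂) * P / (Q - P) * P₂⁻¹ =
          (P * Q * (P₁⁻¹ + P₂⁻¹) - 2 * P) / (Q - P) := by
        field_simp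
        ring
      -- After clearing denominators the exponent condition is precisely 1/P + 1/Q ≤ 1/P₁ + 1/P₂.
      rw [e, le_div_iff₀ hQP]
      have : P * Q * (P⁻¹ + Q⁻¹) ≤ P * Q * (P₁⁻¹ + P₂⁻¹) := by gcongr
      have e' : P * Q * (P⁻¹ + Q⁻¹) = Q + P := by field_simp
      linarith
    rw [← lintegral_congr hL] at hH
    simp only [hF, hG] at hH
    have hexp : 0 ≤ 1 / P * Q := by positivity
    refine (ENNReal.rpow_le_rpow hH hexp).trans ?_
    rw [ENNReal.mul_rpow_of_nonneg _ _ hexp, ← ENNReal.rpow_mul, ← ENNReal.rpow_mul, mul_comm,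
      show 1 / (Q / P) * (1 / P * Q) = 1 by field_simp, ENNReal.rpow_one,
      show 1 / (Q / (Q - P)) * (1 / P * Q) = Q / P - 1 by field_simp]
    gcongr
    exact sub_nonneg.2 ((one_le_div hP0).2 hPQ)
  have hQ0 : 0 < q.toReal := zero_lt_one.trans_le hQ
  have hP0 : 0 < p.toReal := zero_lt_one.trans_le hP
  rw [eLpNorm_ennreal h0q htq]
  have htot : ∫⁻ z, eLpNorm (fun a => U₁ a * U₂ (a + z)) p volume ^ q.toReal ≤
      2 ^ (q.toReal / p.toReal - 1) := by
    refine (lintegral_mono hin).trans ?_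
    rw [lintegral_const_mul' _ _ (ENNReal.rpow_ne_top_of_nonneg
      (sub_nonneg.2 ((one_le_div hP0).2 hPQ)) (by norm_num))]
    exact mul_le_of_le_one_right' hcorr
  refine (ENNReal.rpow_le_rpow htot (by positivity)).trans ?_
  rw [← ENNReal.rpow_mul]
  refine two_rpow_le_two ?_
  rw [mul_one_div, div_le_one hQ0]
  have : q.toReal / p.toReal ≤ q.toReal := div_le_self hQ0.le hP
  linarith

/-- Normalisation of a function by a bound on its norm, as needed for `eLpNorm_correlation_le_two`.
-/
theorem lintegral_truncPow_inv_mul_le {p c : ℝ≥0∞} (hp : 1 ≤ p) (hc0 : c ≠ 0) (hct : c ≠ ⊤)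
    {U : A → ℝ≥0∞} (h : eLpNorm U p volume ≤ c) : ∫⁻ a, truncPow p (c⁻¹ * U a) ≤ 1 := by
  unfold truncPow
  split_ifs with ht
  · simp
  have h0 : p ≠ 0 := (zero_lt_one.trans_le hp).ne'
  have hr0 : 0 < p.toReal := zero_lt_one.trans_le (one_le_toReal hp ht)
  rw [eLpNorm_ennreal h0 ht, one_div, ENNReal.rpow_inv_le_iff hr0] at h
  simp only [ENNReal.mul_rpow_of_nonneg _ _ hr0.le]
  rw [lintegral_const_mul' _ _ (ENNReal.rpow_ne_top_of_nonneg hr0.le (ENNReal.inv_ne_top.2 hc0))]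
  calc _ ≤ c⁻¹ ^ p.toReal * c ^ p.toReal := by gcongr
    _ = 1 := by
        rw [← ENNReal.mul_rpow_of_nonneg _ _ hr0.le, ENNReal.inv_mul_cancel hc0 hct,
          ENNReal.one_rpow]

/-- Young's inequality for a correlation of functions that are bounded by their norms. -/
theorem eLpNorm_correlation_le {p₁ p₂ p q : ℝ≥0∞} (hp₁ : 1 ≤ p₁) (hp₂ : 1 ≤ p₂) (hp : 1 ≤ p)
    (hpq : p ≤ q) (h1q : p₁ ≤ q) (h2q : p₂ ≤ q) (h : p⁻¹ + q⁻¹ ≤ p₁⁻¹ + p₂⁻¹)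
    {U₁ U₂ : A → ℝ≥0∞} (hm₁ : Measurable U₁) (hm₂ : Measurable U₂) {c₁ c₂ : ℝ≥0∞} (hc₁ : c₁ ≠ ⊤)
    (hc₂ : c₂ ≠ ⊤) (h₁ : ∀ a, U₁ a ≤ c₁) (h₂ : ∀ a, U₂ a ≤ c₂) (i₁ : eLpNorm U₁ p₁ volume ≤ c₁)
    (i₂ : eLpNorm U₂ p₂ volume ≤ c₂) :
    eLpNorm (fun z => eLpNorm (fun a => U₁ a * U₂ (a + z)) p volume) q volume ≤
      2 * (c₁ * c₂) := by
  have hq := hp.trans hpq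
  have key : ∀ c : ℝ≥0∞, c ≠ 0 → c ≠ ⊤ → ∀ u, u ≤ c → c * (c⁻¹ * u) = u ∧ c⁻¹ * u ≤ 1 := by
    intro c h0 ht u hu
    refine ⟨by rw [← mul_assoc, ENNReal.mul_inv_cancel h0 ht, one_mul], ?_⟩
    calc c⁻¹ * u ≤ c⁻¹ * c := by gcongr
      _ = 1 := ENNReal.inv_mul_cancel h0 ht
  have hzero : (∀ z a, U₁ a * U₂ (a + z) = 0) →
      eLpNorm (fun z => eLpNorm (fun a => U₁ a * U₂ (a + z)) p volume) q volume ≤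
        2 * (c₁ * c₂) := by
    intro hz
    simp only [hz]
    have e1 : eLpNorm (fun _ : A => (0 : ℝ≥0∞)) p volume = 0 := eLpNorm_zero
    have e2 : eLpNorm (fun _ : A => (0 : ℝ≥0∞)) q volume = 0 := eLpNorm_zero
    rw [e1, e2]
    exact zero_le
  by_cases h01 : c₁ = 0
  · exact hzero fun z a => by
      have := h₁ a
      rw [h01, nonpos_iff_eq_zero] at this
      rw [this, zero_mul]
  by_cases h02 : c₂ = 0
  · exact hzero fun z a => by
      have := h₂ (a + z)
      rw [h02, nonpos_iff_eq_zero] at this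
      rw [this, mul_zero]
  have e : ∀ z a, U₁ a * U₂ (a + z) = (c₁ * c₂) * ((c₁⁻¹ * U₁ a) * (c₂⁻¹ * U₂ (a + z))) := by
    intro z a
    rw [mul_mul_mul_comm, (key c₁ h01 hc₁ _ (h₁ a)).1, (key c₂ h02 hc₂ _ (h₂ _)).1]
  have hcc : c₁ * c₂ ≠ ⊤ := ENNReal.mul_ne_top hc₁ hc₂
  simp only [e, eLpNorm_ennreal_const_mul hp hcc]
  rw [eLpNorm_ennreal_const_mul hq hcc, mul_comm 2]
  gcongr
  exact eLpNorm_correlation_le_two (U₁ := fun a => c₁⁻¹ * U₁ a) (U₂ := fun a => c₂⁻¹ * U₂ a)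
    hp₁ hp₂ hp hpq h1q h2q h (hm₁.const_mul _) (hm₂.const_mul _)
    (fun a => (key c₁ h01 hc₁ _ (h₁ a)).2) (fun a => (key c₂ h02 hc₂ _ (h₂ a)).2)
    (lintegral_truncPow_inv_mul_le hp₁ h01 hc₁ i₁) (lintegral_truncPow_inv_mul_le hp₂ h02 hc₂ i₂)

end Correlation

/-! ### Polynomial weights and moderateness -/

section Weights


variable {V : Type*} [NormedAddCommGroup V] [InnerProductSpace ℝ V]

theorem weight_pos (s : ℝ) (z : V) : 0 < weight s z := by
  unfold weight
  positivity

theorem continuous_weight (s : ℝ) : Continuous (weight s : V → ℝ) := by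
  unfold weight
  refine Continuous.rpow_const (by fun_prop) fun x => Or.inl ?_
  positivity

theorem one_add_norm_add_sq_le (x y : V) :
    1 + ‖x + y‖ ^ 2 ≤ 2 * ((1 + ‖x‖ ^ 2) * (1 + ‖y‖ ^ 2)) := by
  have h := norm_add_le x y
  have : ‖x + y‖ ^ 2 ≤ (‖x‖ + ‖y‖) ^ 2 := by gcongr
  nlinarith [sq_nonneg (‖x‖ - ‖y‖), mul_nonneg (sq_nonneg ‖x‖) (sq_nonneg ‖y‖)]

/-- Peetre's inequality. -/
theorem weight_add_le (s : ℝ) (x y : V) :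
    weight s (x + y) ≤ 2 ^ (|s| / 2) * (weight s x * weight |s| y) := by
  unfold weight
  rcases le_total 0 s with hs | hs
  · rw [abs_of_nonneg hs, ← Real.mul_rpow (by positivity) (by positivity),
      ← Real.mul_rpow (by positivity) (by positivity)]
    exact Real.rpow_le_rpow (by positivity) (one_add_norm_add_sq_le x y) (by positivity)
  · rw [abs_of_nonpos hs]
    -- A negative exponent reverses the inequality, so it is applied to x = (x + y) + (-y).
    have h := one_add_norm_add_sq_le (x + y) (-y)
    rw [add_neg_cancel_right, norm_neg] at h
    have h1 : (1 + ‖x‖ ^ 2) ^ (-s / 2) ≤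
        2 ^ (-s / 2) * ((1 + ‖x + y‖ ^ 2) ^ (-s / 2) * (1 + ‖y‖ ^ 2) ^ (-s / 2)) := by
      rw [← Real.mul_rpow (by positivity) (by positivity),
        ← Real.mul_rpow (by positivity) (by positivity)]
      exact Real.rpow_le_rpow (by positivity) h (by linarith)
    have h2 : ∀ a : ℝ, 0 < a → a ^ (s / 2) = (a ^ (-s / 2))⁻¹ := fun a ha => by
      rw [← Real.rpow_neg ha.le]; congr 1; ring
    rw [h2 _ (by positivity), h2 (1 + ‖x‖ ^ 2) (by positivity),
      inv_le_iff_one_le_mul₀ (by positivity)]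
    have hx : 0 < (1 + ‖x‖ ^ 2) ^ (-s / 2) := by positivity
    calc (1 : ℝ) = (1 + ‖x‖ ^ 2) ^ (-s / 2) * ((1 + ‖x‖ ^ 2) ^ (-s / 2))⁻¹ :=
          (mul_inv_cancel₀ hx.ne').symm
      _ ≤ (2 ^ (-s / 2) * ((1 + ‖x + y‖ ^ 2) ^ (-s / 2) * (1 + ‖y‖ ^ 2) ^ (-s / 2))) *
          ((1 + ‖x‖ ^ 2) ^ (-s / 2))⁻¹ := by gcongr
      _ = _ := by
        generalize (1 + ‖x‖ ^ 2) ^ (-s / 2) = a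
        generalize (1 + ‖y‖ ^ 2) ^ (-s / 2) = b
        ring

theorem weight_abs_le (s : ℝ) (x : V) : weight |s| x ≤ (1 + ‖x‖) ^ ⌈|s|⌉₊ := by
  have h1 : (1 : ℝ) ≤ 1 + ‖x‖ := by linarith [norm_nonneg x]
  calc weight |s| x ≤ ((1 + ‖x‖) ^ (2 : ℝ)) ^ (|s| / 2) := by
        unfold weight
        refine Real.rpow_le_rpow (by positivity) ?_ (by positivity)
        rw [Real.rpow_two]
        nlinarith [norm_nonneg x]
    _ = (1 + ‖x‖) ^ |s| := by
        rw [← Real.rpow_mul (by positivity)]; congr 1; ring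
    _ ≤ (1 + ‖x‖) ^ ((⌈|s|⌉₊ : ℕ) : ℝ) := Real.rpow_le_rpow_of_exponent_le h1 (Nat.le_ceil _)
    _ = _ := Real.rpow_natCast _ _

theorem weight_neg (s : ℝ) (x : V) : weight s (-x) = weight s x := by
  simp [weight]

/-- A function on phase space which grows at most like a polynomial under translations. -/
def IsModerate (m : V → V → ℝ) (k : ℕ) : Prop :=
  ∃ C : ℝ, 0 ≤ C ∧ ∀ x ξ x' ξ', m x ξ ≤
    C * (m x' ξ' * ((1 + ‖x' - x‖) ^ k * (1 + ‖ξ' - ξ‖) ^ k))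

theorem isModerate_one : IsModerate (fun _ _ : V => (1 : ℝ)) 0 := ⟨1, zero_le_one, by simp⟩

theorem weight_le_of_sub (s : ℝ) (x x' : V) :
    weight s x ≤ 2 ^ (|s| / 2) * (weight s x' * (1 + ‖x' - x‖) ^ ⌈|s|⌉₊) := by
  have h := weight_add_le s x' (x - x')
  rw [add_sub_cancel] at h
  refine h.trans ?_
  have := (weight_pos s x').le
  rw [← norm_neg (x' - x), neg_sub]
  gcongr
  exact weight_abs_le s _

theorem isModerate_weight_fst (s : ℝ) : IsModerate (fun x _ : V => weight s x) ⌈|s|⌉₊ := by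
  refine ⟨2 ^ (|s| / 2), by positivity, fun x ξ x' ξ' => (weight_le_of_sub s x x').trans ?_⟩
  have := (weight_pos s x').le
  gcongr
  refine le_mul_of_one_le_right (by positivity) (one_le_pow₀ ?_)
  linarith [norm_nonneg (ξ' - ξ)]

theorem one_add_norm_toLp_le (x y : V) :
    1 + ‖WithLp.toLp 2 (x, y)‖ ≤ (1 + ‖x‖) * (1 + ‖y‖) := by
  have : ‖WithLp.toLp 2 (x, y)‖ ≤ ‖x‖ + ‖y‖ := by
    rw [WithLp.prod_norm_eq_of_L2]
    refine Real.sqrt_le_iff.2 ⟨by positivity, ?_⟩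
    simp only [WithLp.toLp_fst, WithLp.toLp_snd]
    nlinarith [norm_nonneg x, norm_nonneg y]
  nlinarith [mul_nonneg (norm_nonneg x) (norm_nonneg y)]

theorem isModerate_weight (s : ℝ) :
    IsModerate (fun x ξ : V => weight s (WithLp.toLp 2 (x, ξ))) ⌈|s|⌉₊ := by
  refine ⟨2 ^ (|s| / 2), by positivity, fun x ξ x' ξ' =>
    (weight_le_of_sub s _ (WithLp.toLp 2 (x', ξ'))).trans ?_⟩
  have := (weight_pos s (WithLp.toLp 2 (x', ξ'))).le
  gcongr
  rw [← mul_pow]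
  gcongr
  exact one_add_norm_toLp_le (x' - x) (ξ' - ξ)

end Weights

/-! ### Independence of the window and embeddings -/

section Window

variable {V : Type*} [NormedAddCommGroup V] [InnerProductSpace ℝ V] [MeasurableSpace V]
  [BorelSpace V] [FiniteDimensional ℝ V]

theorem exists_isKernel_decayKernel :
    ∃ (N : ℕ) (M : ℝ≥0), IsKernel (decayKernel N : V → ℝ≥0∞) M := by
  have h := finite_integral_one_add_norm (E := V) (μ := volume)
    (r := ((Module.finrank ℝ V + 1 : ℕ) : ℝ)) (by push_cast; linarith)
  -- One power more than the dimension makes the kernel integrable; the 1 added to its mass secures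
  -- `1 ≤ M`.
  refine ⟨Module.finrank ℝ V + 1,
    (∫⁻ x : V, decayKernel (Module.finrank ℝ V + 1) x).toNNReal + 1,
    measurable_decayKernel _, fun x => ?_, by simp, ?_⟩
  · unfold decayKernel
    rw [ENNReal.ofReal_le_one]
    exact Real.rpow_le_one_of_one_le_of_nonpos (by linarith [norm_nonneg x])
      (neg_nonpos.2 (Nat.cast_nonneg _))
  · rw [ENNReal.coe_add, ENNReal.coe_toNNReal (by exact h.ne)]
    exact le_self_add

/-- The polynomial loss of a moderate weight under translation is paid for by `k` additional powers
of decay. -/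
theorem decayKernel_mul_ofReal (N k : ℕ) (x : V) :
    decayKernel (N + k) x * ENNReal.ofReal ((1 + ‖x‖) ^ k) = decayKernel N x := by
  have h : 0 < 1 + ‖x‖ := by positivity
  rw [decayKernel, decayKernel, ← ENNReal.ofReal_mul (by positivity)]
  congr 1
  rw [Real.rpow_neg h.le, Real.rpow_neg h.le, Real.rpow_natCast, Real.rpow_natCast, pow_add]
  field_simp

/-- Change of the window of a weighted short-time Fourier transform. -/
theorem exists_enorm_stft_mul_le {g : 𝓢(V, ℂ)} (hg : g ≠ 0) (h : 𝓢(V, ℂ)) (N : ℕ)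
    {m : V → V → ℝ} {k : ℕ} (hm : IsModerate m k) (hm0 : ∀ x ξ, 0 ≤ m x ξ) : ∃ C : ℝ≥0,
    ∀ (f : 𝓢'(V, ℂ)) (x ξ : V), ‖stft h f x ξ‖ₑ * ENNReal.ofReal (m x ξ) ≤
      ∫⁻ x', ∫⁻ ξ', (C * (‖stft g f x' ξ'‖ₑ * ENNReal.ofReal (m x' ξ'))) *
        (decayKernel N (x' - x) * decayKernel N (ξ' - ξ)) := by
  obtain ⟨C, hC⟩ := exists_enorm_stft_le hg h (N + k)
  obtain ⟨D, hD0, hD⟩ := hm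
  refine ⟨C * D.toNNReal, fun f x ξ => ?_⟩
  calc _ ≤ (C * ∫⁻ x', ∫⁻ ξ', ‖stft g f x' ξ'‖ₑ *
        (decayKernel (N + k) (x' - x) * decayKernel (N + k) (ξ' - ξ))) * ENNReal.ofReal (m x ξ) := by
        gcongr; exact hC f x ξ
    _ = ∫⁻ x', ∫⁻ ξ', C * (‖stft g f x' ξ'‖ₑ *
        (decayKernel (N + k) (x' - x) * decayKernel (N + k) (ξ' - ξ))) * ENNReal.ofReal (m x ξ) := by
        simp only [lintegral_mul_const' _ _ ENNReal.ofReal_ne_top,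
          lintegral_const_mul' _ _ ENNReal.coe_ne_top]
    _ ≤ _ := by
        refine lintegral_mono fun x' => lintegral_mono fun ξ' => ?_
        rw [← decayKernel_mul_ofReal N k (x' - x), ← decayKernel_mul_ofReal N k (ξ' - ξ)]
        have h1 : ENNReal.ofReal (m x ξ) ≤ D.toNNReal * (ENNReal.ofReal (m x' ξ') *
            (ENNReal.ofReal ((1 + ‖x' - x‖) ^ k) * ENNReal.ofReal ((1 + ‖ξ' - ξ‖) ^ k))) := by
          rw [← ENNReal.ofReal_mul (by positivity), ← ENNReal.ofReal_mul (hm0 _ _)]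
          change _ ≤ ENNReal.ofReal D * _
          rw [← ENNReal.ofReal_mul hD0]
          exact ENNReal.ofReal_le_ofReal (hD x ξ x' ξ')
        refine (mul_le_mul' le_rfl h1).trans (le_of_eq ?_)
        rw [ENNReal.coe_mul]
        ring

theorem measurable_stft_mul (g : 𝓢(V, ℂ)) (f : 𝓢'(V, ℂ)) {m : V → V → ℝ}
    (hm : Continuous (Function.uncurry m)) :
    Measurable (Function.uncurry fun x ξ : V =>
      ‖stft g f x ξ‖ₑ * ENNReal.ofReal (m x ξ)) := by
  have h1 : Continuous fun w : V × V => stft g f w.1 w.2 :=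
    (continuous_stft g f).comp (WithLp.prod_continuous_toLp 2 V V)
  exact h1.measurable.enorm.mul (ENNReal.measurable_ofReal.comp hm.measurable)

/-- Change of window for modulation norms. -/
theorem exists_modulationNorm_le {g : 𝓢(V, ℂ)} (hg : g ≠ 0) (h : 𝓢(V, ℂ)) {p₀ p q₀ q : ℝ≥0∞}
    (hp₀ : 1 ≤ p₀) (hpp : p₀ ≤ p) (hq₀ : 1 ≤ q₀) (hqq : q₀ ≤ q) {m : WithLp 2 (V × V) → ℝ} {k : ℕ}
    (hm : IsModerate (fun x ξ => m (WithLp.toLp 2 (x, ξ))) k) (hm0 : ∀ z, 0 ≤ m z)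
    (hc : Continuous m) :
    ∃ C : ℝ≥0, ∀ f : 𝓢'(V, ℂ), modulationNorm h p q m f ≤ C * modulationNorm g p₀ q₀ m f := by
  obtain ⟨N, M, hN⟩ := exists_isKernel_decayKernel (V := V)
  obtain ⟨C, hC⟩ := exists_enorm_stft_mul_le hg h N hm fun x ξ => hm0 _
  refine ⟨M * M * C, fun f => ?_⟩
  have hG := measurable_stft_mul g f (m := fun x ξ => m (WithLp.toLp 2 (x, ξ)))
    (hc.comp (WithLp.prod_continuous_toLp 2 V V))
  have hG' : Measurable (Function.uncurry fun ξ x : V =>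
      (C : ℝ≥0∞) * (‖stft g f x ξ‖ₑ * ENNReal.ofReal (m (WithLp.toLp 2 (x, ξ))))) :=
    (hG.comp measurable_swap).const_mul _
  have h1 := hN.mixed_eLpNorm_le hN hp₀ hpp hq₀ hqq hG'
    (H := fun ξ x => ‖stft h f x ξ‖ₑ * ENNReal.ofReal (m (WithLp.toLp 2 (x, ξ))))
    (fun ξ x => by
      refine (hC f x ξ).trans (le_of_eq ?_)
      -- The modulation norm has `x` as its inner variable, whereas the pointwise bound integrates
      -- `ξ'` first.
      rw [lintegral_lintegral_swap]
      · simp only [mul_comm (decayKernel N (_ - x))]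
      · have mk := measurable_decayKernel (V := V) N
        refine Measurable.aemeasurable ?_
        refine (hG.const_mul (C : ℝ≥0∞)).mul ?_
        fun_prop)
  refine h1.trans (le_of_eq ?_)
  simp only [eLpNorm_ennreal_const_mul hp₀ ENNReal.coe_ne_top]
  rw [eLpNorm_ennreal_const_mul hq₀ ENNReal.coe_ne_top, ENNReal.coe_mul, ENNReal.coe_mul,
      ← mul_assoc]
  rfl

/-- The weighted supremum bound for the elements of modulation spaces. -/
theorem exists_enorm_stft_mul_le_modulationNorm {g : 𝓢(V, ℂ)} (hg : g ≠ 0) {p q : ℝ≥0∞}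
    (hp : 1 ≤ p) (hq : 1 ≤ q) {m : WithLp 2 (V × V) → ℝ} {k : ℕ}
    (hm : IsModerate (fun x ξ => m (WithLp.toLp 2 (x, ξ))) k) (hm0 : ∀ z, 0 ≤ m z)
    (hc : Continuous m) :
    ∃ C : ℝ≥0, ∀ (f : 𝓢'(V, ℂ)) (x ξ : V),
      ‖stft g f x ξ‖ₑ * ENNReal.ofReal (m (WithLp.toLp 2 (x, ξ))) ≤ C * modulationNorm g p q m f := by
  obtain ⟨N, M, hN⟩ := exists_isKernel_decayKernel (V := V)
  obtain ⟨C, hC⟩ := exists_enorm_stft_mul_le hg g N hm fun x ξ => hm0 _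
  refine ⟨M * M * C, fun f x ξ => ?_⟩
  have hG := measurable_stft_mul g f (m := fun x ξ => m (WithLp.toLp 2 (x, ξ)))
    (hc.comp (WithLp.prod_continuous_toLp 2 V V))
  have hG' : Measurable (Function.uncurry fun ξ x : V =>
      (C : ℝ≥0∞) * (‖stft g f x ξ‖ₑ * ENNReal.ofReal (m (WithLp.toLp 2 (x, ξ))))) :=
    (hG.comp measurable_swap).const_mul _
  have h1 := hN.le_mixed_eLpNorm hN hp hq hG' ξ x
  refine ((hC f x ξ).trans (le_of_eq ?_)).trans (h1.trans (le_of_eq ?_))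
  · rw [lintegral_lintegral_swap]
    · simp only [mul_comm (decayKernel N (_ - x))]
    · have mk := measurable_decayKernel (V := V) N
      refine Measurable.aemeasurable ?_
      refine (hG.const_mul (C : ℝ≥0∞)).mul ?_
      fun_prop
  · simp only [eLpNorm_ennreal_const_mul hp ENNReal.coe_ne_top]
    rw [eLpNorm_ennreal_const_mul hq ENNReal.coe_ne_top, ENNReal.coe_mul, ENNReal.coe_mul,
      ← mul_assoc]
    rfl

/-- With the weight inside, this is a plain mixed norm of a weighted transform, to which the kernel
estimates apply. -/
theorem wienerNorm_eq (g : 𝓢(V, ℂ)) {p : ℝ≥0∞} (hp : 1 ≤ p) (q : ℝ≥0∞) (w : V → ℝ)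
    (f : 𝓢'(V, ℂ)) : wienerNorm g p q w f = eLpNorm (fun x : V =>
      eLpNorm (fun ξ : V => ‖stft g f x ξ‖ₑ * ENNReal.ofReal (w x)) p volume) q volume := by
  unfold wienerNorm
  congr 1
  funext x
  simp only [mul_comm _ (ENNReal.ofReal (w x))]
  rw [eLpNorm_ennreal_const_mul hp ENNReal.ofReal_ne_top]

/-- Change of window for Wiener amalgam norms. -/
theorem exists_wienerNorm_le {g : 𝓢(V, ℂ)} (hg : g ≠ 0) (h : 𝓢(V, ℂ)) {p₀ p q : ℝ≥0∞}
    (hp₀ : 1 ≤ p₀) (hpp : p₀ ≤ p) (hq : 1 ≤ q) {w : V → ℝ} {k : ℕ}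
    (hm : IsModerate (fun x _ => w x) k) (hm0 : ∀ z, 0 ≤ w z) (hc : Continuous w) :
    ∃ C : ℝ≥0, ∀ f : 𝓢'(V, ℂ), wienerNorm h p q w f ≤ C * wienerNorm g p₀ q w f := by
  obtain ⟨N, M, hN⟩ := exists_isKernel_decayKernel (V := V)
  obtain ⟨C, hC⟩ := exists_enorm_stft_mul_le hg h N hm fun x ξ => hm0 _
  refine ⟨M * M * C, fun f => ?_⟩
  have hG := (measurable_stft_mul g f (m := fun x _ => w x)
    (hc.comp continuous_fst)).const_mul (C : ℝ≥0∞)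
  have h1 := hN.mixed_eLpNorm_le hN hp₀ hpp hq le_rfl (G := fun x ξ : V =>
      (C : ℝ≥0∞) * (‖stft g f x ξ‖ₑ * ENNReal.ofReal (w x))) hG (hC f)
  rw [wienerNorm_eq _ (hp₀.trans hpp), wienerNorm_eq _ hp₀]
  refine h1.trans (le_of_eq ?_)
  simp only [eLpNorm_ennreal_const_mul hp₀ ENNReal.coe_ne_top]
  rw [eLpNorm_ennreal_const_mul hq ENNReal.coe_ne_top, ENNReal.coe_mul, ENNReal.coe_mul,
      ← mul_assoc]

/-- Mixed norms with equal exponents are norms on the product. -/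
theorem eLpNorm_withLp_prod_le {p : ℝ≥0∞} (hp : 1 ≤ p) {f : WithLp 2 (V × V) → ℝ≥0∞}
    (hf : Measurable f) {A : ℝ≥0∞} (hA : ∀ z, f z ≤ A) (hfA : eLpNorm (fun y : V =>
      eLpNorm (fun x : V => f (WithLp.toLp 2 (x, y))) p volume) p volume ≤ A) :
    eLpNorm f p volume ≤ A := by
  by_cases ht : p = ⊤
  · rw [ht, eLpNorm_ennreal_top]
    exact essSup_le_of_ae_le _ (Filter.Eventually.of_forall hA)
  have h0 : p ≠ 0 := (zero_lt_one.trans_le hp).ne'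
  have hr := ENNReal.toReal_pos h0 ht
  refine le_trans (le_of_eq ?_) hfA
  simp only [eLpNorm_ennreal h0 ht]
  rw [lintegral_withLp_prod_symm (hf.pow_const _)]
  simp only [← ENNReal.rpow_mul, one_div_mul_cancel hr.ne', ENNReal.rpow_one]

end Window

/-! ### Functions of polynomial growth as tempered functionals -/

section Pairing

variable {E : Type*} [NormedAddCommGroup E] [NormedSpace ℝ E] [MeasurableSpace E]
  [BorelSpace E] [FiniteDimensional ℝ E] {μ : Measure E} [μ.HasTemperateGrowth]

theorem integrable_schwartz_mul {u : E → ℂ} (hu : Continuous u) {C : ℝ} {k : ℕ}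
    (h : ∀ x, ‖u x‖ ≤ C * (1 + ‖x‖) ^ k) (f : 𝓢(E, ℂ)) : Integrable (fun x => f x * u x) μ := by
  have h1 : Integrable (fun x => C * (2 ^ (k - 1) * (‖f x‖ + ‖x‖ ^ k * ‖f x‖))) μ :=
    ((f.integrable.norm.add (f.integrable_pow_mul μ k)).const_mul _).const_mul _
  have hC : 0 ≤ C := by simpa using (norm_nonneg _).trans (h 0)
  refine h1.mono' (f.continuous.mul hu).aestronglyMeasurable
    (Filter.Eventually.of_forall fun x => ?_)
  rw [norm_mul]
  calc ‖f x‖ * ‖u x‖ ≤ ‖f x‖ * (C * (2 ^ (k - 1) * (1 ^ k + ‖x‖ ^ k))) := by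
        gcongr
        refine (h x).trans ?_
        gcongr
        exact add_pow_le zero_le_one (norm_nonneg _) k
    _ = _ := by rw [one_pow]; ring

/-- The tempered functional given by a continuous function of polynomial growth. -/
theorem exists_clm_integral_mul {u : E → ℂ} (hu : Continuous u) {C : ℝ} {k : ℕ}
    (h : ∀ x, ‖u x‖ ≤ C * (1 + ‖x‖) ^ k) :
    ∃ T : 𝓢(E, ℂ) →L[ℂ] ℂ, ∀ f : 𝓢(E, ℂ), T f = ∫ x, f x * u x ∂μ := by
  have hint := integrable_schwartz_mul (μ := μ) hu h
  have hC : 0 ≤ C := by simpa using (norm_nonneg _).trans (h 0)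
  refine ⟨SchwartzMap.mkCLMtoNormedSpace (fun f => ∫ x, f x * u x ∂μ) (fun f g => ?_)
    (fun c f => ?_) ?_, fun f => rfl⟩
  · rw [← integral_add (hint f) (hint g)]
    simp [add_mul]
  · rw [RingHom.id_apply, smul_eq_mul, ← integral_const_mul]
    simp [mul_assoc]
  · obtain ⟨n, hn⟩ := Measure.HasTemperateGrowth.exists_integrable (μ := μ)
    -- Of the k + n powers of decay, `k` cancel the growth of `u` and `n` make the remainder
    -- integrable.
    refine ⟨Finset.Iic (k + n, 0), 2 ^ (k + n) * (C * ∫ x : E, (1 + ‖x‖) ^ (-(n : ℝ)) ∂μ),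
      by positivity, fun f => (norm_integral_le_integral_norm _).trans ?_⟩
    have h' : ∀ x, ‖f x * u x‖ ≤ (C * (1 + ‖x‖) ^ (-(n : ℝ))) *
        (2 ^ (k + n) * ((Finset.Iic (k + n, 0)).sup
          (fun m' => SchwartzMap.seminorm ℂ m'.1 m'.2) f)) := by
      intro x
      have h2 := one_add_le_sup_seminorm_apply (𝕜 := ℂ) (m := (k + n, 0)) (k := k + n) (n := 0)
        le_rfl le_rfl f x
      rw [norm_iteratedFDeriv_zero] at h2
      refine le_trans ?_ (mul_le_mul_of_nonneg_left h2 (by positivity))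
      rw [norm_mul, Real.rpow_neg (by positivity), Real.rpow_natCast, pow_add]
      have h3 : (1 + ‖x‖) ^ n ≠ 0 := by positivity
      calc _ ≤ ‖f x‖ * (C * (1 + ‖x‖) ^ k) := by gcongr; exact h x
        _ = _ := by field_simp
    refine (integral_mono (hint f).norm ((hn.const_mul C).mul_const _) h').trans (le_of_eq ?_)
    rw [integral_mul_const, integral_const_mul]
    unfold schwartzSeminormFamily
    ring

end Pairing

/-! ### Existence and uniqueness of the transform of two distributions -/

section Existence


variable {V : Type*} [NormedAddCommGroup V] [InnerProductSpace ℝ V] [MeasurableSpace V]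
  [BorelSpace V] [FiniteDimensional ℝ V]

theorem conjS_conjS (φ : 𝓢(V, ℂ)) : conjS (conjS φ) = φ := by
  ext t
  simp [conjS_apply]

theorem conjS_add (φ ψ : 𝓢(V, ℂ)) : conjS (φ + ψ) = conjS φ + conjS ψ := by
  ext t
  simp [conjS_apply]

theorem conjS_smul (c : ℂ) (φ : 𝓢(V, ℂ)) : conjS (c • φ) = conj c • conjS φ := by
  ext t
  simp [conjS_apply]

theorem continuous_conjS : Continuous (conjS : 𝓢(V, ℂ) → 𝓢(V, ℂ)) :=
  (SchwartzMap.postcompCLM (𝕜 := ℝ) (E := V) (Complex.conjCLE : ℂ →L[ℝ] ℂ)).continuous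

theorem bracket_coe_self (g : 𝓢(V, ℂ)) :
    bracket (g : 𝓢'(V, ℂ)) g = ((∫ x, ‖g x‖ ^ 2 : ℝ) : ℂ) := by
  rw [← integral_complex_ofReal, bracket, SchwartzMap.coe_apply]
  refine integral_congr_ae (Filter.Eventually.of_forall fun t => ?_)
  beta_reduce
  rw [conjS_apply, smul_eq_mul, Complex.conj_mul', Complex.ofReal_pow]

/-- By orthogonality the squared L² norm of V_{g₁}g₂ is the product of those of g₁ and g₂. -/
theorem stftS_ne_zero {g₁ g₂ : 𝓢(V, ℂ)} (hg₁ : g₁ ≠ 0) (hg₂ : g₂ ≠ 0) : stftS g₁ g₂ ≠ 0 := by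
  intro h0
  have h := isSTFT_stftS g₁ g₂ g₁ g₂
  rw [bracket_coe_self, bracket_coe_self, h0, bracket_coe_self, Complex.conj_ofReal] at h
  have h1 := (integral_norm_sq_pos hg₁).ne'
  have h2 := (integral_norm_sq_pos hg₂).ne'
  simp only [zero_apply, norm_zero] at h
  norm_cast at h
  simp [h1, h2] at h

/-- The product formula gives both distributions the same short-time Fourier transform for the
nonzero window V_g g, and the reproducing formula recovers a distribution from that. -/
theorem IsSTFT.unique {f₁ f₂ : 𝓢'(V, ℂ)} {F F' : 𝓢'(WithLp 2 (V × V), ℂ)} (hF : IsSTFT f₁ f₂ F)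
    (hF' : IsSTFT f₁ f₂ F') {g : 𝓢(V, ℂ)} (hg : g ≠ 0) : F' = F := by
  have h0 := stftS_ne_zero hg hg
  have h1 : ∀ h, bracket F' h = bracket F h := fun h => by
    obtain ⟨-, -, e1⟩ := bracket_eq_integral_stft F (stftS g g) h
    obtain ⟨-, -, e2⟩ := bracket_eq_integral_stft F' (stftS g g) h
    simp only [hF.stft_eq] at e1
    simp only [hF'.stft_eq] at e2
    have hA : ((∫ x, ‖stftS g g x‖ ^ 2 : ℝ) : ℂ) ≠ 0 := by
      exact_mod_cast (integral_norm_sq_pos h0).ne'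
    exact mul_left_cancel₀ hA (e2.trans e1.symm)
  ext h
  have := h1 (conjS h)
  rwa [bracket, bracket, conjS_conjS] at this

/-- The rotation `(x, ξ) ↦ (-ξ, x)` of phase space. -/
noncomputable def phaseRotation : WithLp 2 (V × V) ≃ₗᵢ[ℝ] WithLp 2 (V × V) where
  toFun z := WithLp.toLp 2 (-z.snd, z.fst)
  invFun z := WithLp.toLp 2 (z.snd, -z.fst)
  map_add' x y := by
    simp only [← WithLp.toLp_add, WithLp.add_fst, WithLp.add_snd, neg_add, Prod.mk_add_mk]
  map_smul' c x := by
    simp only [← WithLp.toLp_smul, WithLp.smul_fst, WithLp.smul_snd, Prod.smul_mk, smul_neg,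
      RingHom.id_apply]
  left_inv x := by
    simp only [WithLp.toLp_fst, WithLp.toLp_snd, neg_neg]; rfl
  right_inv x := by
    simp only [WithLp.toLp_fst, WithLp.toLp_snd, neg_neg]; rfl
  norm_map' z := by
    rw [WithLp.prod_norm_eq_of_L2, WithLp.prod_norm_eq_of_L2]
    change √(‖-z.snd‖ ^ 2 + ‖z.fst‖ ^ 2) = _
    rw [norm_neg, add_comm]

theorem phaseRotation_fst (z : WithLp 2 (V × V)) : (phaseRotation z).fst = -z.snd := rfl

theorem phaseRotation_snd (z : WithLp 2 (V × V)) : (phaseRotation z).snd = z.fst := rfl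

theorem phaseRotation_add_fst (z ζ : WithLp 2 (V × V)) :
    (phaseRotation ζ + WithLp.toLp 2 (0, z.snd)).fst = -ζ.snd := by
  simp [phaseRotation_fst]

theorem phaseRotation_add_snd (z ζ : WithLp 2 (V × V)) :
    (phaseRotation ζ + WithLp.toLp 2 (0, z.snd)).snd = ζ.fst + z.snd := by
  simp [phaseRotation_snd]

theorem phaseRotation_add_sub_fst (z ζ : WithLp 2 (V × V)) :
    (phaseRotation ζ + WithLp.toLp 2 (0, z.snd) - z).fst = -ζ.snd - z.fst := by
  simp [phaseRotation_fst]

theorem phaseRotation_add_sub_snd (z ζ : WithLp 2 (V × V)) :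
    (phaseRotation ζ + WithLp.toLp 2 (0, z.snd) - z).snd = ζ.fst := by
  simp [phaseRotation_snd]

theorem measurePreserving_phaseRotation_add (c : WithLp 2 (V × V)) :
    MeasurePreserving (fun ζ : WithLp 2 (V × V) => phaseRotation ζ + c) volume volume :=
  (measurePreserving_add_right volume c).comp (phaseRotation (V := V)).measurePreserving

theorem continuous_stft_comp {X : Type*} [TopologicalSpace X] (g : 𝓢(V, ℂ)) (f : 𝓢'(V, ℂ))
    {x ξ : X → V} (hx : Continuous x) (hξ : Continuous ξ) :
    Continuous fun w => stft g f (x w) (ξ w) := by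
  have h : Continuous fun w => WithLp.toLp 2 (x w, ξ w) :=
    (WithLp.prod_continuous_toLp 2 V V).comp (hx.prodMk hξ)
  simpa only [Function.comp_def, WithLp.toLp_fst, WithLp.toLp_snd] using
    (continuous_stft g f).comp h

set_option maxHeartbeats 800000 in
/-- Existence of the short-time Fourier transform of a tempered distribution with respect to a
tempered distribution, under an assumption on the growth. -/
theorem exists_isSTFT {g₁ g₂ : 𝓢(V, ℂ)} (hg₁ : g₁ ≠ 0) (hg₂ : g₂ ≠ 0) {f₁ f₂ : 𝓢'(V, ℂ)}
    {C₁ C₂ : ℝ} {k₁ k₂ : ℕ} (h₁ : ∀ x ξ, ‖stft g₁ f₁ x ξ‖ ≤ C₁ * ((1 + ‖x‖) * (1 + ‖ξ‖)) ^ k₁)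
    (h₂ : ∀ x ξ, ‖stft g₂ f₂ x ξ‖ ≤ C₂ * ((1 + ‖x‖) * (1 + ‖ξ‖)) ^ k₂) :
    ∃ F, IsSTFT f₁ f₂ F := by
  set A₁ : ℝ := ∫ x, ‖g₁ x‖ ^ 2
  set A₂ : ℝ := ∫ x, ‖g₂ x‖ ^ 2
  have hA₁ : (A₁ : ℂ) ≠ 0 := by exact_mod_cast (integral_norm_sq_pos hg₁).ne'
  have hA₂ : (A₂ : ℂ) ≠ 0 := by exact_mod_cast (integral_norm_sq_pos hg₂).ne'
  have hC₁ : 0 ≤ C₁ := by simpa using (norm_nonneg _).trans (h₁ 0 0)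
  have hC₂ : 0 ≤ C₂ := by simpa using (norm_nonneg _).trans (h₂ 0 0)
  let e : WithLp 2 (WithLp 2 (V × V) × WithLp 2 (V × V)) → ℂ := fun w =>
    conj (Complex.exp (2 * Real.pi * Complex.I * ((⟪w.fst.snd, w.snd.snd⟫ : ℝ) : ℂ)))
  -- By `IsSTFT.stft_eq`, this is what the transform of `F` with window V_{g₁}g₂ has to be.
  let u : WithLp 2 (WithLp 2 (V × V) × WithLp 2 (V × V)) → ℂ := fun w =>
    e w * (stft g₂ f₂ (-w.snd.snd) (w.snd.fst + w.fst.snd) *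
          conj (stft g₁ f₁ (-w.snd.snd - w.fst.fst) w.snd.fst))
  have he : ∀ w, ‖e w‖ = 1 := fun w => by
    rw [RCLike.norm_conj, norm_cexp_two_pi_mul]
  have c1 : Continuous fun w : WithLp 2 (WithLp 2 (V × V) × WithLp 2 (V × V)) => w.fst :=
    (WithLp.fstL 2 ℝ _ _).continuous
  have c2 : Continuous fun w : WithLp 2 (WithLp 2 (V × V) × WithLp 2 (V × V)) => w.snd :=
    (WithLp.sndL 2 ℝ _ _).continuous
  have c3 : Continuous fun w : WithLp 2 (V × V) => w.fst := (WithLp.fstL 2 ℝ _ _).continuous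
  have c4 : Continuous fun w : WithLp 2 (V × V) => w.snd := (WithLp.sndL 2 ℝ _ _).continuous
  have c11 := c3.comp c1
  have c12 := c4.comp c1
  have c21 := c3.comp c2
  have c22 := c4.comp c2
  simp only [Function.comp_def] at c11 c12 c21 c22
  have hu : Continuous u := by
    refine Continuous.mul ?_ (Continuous.mul ?_ ?_)
    · exact Complex.continuous_conj.comp (Complex.continuous_exp.comp (continuous_const.mul
        (Complex.continuous_ofReal.comp (c12.inner c22))))
    · exact continuous_stft_comp g₂ f₂ c22.neg (c21.add c12)
    · exact Complex.continuous_conj.comp (continuous_stft_comp g₁ f₁ (c22.neg.sub c11) c21)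
  have hb : ∀ w, ‖u w‖ ≤ (C₂ * 4 ^ k₂ * (C₁ * 4 ^ k₁)) * (1 + ‖w‖) ^ (2 * k₂ + 2 * k₁) := by
    intro w
    have n1 : ‖w.fst‖ ≤ ‖w‖ := WithLp.norm_fst_le (p := 2) _ w
    have n2 : ‖w.snd‖ ≤ ‖w‖ := WithLp.norm_snd_le (p := 2) _ w
    have n11 : ‖w.fst.fst‖ ≤ ‖w‖ := (WithLp.norm_fst_le (p := 2) _ w.fst).trans n1
    have n12 : ‖w.fst.snd‖ ≤ ‖w‖ := (WithLp.norm_snd_le (p := 2) _ w.fst).trans n1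
    have n21 : ‖w.snd.fst‖ ≤ ‖w‖ := (WithLp.norm_fst_le (p := 2) _ w.snd).trans n2
    have n22 : ‖w.snd.snd‖ ≤ ‖w‖ := (WithLp.norm_snd_le (p := 2) _ w.snd).trans n2
    have s1 : 1 + ‖-w.snd.snd‖ ≤ 2 * (1 + ‖w‖) := by
      rw [norm_neg]; linarith [norm_nonneg w]
    have s2 : 1 + ‖w.snd.fst + w.fst.snd‖ ≤ 2 * (1 + ‖w‖) := by
      linarith [norm_add_le w.snd.fst w.fst.snd]
    have s3 : 1 + ‖-w.snd.snd - w.fst.fst‖ ≤ 2 * (1 + ‖w‖) := by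
      have := norm_sub_le (-w.snd.snd) w.fst.fst
      rw [norm_neg] at this
      linarith
    have s4 : 1 + ‖w.snd.fst‖ ≤ 2 * (1 + ‖w‖) := by linarith [norm_nonneg w]
    rw [norm_mul, he, one_mul, norm_mul, RCLike.norm_conj]
    calc _ ≤ (C₂ * ((2 * (1 + ‖w‖)) * (2 * (1 + ‖w‖))) ^ k₂) *
          (C₁ * ((2 * (1 + ‖w‖)) * (2 * (1 + ‖w‖))) ^ k₁) := by
          refine mul_le_mul ((h₂ _ _).trans ?_) ((h₁ _ _).trans ?_) (norm_nonneg _) (by positivity)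
          all_goals gcongr
      _ = _ := by
          rw [show (2 * (1 + ‖w‖)) * (2 * (1 + ‖w‖)) = 4 * (1 + ‖w‖) ^ 2 by ring, mul_pow, mul_pow,
            pow_add, pow_mul, pow_mul]
          ring
  obtain ⟨T, hT⟩ := exists_clm_integral_mul (μ := volume) hu hb
  have hint := integrable_schwartz_mul (μ := volume) hu hb
  set Φ := stftS g₁ g₂
  -- `F` is obtained from `u` by the reproducing formula, with `A₁ * A₂` the squared norm of
  -- V_{g₁}g₂. The two conjugations make the functional linear.
  let L : 𝓢(WithLp 2 (V × V), ℂ) →L[ℂ] ℂ :=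
    { toFun := fun Ψ => T (conjS (stftCLM Φ (conjS Ψ)))
      map_add' := fun Ψ₁ Ψ₂ => by simp only [conjS_add, map_add]
      map_smul' := fun c Ψ => by
        simp only [conjS_smul, map_smul, Complex.conj_conj, RingHom.id_apply]
      cont := T.continuous.comp (continuous_conjS.comp
        ((stftCLM Φ).continuous.comp continuous_conjS)) }
  refine ⟨ContinuousLinearMap.toPointwiseConvergenceCLM _ _ _ _ (((A₁ : ℂ) * A₂)⁻¹ • L),
    fun φ ψ => ?_⟩
  have hL : bracket (ContinuousLinearMap.toPointwiseConvergenceCLM _ _ _ _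
      (((A₁ : ℂ) * A₂)⁻¹ • L)) (stftS φ ψ) =
      ((A₁ : ℂ) * A₂)⁻¹ * T (conjS (stftS Φ (stftS φ ψ))) := by
    change ((A₁ : ℂ) * A₂)⁻¹ * T (conjS (stftCLM Φ (conjS (conjS (stftS φ ψ))))) = _
    rw [conjS_conjS, stftCLM_apply]
  rw [hL, inv_mul_eq_iff_eq_mul₀ (mul_ne_zero hA₁ hA₂)]
  obtain ⟨-, i₁, e₁⟩ := bracket_eq_integral_stft f₁ g₁ φ
  obtain ⟨-, i₂, e₂⟩ := bracket_eq_integral_stft f₂ g₂ ψ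
  set H₁ := fun z : WithLp 2 (V × V) => conj (stftFun g₁ φ z) * stft g₁ f₁ z.fst z.snd
  set H₂ := fun z : WithLp 2 (V × V) => conj (stftFun g₂ ψ z) * stft g₂ f₂ z.fst z.snd
  -- The phases of the two transforms cancel. In the variable b, a rotated and translated ζ, the
  -- integrand is that of a convolution evaluated at z.
  have key : ∀ z ζ : WithLp 2 (V × V),
      conjS (stftS Φ (stftS φ ψ)) (WithLp.toLp 2 (z, ζ)) * u (WithLp.toLp 2 (z, ζ)) =
        (fun b => H₂ b * conj (H₁ (-(z - b)))) (phaseRotation ζ + WithLp.toLp 2 (0, z.snd)) := by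
    intro z ζ
    have e1 := (isSTFT_stftS φ ψ).stft_eq g₁ g₂ z ζ
    rw [show stft (stftS g₁ g₂) (stftS φ ψ : 𝓢'(WithLp 2 (V × V), ℂ)) z ζ =
      stftFun (stftS g₁ g₂) (stftS φ ψ) (WithLp.toLp 2 (z, ζ)) from stft_coe _ _
        (WithLp.toLp 2 (z, ζ))] at e1
    have e2 := stft_coe g₂ ψ (phaseRotation ζ + WithLp.toLp 2 (0, z.snd))
    have e3 := stft_coe g₁ φ (phaseRotation ζ + WithLp.toLp 2 (0, z.snd) - z)
    rw [phaseRotation_add_fst, phaseRotation_add_snd] at e2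
    rw [phaseRotation_add_sub_fst, phaseRotation_add_sub_snd] at e3
    set E := Complex.exp (2 * Real.pi * Complex.I * ((⟪z.snd, ζ.snd⟫ : ℝ) : ℂ)) with hE
    have hee : E * conj E = 1 := by
      rw [Complex.mul_conj', hE, norm_cexp_two_pi_mul]; simp
    beta_reduce
    rw [conjS_apply, stftS_apply, e1, e2, e3, neg_sub]
    simp only [H₁, H₂, phaseRotation_add_fst, phaseRotation_add_snd, phaseRotation_add_sub_fst,
      phaseRotation_add_sub_snd, map_mul, Complex.conj_conj]
    change E * _ * (conj E * (stft g₂ f₂ (-ζ.snd) (ζ.fst + z.snd) *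
      conj (stft g₁ f₁ (-ζ.snd - z.fst) ζ.fst))) = _
    linear_combination (conj (stftFun g₂ ψ (phaseRotation ζ + WithLp.toLp 2 (0, z.snd))) *
      stftFun g₁ φ (phaseRotation ζ + WithLp.toLp 2 (0, z.snd) - z) *
      stft g₂ f₂ (-ζ.snd) (ζ.fst + z.snd) * conj (stft g₁ f₁ (-ζ.snd - z.fst) ζ.fst)) * hee
  have hmp := WithLp.volume_preserving_toLp (WithLp 2 (V × V)) (WithLp 2 (V × V))
  have hint' := hmp.integrable_comp_of_integrable (hint (conjS (stftS Φ (stftS φ ψ))))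
  rw [hT, ← hmp.integral_comp (MeasurableEquiv.toLp 2 _).measurableEmbedding,
    Measure.volume_eq_prod]
  refine (integral_prod _ hint').trans ?_
  have hrot : ∀ (z : WithLp 2 (V × V)) (G : WithLp 2 (V × V) → ℂ),
      ∫ ζ, G (phaseRotation ζ + WithLp.toLp 2 (0, z.snd)) = ∫ b, G b := fun z G => by
    rw [(phaseRotation (V := V)).measurePreserving.integral_comp
      (phaseRotation (V := V)).toHomeomorph.measurableEmbedding
      (fun b => G (b + WithLp.toLp 2 (0, z.snd))), integral_add_right_eq_self]
  refine (integral_congr_ae (Filter.Eventually.of_forall fun z =>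
    (integral_congr_ae (Filter.Eventually.of_forall (key z))).trans
      (hrot z fun b => H₂ b * conj (H₁ (-(z - b)))))).trans ?_
  have i₁' : Integrable fun z => conj (H₁ (-z)) := by
    exact (Complex.conjLIE.toContinuousLinearEquiv.toContinuousLinearMap.integrable_comp
      i₁.comp_neg)
  -- The two factors are the reproducing integrals for ⟨f₂, ψ⟩ and the conjugate of ⟨f₁, φ⟩.
  have hconv : ∫ z, ∫ b, H₂ b * conj (H₁ (-(z - b))) = (∫ b, H₂ b) * ∫ z, conj (H₁ (-z)) :=
    integral_convolution (ContinuousLinearMap.mul ℂ ℂ) i₂ i₁'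
  rw [hconv, integral_neg_eq_self (fun z => conj (H₁ z)), integral_conj, ← e₁, ← e₂, map_mul,
    Complex.conj_ofReal]
  ring

end Existence

/-! ### Sufficiency of the exponent conditions -/

section Boundedness

variable {V : Type*} [NormedAddCommGroup V] [InnerProductSpace ℝ V] [MeasurableSpace V]
  [BorelSpace V] [FiniteDimensional ℝ V]

/-- Moderateness between 0 and z bounds the weight below by an inverse power, so a weighted sup
bound becomes the polynomial growth required by `exists_isSTFT`. -/
theorem norm_stft_le_of_enorm_mul_weight_le {g : 𝓢(V, ℂ)} {f : 𝓢'(V, ℂ)} {s : ℝ} {A : ℝ≥0∞}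
    (hA : A ≠ ⊤) (h : ∀ x ξ, ‖stft g f x ξ‖ₑ * ENNReal.ofReal (weight s (WithLp.toLp 2 (x, ξ))) ≤ A)
    (x ξ : V) : ‖stft g f x ξ‖ ≤
      (A.toReal * 2 ^ (|s| / 2)) * ((1 + ‖x‖) * (1 + ‖ξ‖)) ^ ⌈|s|⌉₊ := by
  set z := WithLp.toLp 2 (x, ξ) with hz
  have hw := weight_pos s z
  have h1 : ‖stft g f x ξ‖ * weight s z ≤ A.toReal := by
    have := ENNReal.toReal_mono hA (h x ξ)
    rwa [ENNReal.toReal_mul, toReal_enorm, ENNReal.toReal_ofReal hw.le] at this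
  have h2 : 1 ≤ 2 ^ (|s| / 2) * (weight s z * ((1 + ‖x‖) * (1 + ‖ξ‖)) ^ ⌈|s|⌉₊) := by
    have h3 := weight_le_of_sub s (0 : WithLp 2 (V × V)) z
    rw [sub_zero, show weight s (0 : WithLp 2 (V × V)) = 1 by simp [weight]] at h3
    refine h3.trans ?_
    gcongr
    exact one_add_norm_toLp_le x ξ
  have h0 := norm_nonneg (stft g f x ξ)
  calc ‖stft g f x ξ‖ ≤ ‖stft g f x ξ‖ *
        (2 ^ (|s| / 2) * (weight s z * ((1 + ‖x‖) * (1 + ‖ξ‖)) ^ ⌈|s|⌉₊)) :=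
        le_mul_of_one_le_right h0 h2
    _ = (‖stft g f x ξ‖ * weight s z) * (2 ^ (|s| / 2) * ((1 + ‖x‖) * (1 + ‖ξ‖)) ^ ⌈|s|⌉₊) := by
        ring
    _ ≤ A.toReal * (2 ^ (|s| / 2) * ((1 + ‖x‖) * (1 + ‖ξ‖)) ^ ⌈|s|⌉₊) := by gcongr
    _ = _ := by ring

/-- The weighted modulus of the short-time Fourier transform. -/
noncomputable def weightedSTFT (g : 𝓢(V, ℂ)) (s : ℝ) (f : 𝓢'(V, ℂ)) (z : WithLp 2 (V × V)) :
    ℝ≥0∞ := ‖stft g f z.fst z.snd‖ₑ * ENNReal.ofReal (weight s z)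

theorem measurable_weightedSTFT (g : 𝓢(V, ℂ)) (s : ℝ) (f : 𝓢'(V, ℂ)) :
    Measurable (weightedSTFT g s f) :=
  (continuous_stft g f).measurable.enorm.mul
    (ENNReal.measurable_ofReal.comp (continuous_weight s).measurable)

theorem exists_weightedSTFT_le {g : 𝓢(V, ℂ)} (hg : g ≠ 0) (s : ℝ) {p : ℝ≥0∞} (hp : 1 ≤ p) :
    ∃ C : ℝ≥0, ∀ f : 𝓢'(V, ℂ),
      (∀ z, weightedSTFT g s f z ≤ C * modulationNorm g p p (weight s) f) ∧
      eLpNorm (weightedSTFT g s f) p volume ≤ C * modulationNorm g p p (weight s) f := by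
  obtain ⟨C, hC⟩ := exists_enorm_stft_mul_le_modulationNorm hg hp hp (isModerate_weight s)
    (fun z => (weight_pos s z).le) (continuous_weight s)
  refine ⟨C + 1, fun f => ?_⟩
  have h1 : ∀ z, weightedSTFT g s f z ≤ (C + 1 : ℝ≥0) * modulationNorm g p p (weight s) f :=
    fun z => (hC f z.fst z.snd).trans (by gcongr; simp)
  refine ⟨h1, eLpNorm_withLp_prod_le hp (measurable_weightedSTFT g s f) h1 ?_⟩
  calc _ = modulationNorm g p p (weight s) f := rfl
    _ ≤ _ := le_mul_of_one_le_left' (by simp)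

/-- The measure-preserving substitution from ζ to a turns the product formula into U₁(a) U₂(a + z).
Peetre's inequality for z = (a + z) + (-a) puts the weight of order s on the second factor and that
of order |s| on the first. -/
theorem IsSTFT.wienerNorm_le {f₁ f₂ : 𝓢'(V, ℂ)} {F : 𝓢'(WithLp 2 (V × V), ℂ)}
    (hF : IsSTFT f₁ f₂ F) (g₁ g₂ : 𝓢(V, ℂ)) (s : ℝ) {p : ℝ≥0∞} (hp : 1 ≤ p) {q : ℝ≥0∞}
    (hq : 1 ≤ q) :
    wienerNorm (stftS g₁ g₂) p q (weight s) F ≤ ENNReal.ofReal (2 ^ (|s| / 2)) *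
      eLpNorm (fun z => eLpNorm (fun a => weightedSTFT g₁ |s| f₁ a * weightedSTFT g₂ s f₂ (a + z))
        p volume) q volume := by
  rw [wienerNorm_eq _ hp, ← eLpNorm_ennreal_const_mul hq ENNReal.ofReal_ne_top]
  refine eLpNorm_ennreal_mono fun z => ?_
  have hm : Measurable fun a => ENNReal.ofReal (2 ^ (|s| / 2)) *
      (weightedSTFT g₁ |s| f₁ a * weightedSTFT g₂ s f₂ (a + z)) :=
    ((measurable_weightedSTFT g₁ |s| f₁).mul ((measurable_weightedSTFT g₂ s f₂).comp
      (measurable_id.add_const z))).const_mul _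
  rw [← eLpNorm_ennreal_const_mul hp ENNReal.ofReal_ne_top,
    ← eLpNorm_comp_measurePreserving hm.aestronglyMeasurable
      (measurePreserving_phaseRotation_add (WithLp.toLp 2 (0, z.snd) - z))]
  refine eLpNorm_ennreal_mono fun ζ => ?_
  simp only [Function.comp_apply]
  rw [hF.enorm_stft_eq, ← add_sub_assoc, sub_add_cancel]
  set b := phaseRotation ζ + WithLp.toLp 2 (0, z.snd) with hb
  have hz : z = b + -(b - z) := by abel
  have hw : ENNReal.ofReal (weight s z) ≤ ENNReal.ofReal (2 ^ (|s| / 2)) *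
      (ENNReal.ofReal (weight s b) * ENNReal.ofReal (weight |s| (b - z))) := by
    rw [← ENNReal.ofReal_mul (weight_pos _ _).le, ← ENNReal.ofReal_mul (by positivity),
      ← weight_neg |s| (b - z)]
    refine ENNReal.ofReal_le_ofReal ?_
    conv_lhs => rw [hz]
    exact weight_add_le s b _
  refine (mul_le_mul' le_rfl hw).trans (le_of_eq ?_)
  simp only [weightedSTFT]
  rw [hb, phaseRotation_add_sub_fst, phaseRotation_add_sub_snd, phaseRotation_add_fst,
    phaseRotation_add_snd]
  ring

/-- Boundedness of the short-time Fourier transform from modulation spaces to Wiener amalgam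
spaces. -/
theorem exists_isSTFT_wienerNorm_le {p₁ p₂ p q : ℝ≥0∞} (hp₁ : 1 ≤ p₁) (hp₂ : 1 ≤ p₂) (hp : 1 ≤ p)
    (hq : 1 ≤ q) {g₁ g₂ : 𝓢(V, ℂ)} (hg₁ : g₁ ≠ 0) (hg₂ : g₂ ≠ 0) (Φ : 𝓢(WithLp 2 (V × V), ℂ))
    (h₁ : p₁ ≤ q) (h₂ : p₂ ≤ q) (h : p⁻¹ + q⁻¹ ≤ p₁⁻¹ + p₂⁻¹) (s : ℝ) :
    ∃ C : ℝ≥0, ∀ f₁ f₂ : 𝓢'(V, ℂ),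
      MemModulation g₁ p₁ p₁ (weight |s|) f₁ → MemModulation g₂ p₂ p₂ (weight s) f₂ →
      ∃ F, IsSTFT f₁ f₂ F ∧ (∀ F', IsSTFT f₁ f₂ F' → F' = F) ∧
        MemWiener Φ p q (weight s) F ∧
        wienerNorm Φ p q (weight s) F ≤
          C * modulationNorm g₁ p₁ p₁ (weight |s|) f₁ * modulationNorm g₂ p₂ p₂ (weight s) f₂ := by
  obtain ⟨p₀, hp₀, hpp, hpq, hh⟩ : ∃ p₀ : ℝ≥0∞, 1 ≤ p₀ ∧ p₀ ≤ p ∧ p₀ ≤ q ∧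
      p₀⁻¹ + q⁻¹ ≤ p₁⁻¹ + p₂⁻¹ := by
    -- For p > q the inner exponent q is used instead: the sum condition then follows from p₁, p₂ ≤
    -- q, and the change of window raises the exponent back to p.
    rcases le_total p q with hle | hle
    · exact ⟨p, hp, le_rfl, hle, h⟩
    · exact ⟨q, hq, hle, le_rfl, add_le_add (ENNReal.inv_le_inv.2 h₁) (ENNReal.inv_le_inv.2 h₂)⟩
  obtain ⟨C₁, hC₁⟩ := exists_weightedSTFT_le hg₁ |s| hp₁
  obtain ⟨C₂, hC₂⟩ := exists_weightedSTFT_le hg₂ s hp₂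
  obtain ⟨C₃, hC₃⟩ := exists_wienerNorm_le (stftS_ne_zero hg₁ hg₂) Φ hp₀ hpp hq
    (isModerate_weight_fst s) (fun z => (weight_pos s z).le) (continuous_weight s)
  refine ⟨C₃ * ((2 ^ (|s| / 2) : ℝ).toNNReal * (2 * (C₁ * C₂))), fun f₁ f₂ hf₁ hf₂ => ?_⟩
  obtain ⟨a₁, b₁⟩ := hC₁ f₁
  obtain ⟨a₂, b₂⟩ := hC₂ f₂
  have t₁ : (C₁ : ℝ≥0∞) * modulationNorm g₁ p₁ p₁ (weight |s|) f₁ ≠ ⊤ :=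
    ENNReal.mul_ne_top ENNReal.coe_ne_top hf₁.ne
  have t₂ : (C₂ : ℝ≥0∞) * modulationNorm g₂ p₂ p₂ (weight s) f₂ ≠ ⊤ :=
    ENNReal.mul_ne_top ENNReal.coe_ne_top hf₂.ne
  obtain ⟨F, hF⟩ := exists_isSTFT hg₁ hg₂
    (norm_stft_le_of_enorm_mul_weight_le t₁ fun x ξ => a₁ (WithLp.toLp 2 (x, ξ)))
    (norm_stft_le_of_enorm_mul_weight_le t₂ fun x ξ => a₂ (WithLp.toLp 2 (x, ξ)))
  have hmain : wienerNorm Φ p q (weight s) F ≤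
      (C₃ * ((2 ^ (|s| / 2) : ℝ).toNNReal * (2 * (C₁ * C₂))) : ℝ≥0) *
        modulationNorm g₁ p₁ p₁ (weight |s|) f₁ * modulationNorm g₂ p₂ p₂ (weight s) f₂ := by
    calc _ ≤ C₃ * (ENNReal.ofReal (2 ^ (|s| / 2)) *
          (2 * ((C₁ * modulationNorm g₁ p₁ p₁ (weight |s|) f₁) *
            (C₂ * modulationNorm g₂ p₂ p₂ (weight s) f₂)))) := by
          refine (hC₃ F).trans ?_
          gcongr
          refine (hF.wienerNorm_le g₁ g₂ s hp₀ hq).trans ?_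
          gcongr
          exact eLpNorm_correlation_le hp₁ hp₂ hp₀ hpq h₁ h₂ hh (measurable_weightedSTFT g₁ |s| f₁)
            (measurable_weightedSTFT g₂ s f₂) t₁ t₂ a₁ a₂ b₁ b₂
      _ = _ := by
          push_cast
          rw [show ((2 ^ (|s| / 2) : ℝ).toNNReal : ℝ≥0∞) = ENNReal.ofReal (2 ^ (|s| / 2)) from rfl]
          ring
  refine ⟨F, hF, fun F' hF' => hF.unique hF' hg₁, hmain.trans_lt ?_, hmain⟩
  exact ENNReal.mul_lt_top (ENNReal.mul_lt_top ENNReal.coe_lt_top hf₁) hf₂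

end Boundedness

/-! ### Gaussians and their short-time Fourier transforms -/

section Gaussian

variable {V : Type*} [NormedAddCommGroup V] [InnerProductSpace ℝ V]

/-- One term of the exponential series at a(1 + r²), together with 1 + r ≤ 2(1 + r²). -/
theorem one_add_pow_le_exp {a : ℝ} (ha : 0 < a) (m : ℕ) {r : ℝ} (hr : 0 ≤ r) :
    (1 + r) ^ m ≤ (2 / a) ^ m * m.factorial * Real.exp a * Real.exp (a * r ^ 2) := by
  have h1 : (a * (1 + r ^ 2)) ^ m / m.factorial ≤ Real.exp (a * (1 + r ^ 2)) :=
    Real.pow_div_factorial_le_exp _ (by positivity) m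
  rw [div_le_iff₀ (by positivity)] at h1
  have h2 : 1 + r ≤ (2 / a) * (a * (1 + r ^ 2)) := by
    rw [← mul_assoc, div_mul_cancel₀ _ ha.ne']
    nlinarith [sq_nonneg (r - 1)]
  calc (1 + r) ^ m ≤ ((2 / a) * (a * (1 + r ^ 2))) ^ m := by gcongr
    _ = (2 / a) ^ m * (a * (1 + r ^ 2)) ^ m := mul_pow _ _ _
    _ ≤ (2 / a) ^ m * (Real.exp (a * (1 + r ^ 2)) * m.factorial) := by gcongr
    _ = _ := by rw [mul_add, mul_one, Real.exp_add]; ring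

theorem exists_decay_gaussian {a : ℝ} (ha : 0 < a) (k n : ℕ) : ∃ C : ℝ, ∀ x : V,
    ‖x‖ ^ k * ‖iteratedFDeriv ℝ n (fun x => Real.exp (-a * ‖x‖ ^ 2)) x‖ ≤ C := by
  have htg : (fun x : V => -a * ‖x‖ ^ 2).HasTemperateGrowth := by
    have := Function.hasTemperateGrowth_norm_sq (H := V)
    fun_prop
  obtain ⟨l, K, hK, h⟩ := htg.norm_iteratedFDeriv_le_uniform n
  -- `K + 1` in place of `K` makes the base of the composition bound at least 1, so that it is
  -- dominated by its positive powers.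
  refine ⟨n.factorial * (K + 1) ^ n * ((2 / a) ^ (k + l * n) * (k + l * n).factorial * Real.exp a),
    fun x => ?_⟩
  have h1 : ‖iteratedFDeriv ℝ n (Real.exp ∘ fun x : V => -a * ‖x‖ ^ 2) x‖ ≤
      n.factorial * Real.exp (-a * ‖x‖ ^ 2) * ((K + 1) * (1 + ‖x‖) ^ l) ^ n := by
    refine norm_iteratedFDeriv_comp_le (N := ∞) Real.contDiff_exp htg.1 (mod_cast le_top) x
      (fun i _ => ?_) (fun i hi hin => (h i hin x).trans ?_)
    · rw [norm_iteratedFDeriv_eq_norm_iteratedDeriv, iteratedDeriv_eq_iterate, Real.iter_deriv_exp,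
        Real.norm_of_nonneg (Real.exp_pos _).le]
    · have h2 : 1 ≤ (1 + ‖x‖) ^ l := one_le_pow₀ (by linarith [norm_nonneg x])
      calc K * (1 + ‖x‖) ^ l ≤ (K + 1) * (1 + ‖x‖) ^ l := by gcongr; linarith
        _ ≤ _ := le_self_pow₀ (by nlinarith) (by omega)
  have h3 := one_add_pow_le_exp ha (k + l * n) (norm_nonneg x)
  have h4 : Real.exp (-a * ‖x‖ ^ 2) * Real.exp (a * ‖x‖ ^ 2) = 1 := by
    rw [← Real.exp_add]; simp
  calc _ ≤ (1 + ‖x‖) ^ k * (n.factorial * Real.exp (-a * ‖x‖ ^ 2) *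
        ((K + 1) * (1 + ‖x‖) ^ l) ^ n) := by
        gcongr
        · linarith
        · exact h1
    _ = n.factorial * (K + 1) ^ n * (Real.exp (-a * ‖x‖ ^ 2) * (1 + ‖x‖) ^ (k + l * n)) := by
        rw [mul_pow, pow_add, pow_mul]; ring
    _ ≤ n.factorial * (K + 1) ^ n * (Real.exp (-a * ‖x‖ ^ 2) * ((2 / a) ^ (k + l * n) *
        (k + l * n).factorial * Real.exp a * Real.exp (a * ‖x‖ ^ 2))) := by gcongr
    _ = n.factorial * (K + 1) ^ n * ((2 / a) ^ (k + l * n) * (k + l * n).factorial * Real.exp a) *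
        (Real.exp (-a * ‖x‖ ^ 2) * Real.exp (a * ‖x‖ ^ 2)) := by ring
    _ = _ := by rw [h4, mul_one]

/-- The Gaussian `x ↦ e^{-a|x|²}` as a real-valued Schwartz function. -/
noncomputable def realGaussian {a : ℝ} (ha : 0 < a) : 𝓢(V, ℝ) where
  toFun x := Real.exp (-a * ‖x‖ ^ 2)
  smooth' := Real.contDiff_exp.comp (contDiff_const.mul (contDiff_norm_sq ℝ))
  decay' := exists_decay_gaussian ha

/-- The Gaussian `x ↦ e^{-a|x|²}` as a Schwartz function. -/
noncomputable def gaussian {a : ℝ} (ha : 0 < a) : 𝓢(V, ℂ) :=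
  SchwartzMap.postcompCLM (𝕜 := ℝ) Complex.ofRealCLM (realGaussian ha)

theorem gaussian_apply {a : ℝ} (ha : 0 < a) (x : V) :
    gaussian ha x = (Real.exp (-a * ‖x‖ ^ 2) : ℂ) := rfl

theorem gaussian_ne_zero {a : ℝ} (ha : 0 < a) : (gaussian ha : 𝓢(V, ℂ)) ≠ 0 := by
  intro h
  have := congrArg (fun f : 𝓢(V, ℂ) => f 0) h
  simp [gaussian_apply] at this

variable [MeasurableSpace V] [BorelSpace V] [FiniteDimensional ℝ V]

/-- Translating by x/(1 + l) completes the square in the product of the two Gaussians. The Fourier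
transform of a centred Gaussian is left, times a phase. -/
theorem norm_stftFun_gaussian {l : ℝ} (hl : 0 < l) (z : WithLp 2 (V × V)) :
    ‖stftFun (gaussian Real.pi_pos) (gaussian (mul_pos Real.pi_pos hl)) z‖ =
      (1 + l)⁻¹ ^ ((Module.finrank ℝ V : ℝ) / 2) *
        (Real.exp (-(Real.pi * (l / (1 + l))) * ‖z.fst‖ ^ 2) *
          Real.exp (-(Real.pi / (1 + l)) * ‖z.snd‖ ^ 2)) := by
  have h1l : 0 < 1 + l := by linarith
  set x := z.fst
  set ξ := z.snd
  have key : stftFun (gaussian Real.pi_pos) (gaussian (mul_pos Real.pi_pos hl)) z =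
      (Real.exp (-(Real.pi * (l / (1 + l))) * ‖x‖ ^ 2) *
        Complex.exp (2 * Real.pi * Complex.I * ((-⟪ξ, (1 + l)⁻¹ • x⟫ : ℝ) : ℂ))) *
      ∫ t : V, Complex.exp (-((Real.pi * (1 + l) : ℝ) : ℂ) * ‖t‖ ^ 2 +
        -(2 * Real.pi * Complex.I) * ⟪ξ, t⟫) := by
    rw [stftFun, ← integral_add_right_eq_self _ ((1 + l)⁻¹ • x), ← integral_const_mul]
    refine integral_congr_ae (Filter.Eventually.of_forall fun t => ?_)
    beta_reduce
    rw [gaussian_apply, gaussian_apply, Complex.conj_ofReal, ← Complex.ofReal_mul,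
      ← Real.exp_add, Complex.ofReal_exp, ← Complex.exp_add, Complex.ofReal_exp,
      ← Complex.exp_add, ← Complex.exp_add]
    congr 1
    have e1 : ‖t + (1 + l)⁻¹ • x‖ ^ 2 = ‖t‖ ^ 2 + 2 * ((1 + l)⁻¹ * ⟪t, x⟫) +
        ((1 + l)⁻¹) ^ 2 * ‖x‖ ^ 2 := by
      rw [norm_add_sq_real, inner_smul_right, norm_smul, mul_pow, Real.norm_eq_abs, sq_abs]
    have e2 : ‖t + (1 + l)⁻¹ • x - x‖ ^ 2 = ‖t‖ ^ 2 + 2 * (((1 + l)⁻¹ - 1) * ⟪t, x⟫) +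
        ((1 + l)⁻¹ - 1) ^ 2 * ‖x‖ ^ 2 := by
      rw [show t + (1 + l)⁻¹ • x - x = t + ((1 + l)⁻¹ - 1) • x by rw [sub_smul, one_smul]; abel,
        norm_add_sq_real, inner_smul_right, norm_smul, mul_pow, Real.norm_eq_abs, sq_abs]
    have e3 : -(Real.pi * l) * ‖t + (1 + l)⁻¹ • x‖ ^ 2 +
        -Real.pi * ‖t + (1 + l)⁻¹ • x - x‖ ^ 2 =
        -(Real.pi * (l / (1 + l))) * ‖x‖ ^ 2 + -(Real.pi * (1 + l)) * ‖t‖ ^ 2 := by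
      rw [e1, e2]
      field_simp
      ring
    rw [e3, inner_add_right]
    push_cast
    ring
  have hre : 0 < (((Real.pi * (1 + l) : ℝ) : ℂ)).re := by
    rw [Complex.ofReal_re]; positivity
  rw [key, GaussianFourier.integral_cexp_neg_mul_sq_norm_add hre, norm_mul, norm_mul, norm_mul,
    norm_cexp_two_pi_mul, Complex.norm_real, Real.norm_of_nonneg (Real.exp_pos _).le, mul_one]
  have e1 : ((Real.pi : ℂ) / ((Real.pi * (1 + l) : ℝ) : ℂ)) ^ (Module.finrank ℝ V / 2 : ℂ) =
      (((1 + l)⁻¹ ^ ((Module.finrank ℝ V : ℝ) / 2) : ℝ) : ℂ) := by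
    rw [Complex.ofReal_cpow (by positivity)]
    congr 1
    · push_cast
      have : (1 + l : ℂ) ≠ 0 := by exact_mod_cast h1l.ne'
      have : (Real.pi : ℂ) ≠ 0 := by exact_mod_cast Real.pi_ne_zero
      field_simp
    · push_cast; rfl
  have e2 : (-(2 * Real.pi * Complex.I)) ^ 2 * ‖ξ‖ ^ 2 / (4 * ((Real.pi * (1 + l) : ℝ) : ℂ)) =
      ((-(Real.pi / (1 + l)) * ‖ξ‖ ^ 2 : ℝ) : ℂ) := by
    push_cast
    have : (1 + l : ℂ) ≠ 0 := by exact_mod_cast h1l.ne'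
    have : (Real.pi : ℂ) ≠ 0 := by exact_mod_cast Real.pi_ne_zero
    rw [neg_sq, mul_pow, Complex.I_sq]
    field_simp
    ring
  rw [e1, e2, Complex.norm_real, Real.norm_of_nonneg (by positivity), ← Complex.ofReal_exp,
    Complex.norm_real, Real.norm_of_nonneg (by positivity)]
  ring

end Gaussian

/-! ### Two-sided estimates for dilated Gaussians -/

section Sharpness

/-- Chebyshev's inequality; positivity of the measure is what makes the case p = ∞ true. -/
theorem mul_rpow_le_eLpNorm {X : Type*} [MeasurableSpace X] {μ : Measure X} {p : ℝ≥0∞} (hp : 1 ≤ p)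
    {S : Set X} (hS : MeasurableSet S) (h0 : μ S ≠ 0) {f : X → ℝ≥0∞} {c : ℝ≥0∞}
    (h : ∀ x ∈ S, c ≤ f x) : c * μ S ^ p⁻¹.toReal ≤ eLpNorm f p μ := by
  by_cases ht : p = ⊤
  · rw [ht, eLpNorm_ennreal_top, ENNReal.inv_top, ENNReal.toReal_zero, ENNReal.rpow_zero, mul_one]
    by_contra! hlt
    refine h0 (measure_mono_null (fun x hx => ?_) (ae_iff.1 (ENNReal.ae_le_essSup f)))
    exact not_le.2 (hlt.trans_le (h x hx))
  · have hp0 : p ≠ 0 := (zero_lt_one.trans_le hp).ne'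
    have hr := ENNReal.toReal_pos hp0 ht
    have h1 : c ^ p.toReal * μ S ≤ ∫⁻ x, f x ^ p.toReal ∂μ := by
      rw [← setLIntegral_const]
      exact (setLIntegral_mono' hS fun x hx => ENNReal.rpow_le_rpow (h x hx) hr.le).trans
        (setLIntegral_le_lintegral _ _)
    rw [eLpNorm_ennreal hp0 ht, ENNReal.toReal_inv, ← one_div]
    refine le_trans (le_of_eq ?_) (ENNReal.rpow_le_rpow h1 (by positivity))
    rw [ENNReal.mul_rpow_of_nonneg _ _ (by positivity), ← ENNReal.rpow_mul,
      mul_one_div_cancel hr.ne', ENNReal.rpow_one]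

variable {V : Type*} [NormedAddCommGroup V] [InnerProductSpace ℝ V] [MeasurableSpace V]
  [BorelSpace V] [FiniteDimensional ℝ V]

theorem eLpNorm_dilation (f : V → ℝ≥0∞) (p : ℝ≥0∞) {R : ℝ} (hR : 0 < R) :
    eLpNorm (fun x => f (R⁻¹ • x)) p volume =
      ENNReal.ofReal (R ^ Module.finrank ℝ V) ^ p⁻¹.toReal * eLpNorm f p volume := by
  have hR' : R⁻¹ ≠ 0 := (inv_pos.2 hR).ne'
  have h1 := (Homeomorph.smulOfNeZero (α := V) R⁻¹ hR').measurableEmbedding.eLpNorm_map_measure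
    (μ := volume) (g := f) (p := p)
  change eLpNorm f p (Measure.map (R⁻¹ • ·) volume) = _ at h1
  rw [Measure.map_addHaar_smul _ hR', inv_pow, inv_inv, abs_of_pos (by positivity),
    eLpNorm_smul_measure_of_ne_zero (by simpa using pow_pos hR _), one_div, smul_eq_mul] at h1
  rw [h1]
  rfl

/-- The dilated Gaussian `x ↦ e^{-π|x/R|²}`. -/
noncomputable def dilatedGaussian {R : ℝ} (hR : 0 < R) : 𝓢(V, ℂ) :=
  gaussian (mul_pos Real.pi_pos (inv_pos.2 (pow_pos hR 2)))

theorem norm_stft_dilatedGaussian {R : ℝ} (hR : 0 < R) (x ξ : V) :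
    ‖stft (gaussian Real.pi_pos) (dilatedGaussian (V := V) hR : 𝓢'(V, ℂ)) x ξ‖ =
      (1 + (R ^ 2)⁻¹)⁻¹ ^ ((Module.finrank ℝ V : ℝ) / 2) *
        (Real.exp (-(Real.pi * ((R ^ 2)⁻¹ / (1 + (R ^ 2)⁻¹))) * ‖x‖ ^ 2) *
          Real.exp (-(Real.pi / (1 + (R ^ 2)⁻¹)) * ‖ξ‖ ^ 2)) := by
  have h := stft_coe (gaussian Real.pi_pos) (dilatedGaussian hR) (WithLp.toLp 2 (x, ξ))
  rw [WithLp.toLp_fst, WithLp.toLp_snd] at h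
  rw [h, dilatedGaussian, norm_stftFun_gaussian (inv_pos.2 (pow_pos hR 2))]
  rfl

/-- Since l = R⁻² ≤ 1, the factor 1/(1 + l) is at least 1/2. This decouples the variables, with `R`
entering only through the dilation in `x`. -/
theorem enorm_stft_dilatedGaussian_le {R : ℝ} (hR : 0 < R) (h1 : 1 ≤ R) (x ξ : V) :
    ‖stft (gaussian Real.pi_pos) (dilatedGaussian (V := V) hR : 𝓢'(V, ℂ)) x ξ‖ₑ ≤
      ‖(gaussian Real.pi_div_two_pos : 𝓢(V, ℂ)) (R⁻¹ • x)‖ₑ *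
        ‖(gaussian Real.pi_div_two_pos : 𝓢(V, ℂ)) ξ‖ₑ := by
  rw [← ofReal_norm, ← ofReal_norm, ← ofReal_norm, ← ENNReal.ofReal_mul (norm_nonneg _),
    norm_stft_dilatedGaussian, gaussian_apply, gaussian_apply, Complex.norm_real, Complex.norm_real,
    Real.norm_of_nonneg (Real.exp_pos _).le, Real.norm_of_nonneg (Real.exp_pos _).le]
  refine ENNReal.ofReal_le_ofReal ?_
  have hl : 0 < (R ^ 2)⁻¹ := by positivity
  have hl1 : (R ^ 2)⁻¹ ≤ 1 := inv_le_one_of_one_le₀ (one_le_pow₀ h1)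
  rw [norm_smul, mul_pow, norm_inv, inv_pow, Real.norm_eq_abs, sq_abs]
  set l := (R ^ 2)⁻¹
  have hπ := Real.pi_pos
  have e0 : (1 + l)⁻¹ ^ ((Module.finrank ℝ V : ℝ) / 2) ≤ 1 :=
    Real.rpow_le_one (by positivity) (inv_le_one_of_one_le₀ (by linarith)) (by positivity)
  have e1 : l / 2 ≤ l / (1 + l) := by gcongr; linarith
  have e2 : Real.pi / 2 ≤ Real.pi / (1 + l) := by gcongr; linarith
  calc _ ≤ 1 * (Real.exp (-(Real.pi * (l / (1 + l))) * ‖x‖ ^ 2) *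
        Real.exp (-(Real.pi / (1 + l)) * ‖ξ‖ ^ 2)) := by gcongr
    _ ≤ 1 * (Real.exp (-(Real.pi * (l / 2)) * ‖x‖ ^ 2) *
        Real.exp (-(Real.pi / 2) * ‖ξ‖ ^ 2)) := by gcongr
    _ = _ := by rw [one_mul]; congr 2; ring

theorem exists_modulationNorm_dilatedGaussian_le {p : ℝ≥0∞} (hp : 1 ≤ p) : ∃ C : ℝ≥0,
    ∀ {R : ℝ} (hR : 0 < R), 1 ≤ R →
      modulationNorm (gaussian Real.pi_pos) p p (fun _ => 1)
        (dilatedGaussian (V := V) hR : 𝓢'(V, ℂ)) ≤ C * ENNReal.ofReal (R ^ Module.finrank ℝ V) ^ p⁻¹.toReal := by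
  let G : 𝓢(V, ℂ) := gaussian Real.pi_div_two_pos
  have hG : eLpNorm G p volume ≠ ⊤ := (G.memLp p volume).eLpNorm_ne_top
  refine ⟨(eLpNorm G p volume).toNNReal * (eLpNorm G p volume).toNNReal, fun {R} hR h1 => ?_⟩
  rw [ENNReal.coe_mul, ENNReal.coe_toNNReal hG]
  have ht : ENNReal.ofReal (R ^ Module.finrank ℝ V) ^ p⁻¹.toReal ≠ ⊤ :=
    ENNReal.rpow_ne_top_of_nonneg ENNReal.toReal_nonneg ENNReal.ofReal_ne_top
  unfold modulationNorm
  calc _ ≤ eLpNorm (fun ξ : V => eLpNorm (fun x : V => ‖G ξ‖ₑ * ‖G (R⁻¹ • x)‖ₑ) p volume) p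
        volume := by
        refine eLpNorm_ennreal_mono fun ξ => eLpNorm_ennreal_mono fun x => ?_
        rw [ENNReal.ofReal_one, mul_one, mul_comm ‖G ξ‖ₑ]
        exact enorm_stft_dilatedGaussian_le hR h1 x ξ
    _ = _ := by
        simp only [eLpNorm_ennreal_const_mul hp enorm_ne_top]
        rw [eLpNorm_dilation (fun x => ‖G x‖ₑ) p hR, eLpNorm_enorm]
        simp only [mul_comm (‖G _‖ₑ)]
        rw [eLpNorm_ennreal_const_mul hp (ENNReal.mul_ne_top ht hG), eLpNorm_enorm]
        ring

theorem exists_le_enorm_stft_dilatedGaussian : ∃ c : ℝ, 0 < c ∧ ∀ {R : ℝ} (hR : 0 < R), 1 ≤ R →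
    ∀ x ξ : V, ‖x‖ ≤ 2 * R → ‖ξ‖ ≤ 2 → ENNReal.ofReal c ≤
      ‖stft (gaussian Real.pi_pos) (dilatedGaussian (V := V) hR : 𝓢'(V, ℂ)) x ξ‖ₑ := by
  refine ⟨2⁻¹ ^ ((Module.finrank ℝ V : ℝ) / 2) * (Real.exp (-(Real.pi * 4)) *
    Real.exp (-(Real.pi * 4))), by positivity, fun {R} hR h1 x ξ hx hξ => ?_⟩
  rw [← ofReal_norm, norm_stft_dilatedGaussian]
  refine ENNReal.ofReal_le_ofReal ?_
  have hl : 0 < (R ^ 2)⁻¹ := by positivity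
  have hl1 : (R ^ 2)⁻¹ ≤ 1 := inv_le_one_of_one_le₀ (one_le_pow₀ h1)
  have hlx : (R ^ 2)⁻¹ * ‖x‖ ^ 2 ≤ 4 := by
    rw [inv_mul_le_iff₀ (by positivity)]
    calc ‖x‖ ^ 2 ≤ (2 * R) ^ 2 := by gcongr
      _ = _ := by ring
  have hξ2 : ‖ξ‖ ^ 2 ≤ 4 := by
    calc ‖ξ‖ ^ 2 ≤ 2 ^ 2 := by gcongr
      _ = 4 := by norm_num
  set l := (R ^ 2)⁻¹
  have hπ := Real.pi_pos
  have e1 : l / (1 + l) ≤ l := div_le_self hl.le (by linarith)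
  have e2 : Real.pi / (1 + l) ≤ Real.pi := div_le_self hπ.le (by linarith)
  gcongr
  · linarith
  · rw [neg_mul, neg_le_neg_iff]
    calc Real.pi * (l / (1 + l)) * ‖x‖ ^ 2 ≤ Real.pi * l * ‖x‖ ^ 2 := by gcongr
      _ = Real.pi * (l * ‖x‖ ^ 2) := by ring
      _ ≤ _ := by gcongr
  · rw [neg_mul, neg_le_neg_iff]
    gcongr

/-- The product of two closed balls. -/
def ballProd (c : V) (r : ℝ) (c' : V) (r' : ℝ) : Set (WithLp 2 (V × V)) :=
  WithLp.ofLp ⁻¹' (Metric.closedBall c r ×ˢ Metric.closedBall c' r')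

theorem measurableSet_ballProd (c : V) (r : ℝ) (c' : V) (r' : ℝ) :
    MeasurableSet (ballProd c r c' r') :=
  (WithLp.volume_preserving_ofLp V V).measurable
    (Metric.isClosed_closedBall.measurableSet.prod Metric.isClosed_closedBall.measurableSet)

theorem volume_ballProd (c c' : V) {r r' : ℝ} (hr : 0 ≤ r) (hr' : 0 ≤ r') :
    volume (ballProd c r c' r') =
      ENNReal.ofReal (r ^ Module.finrank ℝ V) * ENNReal.ofReal (r' ^ Module.finrank ℝ V) *
        volume (Metric.ball (0 : V) 1) ^ 2 := by
  rw [ballProd, (WithLp.volume_preserving_ofLp V V).measure_preimage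
    (Metric.isClosed_closedBall.measurableSet.prod
      Metric.isClosed_closedBall.measurableSet).nullMeasurableSet, Measure.volume_eq_prod,
    Measure.prod_prod, Measure.addHaar_closedBall _ _ hr, Measure.addHaar_closedBall _ _ hr']
  ring

end Sharpness

/-! ### Necessity of the exponent conditions -/

section Necessity

theorem le_of_forall_mul_rpow_le {c C : ℝ≥0∞} (hc : c ≠ 0) (hct : c ≠ ⊤) (hC : C ≠ ⊤) {n : ℕ}
    (hn : 0 < n) {a b : ℝ} (hb : 0 ≤ b) (h : ∀ R : ℝ, 1 ≤ R →
      c * ENNReal.ofReal (R ^ n) ^ a ≤ C * ENNReal.ofReal (R ^ n) ^ b) : a ≤ b := by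
  by_contra! hab
  have hab' : 0 < a - b := sub_pos.2 hab
  have hD : C / c ≠ ⊤ := ENNReal.div_ne_top hC hc
  set D := (C / c).toReal with hDdef
  have hD0 : 0 ≤ D := ENNReal.toReal_nonneg
  -- This value makes R^(a-b) exceed the supposed bound `D`, and `R ^ n` is at least `R`.
  set R := (D + 1) ^ (1 / (a - b)) with hR
  have hR1 : 1 ≤ R := Real.one_le_rpow (by linarith) (by positivity)
  set X := ENNReal.ofReal (R ^ n) with hX
  have hX0 : X ≠ 0 := by rw [hX]; simpa using (by positivity : (0 : ℝ) < R ^ n)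
  have hXt : X ≠ ⊤ := ENNReal.ofReal_ne_top
  have h1 : X ^ (a - b) ≤ C / c := by
    rw [ENNReal.le_div_iff_mul_le (Or.inl hc) (Or.inl hct)]
    have h2 := h R hR1
    rw [← hX, show a = (a - b) + b by ring, ENNReal.rpow_add _ _ hX0 hXt, ← mul_assoc] at h2
    have h3 := (ENNReal.mul_le_mul_iff_left
      (ENNReal.rpow_pos (pos_iff_ne_zero.2 hX0) hXt).ne' (ENNReal.rpow_ne_top_of_nonneg hb hXt)).1 h2
    rwa [mul_comm] at h3
  have h2 : ENNReal.ofReal (D + 1) ≤ X ^ (a - b) := by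
    calc ENNReal.ofReal (D + 1) = ENNReal.ofReal R ^ (a - b) := by
          rw [ENNReal.ofReal_rpow_of_nonneg (by positivity) hab'.le, hR,
            ← Real.rpow_mul (by positivity), one_div_mul_cancel hab'.ne', Real.rpow_one]
      _ ≤ X ^ (a - b) := ENNReal.rpow_le_rpow
          (ENNReal.ofReal_le_ofReal (le_self_pow₀ hR1 hn.ne')) hab'.le
  have h3 := h2.trans h1
  rw [← ENNReal.ofReal_toReal hD, ENNReal.ofReal_le_ofReal_iff ENNReal.toReal_nonneg] at h3
  linarith

variable {V : Type*} [NormedAddCommGroup V] [InnerProductSpace ℝ V] [MeasurableSpace V]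
  [BorelSpace V] [FiniteDimensional ℝ V]

/-- Both factors of the product formula are at least κ when z lies in a box of size max(R₁,R₂) × 1
and ζ in one of size 1 × min(R₁,R₂). Chebyshev is applied to the inner and then to the outer norm.
-/
theorem mul_rpow_le_wienerNorm {p q : ℝ≥0∞} (hp : 1 ≤ p) (hq : 1 ≤ q) {κ : ℝ} {R₁ R₂ : ℝ}
    (hκ : 0 ≤ κ) (hR₁ : 0 < R₁) (hR₂ : 0 < R₂) {g : 𝓢(V, ℂ)} {f₁ f₂ : 𝓢'(V, ℂ)}
    {F : 𝓢'(WithLp 2 (V × V), ℂ)} (hF : IsSTFT f₁ f₂ F)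
    (h₁ : ∀ x ξ : V, ‖x‖ ≤ 2 * R₁ → ‖ξ‖ ≤ 2 → ENNReal.ofReal κ ≤ ‖stft g f₁ x ξ‖ₑ)
    (h₂ : ∀ x ξ : V, ‖x‖ ≤ 2 * R₂ → ‖ξ‖ ≤ 2 → ENNReal.ofReal κ ≤ ‖stft g f₂ x ξ‖ₑ) :
    ENNReal.ofReal (κ * κ) *
        (ENNReal.ofReal (min R₁ R₂ ^ Module.finrank ℝ V) * volume (Metric.ball (0 : V) 1) ^ 2) ^
          p⁻¹.toReal *
        (ENNReal.ofReal (max R₁ R₂ ^ Module.finrank ℝ V) * volume (Metric.ball (0 : V) 1) ^ 2) ^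
          q⁻¹.toReal ≤
      wienerNorm (stftS g g) p q (fun _ => 1) F := by
  have hmin : 0 < min R₁ R₂ := lt_min hR₁ hR₂
  have hmax : 0 < max R₁ R₂ := lt_max_of_lt_left hR₁
  have hb : volume (Metric.ball (0 : V) 1) ≠ 0 :=
    (Metric.measure_ball_pos volume 0 one_pos).ne'
  have hv : ∀ r : ℝ, 0 < r →
      ENNReal.ofReal (r ^ Module.finrank ℝ V) * volume (Metric.ball (0 : V) 1) ^ 2 ≠ 0 :=
    fun r hr => mul_ne_zero (by simpa using pow_pos hr _) (pow_ne_zero 2 hb)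
  -- The ball for ζ₂ is centred so that the argument belonging to the narrower Gaussian is small;
  -- the other is then at most the sum of the radii, hence the factor 2.
  obtain ⟨c, hc⟩ : ∃ c : V → V, ∀ x y : V, ‖x‖ ≤ max R₁ R₂ → ‖y - c x‖ ≤ min R₁ R₂ →
      ‖-y - x‖ ≤ 2 * R₁ ∧ ‖-y‖ ≤ 2 * R₂ := by
    rcases le_total R₁ R₂ with hle | hle
    · refine ⟨fun x => -x, fun x y hx hy => ?_⟩
      rw [min_eq_left hle, sub_neg_eq_add] at hy
      rw [max_eq_right hle] at hx
      have e1 : ‖-y - x‖ = ‖y + x‖ := by rw [← norm_neg, neg_sub, sub_neg_eq_add, add_comm]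
      have e2 : ‖-y‖ ≤ ‖y + x‖ + ‖x‖ := by
        rw [norm_neg]
        simpa using norm_sub_le (y + x) x
      exact ⟨by linarith, by linarith⟩
    · refine ⟨fun x => 0, fun x y hx hy => ?_⟩
      rw [min_eq_right hle, sub_zero] at hy
      rw [max_eq_left hle] at hx
      have e1 := norm_sub_le (-y) x
      rw [norm_neg] at e1
      rw [norm_neg]
      exact ⟨by linarith, by linarith⟩
  have hS : ∀ z : WithLp 2 (V × V), volume (ballProd 0 1 (c z.fst) (min R₁ R₂)) =
      ENNReal.ofReal (min R₁ R₂ ^ Module.finrank ℝ V) * volume (Metric.ball (0 : V) 1) ^ 2 :=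
    fun z => by rw [volume_ballProd _ _ zero_le_one hmin.le]; simp
  have hS' : volume (ballProd (0 : V) (max R₁ R₂) 0 1) =
      ENNReal.ofReal (max R₁ R₂ ^ Module.finrank ℝ V) * volume (Metric.ball (0 : V) 1) ^ 2 := by
    rw [volume_ballProd _ _ hmax.le zero_le_one]; simp
  rw [← hS']
  refine mul_rpow_le_eLpNorm hq (measurableSet_ballProd _ _ _ _) (hS' ▸ hv _ hmax) fun z hz => ?_
  rw [ENNReal.ofReal_one, mul_one, ← hS z]
  refine mul_rpow_le_eLpNorm hp (measurableSet_ballProd _ _ _ _) (hS z ▸ hv _ hmin) fun ζ hζ => ?_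
  obtain ⟨hz1, hz2⟩ := hz
  obtain ⟨hζ1, hζ2⟩ := hζ
  simp only [WithLp.ofLp_fst, WithLp.ofLp_snd, mem_closedBall_iff_norm, sub_zero] at hz1 hz2 hζ1 hζ2
  rw [hF.enorm_stft_eq, ENNReal.ofReal_mul hκ]
  obtain ⟨k1, k2⟩ := hc _ _ hz1 hζ2
  exact mul_le_mul' (h₁ _ _ k1 (by linarith))
    (h₂ _ _ k2 ((norm_add_le _ _).trans (by linarith)))

/-- Necessity of the conditions on the exponents. -/
theorem exponents_le_of_wienerNorm_le [Nontrivial V] {p₁ p₂ p q : ℝ≥0∞} (hp₁ : 1 ≤ p₁)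
    (hp₂ : 1 ≤ p₂) (hp : 1 ≤ p) (hq : 1 ≤ q) (g₁ g₂ : 𝓢(V, ℂ)) {Φ : 𝓢(WithLp 2 (V × V), ℂ)}
    (hΦ : Φ ≠ 0) {C : ℝ≥0} (hC : ∀ f₁ f₂ : 𝓢(V, ℂ),
      wienerNorm Φ p q (fun _ => 1) (stftS f₁ f₂ : 𝓢'(WithLp 2 (V × V), ℂ)) ≤
        C * modulationNorm g₁ p₁ p₁ (fun _ => 1) (f₁ : 𝓢'(V, ℂ)) *
          modulationNorm g₂ p₂ p₂ (fun _ => 1) (f₂ : 𝓢'(V, ℂ))) :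
    p₁ ≤ q ∧ p₂ ≤ q ∧ p⁻¹ + q⁻¹ ≤ p₁⁻¹ + p₂⁻¹ := by
  set γ : 𝓢(V, ℂ) := gaussian Real.pi_pos with hγdef
  have hγ : γ ≠ 0 := gaussian_ne_zero _
  set n := Module.finrank ℝ V
  have hn : 0 < n := Module.finrank_pos
  obtain ⟨D₁, hD₁⟩ := exists_modulationNorm_le hγ g₁ hp₁ le_rfl hp₁ le_rfl
    (isModerate_one (V := V)) (m := fun _ => 1) (fun _ => zero_le_one) continuous_const
  obtain ⟨D₂, hD₂⟩ := exists_modulationNorm_le hγ g₂ hp₂ le_rfl hp₂ le_rfl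
    (isModerate_one (V := V)) (m := fun _ => 1) (fun _ => zero_le_one) continuous_const
  obtain ⟨D₃, hD₃⟩ := exists_wienerNorm_le hΦ (stftS γ γ) hp le_rfl hq
    (isModerate_one (V := WithLp 2 (V × V))) (w := fun _ => 1) (fun _ => zero_le_one)
    continuous_const
  obtain ⟨K₁, hK₁⟩ := exists_modulationNorm_dilatedGaussian_le (V := V) hp₁
  obtain ⟨K₂, hK₂⟩ := exists_modulationNorm_dilatedGaussian_le (V := V) hp₂
  obtain ⟨κ, hκ, hlow⟩ := exists_le_enorm_stft_dilatedGaussian (V := V)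
  set b := volume (Metric.ball (0 : V) 1)
  have hb : b ≠ 0 := (Metric.measure_ball_pos volume 0 one_pos).ne'
  have hbt : b ≠ ⊤ := measure_ball_lt_top.ne
  set c : ℝ≥0∞ := ENNReal.ofReal (κ * κ) * (b ^ 2) ^ p⁻¹.toReal * (b ^ 2) ^ q⁻¹.toReal
  set M : ℝ≥0∞ := D₃ * (C * (D₁ * K₁) * (D₂ * K₂))
  have hb2 : b ^ 2 ≠ 0 := pow_ne_zero 2 hb
  have hbt2 : b ^ 2 ≠ ⊤ := ENNReal.pow_ne_top hbt
  have hc0 : c ≠ 0 := by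
    refine mul_ne_zero (mul_ne_zero ?_ (ENNReal.rpow_pos (pos_iff_ne_zero.2 hb2) hbt2).ne')
      (ENNReal.rpow_pos (pos_iff_ne_zero.2 hb2) hbt2).ne'
    simpa using mul_pos hκ hκ
  have hct : c ≠ ⊤ := ENNReal.mul_ne_top (ENNReal.mul_ne_top ENNReal.ofReal_ne_top
    (ENNReal.rpow_ne_top_of_nonneg ENNReal.toReal_nonneg hbt2))
    (ENNReal.rpow_ne_top_of_nonneg ENNReal.toReal_nonneg hbt2)
  have hM : M ≠ ⊤ := by
    simp only [M, ← ENNReal.coe_mul]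
    exact ENNReal.coe_ne_top
  have main : ∀ R₁ R₂ : ℝ, 1 ≤ R₁ → 1 ≤ R₂ →
      c * (ENNReal.ofReal (min R₁ R₂ ^ n) ^ p⁻¹.toReal *
        ENNReal.ofReal (max R₁ R₂ ^ n) ^ q⁻¹.toReal) ≤
      M * (ENNReal.ofReal (R₁ ^ n) ^ p₁⁻¹.toReal * ENNReal.ofReal (R₂ ^ n) ^ p₂⁻¹.toReal) := by
    intro R₁ R₂ h1 h2
    have hR₁ : 0 < R₁ := by linarith
    have hR₂ : 0 < R₂ := by linarith
    have e1 := mul_rpow_le_wienerNorm hp hq hκ.le hR₁ hR₂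
      (isSTFT_stftS (dilatedGaussian (V := V) hR₁) (dilatedGaussian (V := V) hR₂))
      (hlow hR₁ h1) (hlow hR₂ h2)
    have e2 := hD₃ (stftS (dilatedGaussian (V := V) hR₁) (dilatedGaussian (V := V) hR₂))
    have e3 := hC (dilatedGaussian hR₁) (dilatedGaussian hR₂)
    have e4 := (hD₁ (dilatedGaussian (V := V) hR₁)).trans (mul_le_mul' le_rfl (hK₁ hR₁ h1))
    have e5 := (hD₂ (dilatedGaussian (V := V) hR₂)).trans (mul_le_mul' le_rfl (hK₂ hR₂ h2))
    rw [ENNReal.mul_rpow_of_nonneg _ _ ENNReal.toReal_nonneg,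
      ENNReal.mul_rpow_of_nonneg _ _ ENNReal.toReal_nonneg] at e1
    refine le_trans (le_of_eq ?_) (e1.trans (e2.trans ?_))
    · simp only [c, b, n]
      ring
    calc _
      _ ≤ D₃ * (C * (D₁ * (K₁ * ENNReal.ofReal (R₁ ^ n) ^ p₁⁻¹.toReal)) *
          (D₂ * (K₂ * ENNReal.ofReal (R₂ ^ n) ^ p₂⁻¹.toReal))) := by
          refine mul_le_mul' le_rfl (e3.trans ?_)
          gcongr
      _ = _ := by ring
  have hfin : ∀ {r : ℝ≥0∞}, 1 ≤ r → r⁻¹ ≠ ⊤ := fun hr =>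
    ENNReal.inv_ne_top.2 (zero_lt_one.trans_le hr).ne'
  -- The widths (R, 1), (1, R) and (R, R) isolate 1/q ≤ 1/p₁, 1/q ≤ 1/p₂ and the sum condition.
  refine ⟨?_, ?_, ?_⟩
  · rw [← ENNReal.inv_le_inv, ← ENNReal.toReal_le_toReal (hfin hq) (hfin hp₁)]
    refine le_of_forall_mul_rpow_le hc0 hct hM hn ENNReal.toReal_nonneg fun R hR => ?_
    simpa [min_eq_right hR, max_eq_left hR] using main R 1 hR le_rfl
  · rw [← ENNReal.inv_le_inv, ← ENNReal.toReal_le_toReal (hfin hq) (hfin hp₂)]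
    refine le_of_forall_mul_rpow_le hc0 hct hM hn ENNReal.toReal_nonneg fun R hR => ?_
    simpa [min_eq_left hR, max_eq_right hR] using main 1 R le_rfl hR
  · rw [← ENNReal.toReal_le_toReal (ENNReal.add_ne_top.2 ⟨hfin hp, hfin hq⟩)
      (ENNReal.add_ne_top.2 ⟨hfin hp₁, hfin hp₂⟩), ENNReal.toReal_add (hfin hp) (hfin hq),
      ENNReal.toReal_add (hfin hp₁) (hfin hp₂)]
    refine le_of_forall_mul_rpow_le hc0 hct hM hn (by positivity) fun R hR => ?_
    rw [ENNReal.rpow_add_of_nonneg _ _ ENNReal.toReal_nonneg ENNReal.toReal_nonneg,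
      ENNReal.rpow_add_of_nonneg _ _ ENNReal.toReal_nonneg ENNReal.toReal_nonneg]
    simpa using main R R hR hR

end Necessity
end TimeFreq

theorem corollary4p3 (d : ℕ) (hd : 0 < d) (p₁ p₂ p q : ℝ≥0∞)
    (hp₁ : 1 ≤ p₁) (hp₂ : 1 ≤ p₂) (hp : 1 ≤ p) (hq : 1 ≤ q)
    -- the windows with which the norms are computed
    (g₁ g₂ : 𝓢(EuclideanSpace ℝ (Fin d), ℂ)) (hg₁ : g₁ ≠ 0) (hg₂ : g₂ ≠ 0)
    (Φ : 𝓢(WithLp 2 (EuclideanSpace ℝ (Fin d) × EuclideanSpace ℝ (Fin d)), ℂ)) (hΦ : Φ ≠ 0) :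
    ((p₁ ≤ q ∧ p₂ ≤ q ∧ p⁻¹ + q⁻¹ ≤ p₁⁻¹ + p₂⁻¹) →
      ∀ s : ℝ, ∃ C : ℝ≥0, ∀ f₁ f₂ : 𝓢'(EuclideanSpace ℝ (Fin d), ℂ),
        MemModulation g₁ p₁ p₁ (weight |s|) f₁ → MemModulation g₂ p₂ p₂ (weight s) f₂ →
        ∃ F, IsSTFT f₁ f₂ F ∧ (∀ F', IsSTFT f₁ f₂ F' → F' = F) ∧
          MemWiener Φ p q (weight s) F ∧
          wienerNorm Φ p q (weight s) F ≤
            C * modulationNorm g₁ p₁ p₁ (weight |s|) f₁ * modulationNorm g₂ p₂ p₂ (weight s) f₂) ∧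
    ((∃ C : ℝ≥0, ∀ f₁ f₂ : 𝓢(EuclideanSpace ℝ (Fin d), ℂ),
        wienerNorm Φ p q (fun _ => 1) (stftS f₁ f₂ : 𝓢'(_, ℂ)) ≤
          C * modulationNorm g₁ p₁ p₁ (fun _ => 1) (f₁ : 𝓢'(_, ℂ)) *
            modulationNorm g₂ p₂ p₂ (fun _ => 1) (f₂ : 𝓢'(_, ℂ))) →
      p₁ ≤ q ∧ p₂ ≤ q ∧ p⁻¹ + q⁻¹ ≤ p₁⁻¹ + p₂⁻¹) := by
  -- Positive dimension makes the space nontrivial, so that R^d is unbounded in the dilation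
  -- argument.
  have : Nonempty (Fin d) := ⟨⟨0, hd⟩⟩
  refine ⟨fun ⟨h₁, h₂, h⟩ s =>
    exists_isSTFT_wienerNorm_le hp₁ hp₂ hp hq hg₁ hg₂ Φ h₁ h₂ h s, fun ⟨C, hC⟩ => ?_⟩
  exact exponents_le_of_wienerNorm_le hp₁ hp₂ hp hq g₁ g₂ hΦ hC
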